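/- Let $(M,g)$ be a connected oriented four-dimensional space-time: a connected smooth 4-manifold, oriented by its atlas, with a smooth metric $g$ of signature $(-,+,+,+)$, Levi-Civita connection $\nabla$, metric volume element $\eta$, Riemann tensor $R_{\alpha\beta\gamma\delta}$ and Ricci tensor $Ric$. For a 2-form $A$ put $(*A)_{\alpha\beta}=\frac12\eta_{\alpha\beta\gamma\delta}A^{\gamma\delta}$, $(\delta A)_\beta=-\nabla_\alpha A^{\alpha}{}_{\beta}$ (also regarded as a vector field by raising its index), $(A,B)=\frac12A_{\alpha\beta}B^{\alpha\beta}$, and for 2-tensors $P,Q$ put $[P,Q]^\alpha{}_\beta=P^\alpha{}_\mu Q^\mu{}_\beta-Q^\alpha{}_\mu P^\mu{}_\beta$. Assume that $(M,g)$ is not of constant curvature, i.e. there is no constant $K$ with $R_{\alpha\beta\gamma\delta}=K(g_{\alpha\gamma}g_{\beta\delta}-g_{\alpha\delta}g_{\beta\gamma})$ on all of $M$. Let $A$ be a smooth 2-form on $M$ such that - $A$ is a conformal Killing-Yano tensor: $3(\nabla_\alpha A_{\beta\gamma}+\nabla_\beta A_{\alpha\gamma})=g_{\alpha\gamma}(\delta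 A)_\beta+g_{\beta\gamma}(\delta A)_\alpha-2g_{\alpha\beta}(\delta A)_\gamma$; - $A$ is non null: at each point of $M$, $(A,A)\neq0$ or $(A,*A)\neq0$; - $[A,Ric]=[*A,Ric]=0$. Then the vector fields $Z_1=\delta A$ and $Z_2=\delta{*A}$ are Killing vector fields (possibly identically zero), $\mathcal L_{Z_1}g=\mathcal L_{Z_2}g=0$, and: (i) $A$ is invariant under both: $\mathcal L_{Z_1}A=\mathcal L_{Z_2}A=0$; (ii) if $Z_1\wedge Z_2$ is not identically zero, then $[Z_1,Z_2]=0$ on $M$. -/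

import Mathlib

open scoped Manifold ContDiff

noncomputable section

namespace CKY

/-- The model space of a four-dimensional manifold. -/
abbrev E4 : Type := EuclideanSpace ℝ (Fin 4)

/-! ### Tensor calculus in one coordinate system

Component functions live on (an open part of) `E4`. The matrix-valued function `G` holds the
components `g_{ab}` of the metric, and `T` the components `T_{ab}` of a covariant 2-tensor. -/

/-- A matrix-valued function: the components of a covariant 2-tensor field in a chart. -/
abbrev Comp2 : Type := E4 → Matrix (Fin 4) (Fin 4) ℝ

/-- The partial derivative `∂_a f`. -/
def pd (a : Fin 4) (f : E4 → ℝ) (y : E4) : ℝ :=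
  fderiv ℝ f y (EuclideanSpace.single a 1)

/-- The Christoffel symbols `Γ^a_{bc}` of the Levi-Civita connection. -/
def christoffel (G : Comp2) (a b c : Fin 4) (y : E4) : ℝ :=
  (1 / 2) * ∑ d, (G y)⁻¹ a d *
    (pd b (fun z => G z d c) y + pd c (fun z => G z d b) y - pd d (fun z => G z b c) y)

/-- The Riemann tensor
`R^a_{bcd} = ∂_c Γ^a_{bd} - ∂_d Γ^a_{bc} + Γ^e_{bd} Γ^a_{ec} - Γ^e_{bc} Γ^a_{ed}`. -/
def riemannUp (G : Comp2) (a b c d : Fin 4) (y : E4) : ℝ :=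
  pd c (christoffel G a b d) y - pd d (christoffel G a b c) y
    + ∑ e, (christoffel G e b d y * christoffel G a e c y
      - christoffel G e b c y * christoffel G a e d y)

/-- The covariant Riemann tensor `R_{abcd} = g_{ae} R^e_{bcd}`. -/
def riemann (G : Comp2) (a b c d : Fin 4) (y : E4) : ℝ :=
  ∑ e, G y a e * riemannUp G e b c d y

/-- The Ricci tensor `R_{ab} = R^c_{acb}`. -/
def ricci (G : Comp2) : Comp2 := fun y a b => ∑ c, riemannUp G c a c b y

/-- The covariant derivative `∇_a T_{bc}`. -/
def covDeriv (G T : Comp2) (a b c : Fin 4) (y : E4) : ℝ :=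
  pd a (fun z => T z b c) y
    - ∑ d, (christoffel G d a b y * T y d c + christoffel G d a c y * T y b d)

/-- The codifferential, as a 1-form: `(δT)_b = -∇_a T^a_b`. -/
def codiff (G T : Comp2) (b : Fin 4) (y : E4) : ℝ :=
  - ∑ a, ∑ d, (G y)⁻¹ a d * covDeriv G T a d b y

/-- The codifferential, as a vector field: `(δT)^a = g^{ab} (δT)_b`. -/
def codiffVec (G T : Comp2) (y : E4) : E4 :=
  WithLp.toLp 2 fun a => ∑ b, (G y)⁻¹ a b * codiff G T b y

/-- The Levi-Civita symbol, with `leviCivita 0 1 2 3 = 1`. -/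
def leviCivita (a b c d : Fin 4) : ℝ :=
  (Matrix.of fun i j : Fin 4 => if ![a, b, c, d] i = j then (1 : ℝ) else 0).det

/-- The metric volume element `η_{abcd}` in a positively oriented chart. -/
def volumeElement (G : Comp2) (a b c d : Fin 4) (y : E4) : ℝ :=
  Real.sqrt |(G y).det| * leviCivita a b c d

/-- The components `T^{ab}` with both indices raised. -/
def raise (G T : Comp2) : Comp2 := fun y a b =>
  ∑ c, ∑ d, (G y)⁻¹ a c * (G y)⁻¹ b d * T y c d

/-- The Hodge dual of a 2-form: `(*T)_{ab} = (1/2) η_{abcd} T^{cd}`. -/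
def hodge (G T : Comp2) : Comp2 := fun y a b =>
  (1 / 2) * ∑ c, ∑ d, volumeElement G a b c d y * raise G T y c d

/-- The scalar product `(S, T) = (1/2) S_{ab} T^{ab}`. -/
def pairing (G S T : Comp2) (y : E4) : ℝ :=
  (1 / 2) * ∑ a, ∑ b, S y a b * raise G T y a b

/-- The product `(S · T)_{ab} = S_{am} T^m_b`. -/
def dotProd (G S T : Comp2) : Comp2 := fun y => S y * (G y)⁻¹ * T y

/-- The commutator `[S, T] = S · T - T · S`. -/
def commutator (G S T : Comp2) : Comp2 := fun y => dotProd G S T y - dotProd G T S y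

/-- The Lie derivative
`(L_Z T)_{ab} = Z^c ∂_c T_{ab} + T_{cb} ∂_a Z^c + T_{ac} ∂_b Z^c`. -/
def lieDeriv (Z : E4 → E4) (T : Comp2) : Comp2 := fun y a b =>
  ∑ c, (Z y c * pd c (fun z => T z a b) y + T y c b * pd a (fun z => Z z c) y
    + T y a c * pd b (fun z => Z z c) y)

/-! ### Tensor fields on a manifold -/

variable (M : Type*) [TopologicalSpace M] [ChartedSpace E4 M] [IsManifold (𝓡 4) ∞ M]

/-- A smooth field of bilinear forms on the tangent spaces of `M`. -/
structure BilinField where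
  /-- The bilinear form at each point. -/
  form (x : M) : TangentSpace (𝓡 4) x →L[ℝ] TangentSpace (𝓡 4) x →L[ℝ] ℝ
  contMDiff : ContMDiff (𝓡 4) ((𝓡 4).prod 𝓘(ℝ, E4 →L[ℝ] E4 →L[ℝ] ℝ)) ∞
    (fun x => Bundle.TotalSpace.mk' (E4 →L[ℝ] E4 →L[ℝ] ℝ) x (form x))

/-- A smooth Lorentzian metric of signature `(-,+,+,+)`. -/
structure LorentzMetric extends BilinField M where
  symm (x : M) (v w : TangentSpace (𝓡 4) x) : form x v w = form x w v
  signature (x : M) : ∃ b : Module.Basis (Fin 4) ℝ (TangentSpace (𝓡 4) x),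
    ∀ i j, form x (b i) (b j) = Matrix.diagonal ![(-1 : ℝ), 1, 1, 1] i j

/-- A smooth 2-form. -/
structure TwoForm extends BilinField M where
  antisymm (x : M) (v w : TangentSpace (𝓡 4) x) : form x v w = - form x w v

/-- The manifold is oriented by its atlas: all changes of chart have positive Jacobian. -/
def IsOrientedAtlas (M : Type*) [TopologicalSpace M] [ChartedSpace E4 M] : Prop :=
  ∀ e ∈ atlas E4 M, ∀ e' ∈ atlas E4 M, ∀ y ∈ (e.symm.trans e').source,
    0 < LinearMap.det (fderiv ℝ (e.symm.trans e') y : E4 →ₗ[ℝ] E4)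

variable {M}

/-- The coordinate vector `∂_a` of the chart `e` at the point with coordinates `y`. -/
def coordVec (e : OpenPartialHomeomorph M E4) (a : Fin 4) (y : E4) :
    TangentSpace (𝓡 4) (e.symm y) :=
  mfderiv (𝓡 4) (𝓡 4) e.symm y (EuclideanSpace.single a (1 : ℝ) : E4)

/-- The components `B(∂_a, ∂_b)` of `B` in the chart `e`, as functions of the coordinates. -/
def BilinField.comp (B : BilinField M) (e : OpenPartialHomeomorph M E4) : Comp2 :=
  fun y a b => B.form (e.symm y) (coordVec e a y) (coordVec e b y)

/-- The components of the metric in the chart `e`. -/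
abbrev LorentzMetric.comp (g : LorentzMetric M) (e : OpenPartialHomeomorph M E4) : Comp2 :=
  g.toBilinField.comp e

/-- The components of the 2-form in the chart `e`. -/
abbrev TwoForm.comp (A : TwoForm M) (e : OpenPartialHomeomorph M E4) : Comp2 :=
  A.toBilinField.comp e

/-- The metric has constant curvature: `R_{abcd} = K (g_{ac} g_{bd} - g_{ad} g_{bc})` with a
constant `K`. -/
def HasConstantCurvature (g : LorentzMetric M) : Prop :=
  ∃ K : ℝ, ∀ e ∈ atlas E4 M, ∀ y ∈ e.target, ∀ a b c d,
    riemann (g.comp e) a b c d y =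
      K * (g.comp e y a c * g.comp e y b d - g.comp e y a d * g.comp e y b c)

/-- `A` is a conformal Killing-Yano tensor:
`3 (∇_a A_{bc} + ∇_b A_{ac}) = g_{ac} Z_b + g_{bc} Z_a - 2 g_{ab} Z_c` with `Z = δA`. -/
def IsCKY (g : LorentzMetric M) (A : TwoForm M) : Prop :=
  ∀ e ∈ atlas E4 M, ∀ y ∈ e.target, ∀ a b c,
    3 * (covDeriv (g.comp e) (A.comp e) a b c y + covDeriv (g.comp e) (A.comp e) b a c y) =
      g.comp e y a c * codiff (g.comp e) (A.comp e) b y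
        + g.comp e y b c * codiff (g.comp e) (A.comp e) a y
        - 2 * g.comp e y a b * codiff (g.comp e) (A.comp e) c y

/-- `A` is non null at every point: `(A, A)` and `(A, *A)` do not both vanish. Equivalently, the
self-dual 2-form `(A - i *A) / √2` has non-zero square `(A, A) - i (A, *A)`. -/
def IsNonNull (g : LorentzMetric M) (A : TwoForm M) : Prop :=
  ∀ e ∈ atlas E4 M, ∀ y ∈ e.target,
    pairing (g.comp e) (A.comp e) (A.comp e) y ≠ 0 ∨
      pairing (g.comp e) (A.comp e) (hodge (g.comp e) (A.comp e)) y ≠ 0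

/-- `[A, Ric] = 0` and `[*A, Ric] = 0`. -/
def CommutesWithRicci (g : LorentzMetric M) (A : TwoForm M) : Prop :=
  ∀ e ∈ atlas E4 M, ∀ y ∈ e.target,
    commutator (g.comp e) (A.comp e) (ricci (g.comp e)) y = 0 ∧
      commutator (g.comp e) (hodge (g.comp e) (A.comp e)) (ricci (g.comp e)) y = 0

/-- The vector field `Z₁ = δA` in the chart `e`. -/
def Z1 (g : LorentzMetric M) (A : TwoForm M) (e : OpenPartialHomeomorph M E4) : E4 → E4 :=
  codiffVec (g.comp e) (A.comp e)

/-- The vector field `Z₂ = δ*A` in the chart `e`. -/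
def Z2 (g : LorentzMetric M) (A : TwoForm M) (e : OpenPartialHomeomorph M E4) : E4 → E4 :=
  codiffVec (g.comp e) (hodge (g.comp e) (A.comp e))

end CKY

end

/-! Write u = Z₁ and w = Z₂. The conformal Killing-Yano equation says that the part of 3∇_a A_{bc}
symmetric in a, b is pure trace. Once the trace is removed a 3-form is left, and in dimension four
this is η contracted with a vector. Hence 3∇_a A_{bc} = g_{ac} u_b − g_{ab} u_c + η_{abcd} w^d
(`PairEq`), and *A solves the same equation with (w, −u) in place of (u, w).

Differentiating once more and antisymmetrising (`Normal.integrability`) relates the action of the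
curvature on A to ∇u and ∇w. Contracted and symmetrised, the curvature terms reduce to the
commutator [A, Ric] and what remains is the Killing equation for u (`Normal.killingEq_of_pairEq`);
duality gives it for w. A Killing vector Z preserves g, ∇ and η, so L_Z A again satisfies the pair
equation, with the Killing vectors [Z, u] and [Z, w] (`Normal.pairEq_lieDeriv`).

Encode a 2-form as a vector α in ℂ³: commutators become cross products, the Hodge dual becomes
multiplication by −i, and non null means α·α ≠ 0. For Killing u, w the integrability condition reads
α × W_l = ν × e_l and α × P_l = 0, where W is the complex self-dual block of the curvature and P the
mixed block. Two ℂ-independent solutions, one of them non null, force W = κ·1 and P = 0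
(`cross_rigidity`); the first Bianchi identity makes κ real, and the curvature is constant at the
point.

So at points of non-constant curvature L_Z A = fA + g*A. Comparing pair equations shows df = dg = 0
and [Z, u] = fu + gw. For Z = u this gives fu + gw = 0, while contracting the pair equation yields
L_w A = gA − f*A. Therefore 0 = L_{fu+gw} A = (f² + g²)A with A ≠ 0, and f = g = 0
(`MetricOn.lieDeriv_eq_zero`).

Schur's lemma and connectedness provide a point, hence an open set, of non-constant curvature. The
1-jet of a Killing vector and the value of a parallel tensor propagate by closed linear systems, so
the vanishing of L_Z A spreads over M (`invariantAt_chart`). Finally [Z₁, Z₂] is the vector δ* of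
L_{Z₁} A, which is zero.

All pointwise computations take place at the origin of normal coordinates, where Γ = 0. They are
carried elsewhere by naturality under orientation-preserving maps (`CoordMap`). -/

namespace CKY

noncomputable section

open Matrix

/-! ### Calculus of matrix-valued functions: derivatives, Jacobians, smoothness. -/

/-- The coordinate basis vectors. -/
abbrev bv (a : Fin 4) : E4 := EuclideanSpace.single a 1

/-- All entries are differentiable at `x`. -/
def DiffM (F : Comp2) (x : E4) : Prop := ∀ i j, DifferentiableAt ℝ (fun z => F z i j) x

/-- The entrywise derivative in direction `v`. -/
def dM (v : E4) (F : Comp2) : Comp2 :=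
  fun x => Matrix.of fun i j => fderiv ℝ (fun z => F z i j) x v

lemma dM_apply (v : E4) (F : Comp2) (x : E4) (i j : Fin 4) :
    dM v F x i j = fderiv ℝ (fun z => F z i j) x v := rfl

lemma dM_bv (a : Fin 4) (F : Comp2) (x : E4) (i j : Fin 4) :
    dM (bv a) F x i j = pd a (fun z => F z i j) x := rfl

lemma DiffM.mul {F H : Comp2} {x : E4} (hF : DiffM F x) (hH : DiffM H x) :
    DiffM (fun z => F z * H z) x := by
  intro i j
  simp only [Matrix.mul_apply]
  exact DifferentiableAt.fun_sum fun k _ => (hF i k).mul (hH k j)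

lemma DiffM.transpose {F : Comp2} {x : E4} (hF : DiffM F x) : DiffM (fun z => (F z)ᵀ) x :=
  fun i j => hF j i

lemma dM_mul {F H : Comp2} {x : E4} (hF : DiffM F x) (hH : DiffM H x) (v : E4) :
    dM v (fun z => F z * H z) x = dM v F x * H x + F x * dM v H x := by
  ext i j
  simp only [dM_apply, Matrix.mul_apply, Matrix.add_apply]
  have hd : ∀ k ∈ Finset.univ, DifferentiableAt ℝ (fun z => F z i k * H z k j) x :=
    fun k _ => (hF i k).fun_mul (hH k j)
  rw [fderiv_fun_sum hd, ← Finset.sum_add_distrib]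
  simp only [_root_.sum_apply]
  refine Finset.sum_congr rfl fun k _ => ?_
  rw [fderiv_fun_mul (hF i k) (hH k j)]
  simp only [_root_.add_apply, _root_.smul_apply, smul_eq_mul]
  ring

lemma dM_transpose (F : Comp2) (x v : E4) : dM v (fun z => (F z)ᵀ) x = (dM v F x)ᵀ := rfl

lemma dM_add {F H : Comp2} {x : E4} (hF : DiffM F x) (hH : DiffM H x) (v : E4) :
    dM v (fun z => F z + H z) x = dM v F x + dM v H x := by
  ext i j
  simp only [dM_apply, Matrix.add_apply]
  rw [fderiv_fun_add (hF i j) (hH i j)]; rfl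

lemma dM_congr {F H : Comp2} {x : E4} (h : F =ᶠ[nhds x] H) (v : E4) : dM v F x = dM v H x := by
  ext i j
  simp only [dM_apply]
  have h' : (fun z => F z i j) =ᶠ[nhds x] fun z => H z i j := h.mono fun z hz => by simp only [hz]
  rw [h'.fderiv_eq]

lemma sum_bv (v : E4) : v = ∑ k, v k • bv k := by
  ext i
  simp [Finset.sum_apply, Pi.single_apply]

lemma fderiv_eq_sum_pd (f : E4 → ℝ) (x v : E4) : fderiv ℝ f x v = ∑ k, v k * pd k f x := by
  conv_lhs => rw [sum_bv v]
  simp [pd]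

/-- The Jacobian matrix. -/
def jac (φ : E4 → E4) : Comp2 := fun x => Matrix.of fun i a => pd a (fun z => φ z i) x

lemma jac_apply (φ : E4 → E4) (x : E4) (i a : Fin 4) :
    jac φ x i a = pd a (fun z => φ z i) x := rfl

lemma fderiv_coord {φ : E4 → E4} {x : E4} (h : DifferentiableAt ℝ φ x) (v : E4) (i : Fin 4) :
    fderiv ℝ (fun z => φ z i) x v = (fderiv ℝ φ x v) i := by
  have : HasFDerivAt (fun z => φ z i)
      ((EuclideanSpace.proj (𝕜 := ℝ) i).comp (fderiv ℝ φ x)) x :=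
    (EuclideanSpace.proj (𝕜 := ℝ) i).hasFDerivAt.comp x h.hasFDerivAt
  rw [this.fderiv]; rfl

lemma fderiv_bv {φ : E4 → E4} {x : E4} (h : DifferentiableAt ℝ φ x) (a i : Fin 4) :
    (fderiv ℝ φ x (bv a)) i = jac φ x i a := by
  rw [jac_apply, pd, fderiv_coord h]

lemma fderiv_apply_eq {φ : E4 → E4} {x : E4} (h : DifferentiableAt ℝ φ x) (v : E4) :
    fderiv ℝ φ x v = WithLp.toLp 2 (jac φ x *ᵥ v.ofLp) := by
  ext i
  rw [← fderiv_coord h, fderiv_eq_sum_pd]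
  simp [Matrix.mulVec, dotProduct, jac_apply, mul_comm]

lemma pd_comp {f : E4 → ℝ} {φ : E4 → E4} {x : E4} (hf : DifferentiableAt ℝ f (φ x))
    (hφ : DifferentiableAt ℝ φ x) (a : Fin 4) :
    pd a (fun z => f (φ z)) x = ∑ k, jac φ x k a * pd k f (φ x) := by
  have : HasFDerivAt (fun z => f (φ z)) ((fderiv ℝ f (φ x)).comp (fderiv ℝ φ x)) x :=
    hf.hasFDerivAt.comp x hφ.hasFDerivAt
  rw [pd, this.fderiv, ContinuousLinearMap.comp_apply, fderiv_eq_sum_pd]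
  simp [fderiv_bv hφ]

lemma DiffM.comp {F : Comp2} {φ : E4 → E4} {x : E4} (hF : DiffM F (φ x))
    (hφ : DifferentiableAt ℝ φ x) : DiffM (fun z => F (φ z)) x :=
  fun i j => (hF i j).comp x hφ

lemma dM_comp {F : Comp2} {φ : E4 → E4} {x : E4} (hF : DiffM F (φ x))
    (hφ : DifferentiableAt ℝ φ x) (a : Fin 4) :
    dM (bv a) (fun z => F (φ z)) x = ∑ k, jac φ x k a • dM (bv k) F (φ x) := by
  ext i j
  rw [dM_bv, pd_comp (hF i j) hφ]
  simp [Matrix.sum_apply, dM_bv]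

/-- All entries are smooth on `U`. -/
def SmM (U : Set E4) (F : Comp2) : Prop := ∀ i j, ContDiffOn ℝ ∞ (fun z => F z i j) U

lemma contDiffOn_diffAt {E : Type*} [NormedAddCommGroup E] [NormedSpace ℝ E] {U : Set E4}
    {f : E4 → E} (h : ContDiffOn ℝ ∞ f U) (hU : IsOpen U)
    {x : E4} (hx : x ∈ U) : DifferentiableAt ℝ f x :=
  (h.contDiffAt (hU.mem_nhds hx)).differentiableAt (by simp)

lemma SmM.diffM {U : Set E4} {F : Comp2} (h : SmM U F) (hU : IsOpen U) {x : E4} (hx : x ∈ U) :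
    DiffM F x := fun i j => contDiffOn_diffAt (h i j) hU hx

lemma contDiffOn_fderiv_apply {U : Set E4} {f : E4 → ℝ} (h : ContDiffOn ℝ ∞ f U) (hU : IsOpen U)
    (v : E4) : ContDiffOn ℝ ∞ (fun x => fderiv ℝ f x v) U :=
  (h.fderiv_of_isOpen hU (by simp)).clm_apply contDiffOn_const

lemma contDiffOn_pd {U : Set E4} {f : E4 → ℝ} (h : ContDiffOn ℝ ∞ f U) (hU : IsOpen U)
    (a : Fin 4) : ContDiffOn ℝ ∞ (pd a f) U := contDiffOn_fderiv_apply h hU _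

lemma SmM.dM {U : Set E4} {F : Comp2} (h : SmM U F) (hU : IsOpen U) (v : E4) : SmM U (dM v F) :=
  fun i j => contDiffOn_fderiv_apply (h i j) hU v

lemma SmM.mul {U : Set E4} {F H : Comp2} (hF : SmM U F) (hH : SmM U H) :
    SmM U (fun z => F z * H z) := by
  intro i j
  simp only [Matrix.mul_apply]
  exact ContDiffOn.sum fun k _ => (hF i k).mul (hH k j)

lemma SmM.transpose {U : Set E4} {F : Comp2} (h : SmM U F) : SmM U (fun z => (F z)ᵀ) :=
  fun i j => h j i

lemma SmM.add {U : Set E4} {F H : Comp2} (hF : SmM U F) (hH : SmM U H) :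
    SmM U (fun z => F z + H z) := fun i j => (hF i j).add (hH i j)

lemma SmM.sub {U : Set E4} {F H : Comp2} (hF : SmM U F) (hH : SmM U H) :
    SmM U (fun z => F z - H z) := fun i j => (hF i j).sub (hH i j)

lemma SmM.sum {U : Set E4} {ι : Type*} {s : Finset ι} {F : ι → Comp2} (hF : ∀ k ∈ s, SmM U (F k)) :
    SmM U (fun z => ∑ k ∈ s, F k z) := by
  intro i j
  simp only [Matrix.sum_apply]
  exact ContDiffOn.sum fun k hk => hF k hk i j

lemma SmM.smul {U : Set E4} {f : E4 → ℝ} {F : Comp2} (hf : ContDiffOn ℝ ∞ f U) (hF : SmM U F) :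
    SmM U (fun z => f z • F z) := fun i j => hf.mul (hF i j)

lemma SmM.congr {U : Set E4} {F H : Comp2} (hF : SmM U F) (h : ∀ x ∈ U, H x = F x) : SmM U H :=
  fun i j => (hF i j).congr fun x hx => by rw [h x hx]

lemma SmM.mono {U V : Set E4} {F : Comp2} (hF : SmM U F) (h : V ⊆ U) : SmM V F :=
  fun i j => (hF i j).mono h

lemma SmM.comp {U V : Set E4} {F : Comp2} {φ : E4 → E4} (hF : SmM U F)
    (hφ : ContDiffOn ℝ ∞ φ V) (h : Set.MapsTo φ V U) : SmM V (fun z => F (φ z)) :=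
  fun i j => (hF i j).comp hφ h

lemma contDiffOn_coord {U : Set E4} {Z : E4 → E4} (h : ContDiffOn ℝ ∞ Z U) (i : Fin 4) :
    ContDiffOn ℝ ∞ (fun z => Z z i) U :=
  (EuclideanSpace.proj (𝕜 := ℝ) i).contDiff.comp_contDiffOn h

lemma contDiffOn_of_coord {U : Set E4} {Z : E4 → E4}
    (h : ∀ i, ContDiffOn ℝ ∞ (fun z => Z z i) U) : ContDiffOn ℝ ∞ Z U :=
  contDiffOn_euclidean.2 h

lemma SmM.jac {U : Set E4} {Z : E4 → E4} (h : ContDiffOn ℝ ∞ Z U) (hU : IsOpen U) :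
    SmM U (jac Z) := fun i _ => contDiffOn_pd (contDiffOn_coord h i) hU _

lemma contDiffOn_det {U : Set E4} {F : Comp2} (h : SmM U F) :
    ContDiffOn ℝ ∞ (fun z => (F z).det) U := by
  simp only [Matrix.det_apply]
  exact ContDiffOn.sum fun σ _ => ContDiffOn.const_smul _ (contDiffOn_prod fun i _ => h _ _)

lemma SmM.inv {U : Set E4} {F : Comp2} (h : SmM U F) (hd : ∀ x ∈ U, (F x).det ≠ 0) :
    SmM U (fun z => (F z)⁻¹) := by
  intro i j
  simp only [Matrix.inv_def, Ring.inverse_eq_inv', Matrix.smul_apply, smul_eq_mul,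
    Matrix.adjugate_apply]
  refine ((contDiffOn_det h).inv hd).mul (contDiffOn_det (F := fun z => (F z).updateRow j _) ?_)
  intro k l
  by_cases hk : k = j
  · subst hk; simp only [Matrix.updateRow_self]; exact contDiffOn_const
  · simp only [Matrix.updateRow_ne hk]; exact h k l

lemma pd_comm {f : E4 → ℝ} {U : Set E4} (h : ContDiffOn ℝ ∞ f U) (hU : IsOpen U) {x : E4}
    (hx : x ∈ U) (a b : Fin 4) : pd a (pd b f) x = pd b (pd a f) x := by
  have hf : ContDiffAt ℝ ∞ f x := h.contDiffAt (hU.mem_nhds hx)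
  have h2 : DifferentiableAt ℝ (fderiv ℝ f) x :=
    contDiffOn_diffAt (h.fderiv_of_isOpen hU (by simp)) hU hx
  have key : ∀ a b, pd a (pd b f) x = fderiv ℝ (fderiv ℝ f) x (bv a) (bv b) := by
    intro a b
    change fderiv ℝ (fun y => fderiv ℝ f y (bv b)) x (bv a) = _
    rw [fderiv_clm_apply h2 (differentiableAt_const _)]
    simp
  rw [key, key]
  exact (hf.isSymmSndFDerivAt (by
    simp only [minSmoothness_of_isRCLikeNormedField]; exact WithTop.coe_le_coe.2 (le_top (a := (2 : ℕ∞))))) _ _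

lemma pd_congr {f h : E4 → ℝ} {U : Set E4} (hU : IsOpen U) (hfh : ∀ z ∈ U, f z = h z) {x : E4}
    (hx : x ∈ U) (a : Fin 4) : pd a f x = pd a h x := by
  rw [pd, pd, Filter.EventuallyEq.fderiv_eq (Filter.eventuallyEq_of_mem (hU.mem_nhds hx) hfh)]

/-- Equality of mixed partials of φ. It makes the inhomogeneous term of the connection's
transformation law torsion-free, and cancels second derivatives in the laws for brackets and
curvature. -/
lemma dM_jac_symm {φ : E4 → E4} {U : Set E4} (h : ContDiffOn ℝ ∞ φ U) (hU : IsOpen U) {x : E4}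
    (hx : x ∈ U) (c b i : Fin 4) : dM (bv c) (jac φ) x i b = dM (bv b) (jac φ) x i c := by
  simp only [dM_bv, jac_apply]
  exact pd_comm (contDiffOn_coord h i) hU hx _ _

lemma dM_comm {F : Comp2} {U : Set E4} (h : SmM U F) (hU : IsOpen U) {x : E4}
    (hx : x ∈ U) (c d : Fin 4) :
    dM (bv c) (dM (bv d) F) x = dM (bv d) (dM (bv c) F) x := by
  ext i j
  simp only [dM_bv]
  exact pd_comm (h i j) hU hx c d

/-! ### Lorentz metrics on an open set and their Levi-Civita connection. -/

/-- The Minkowski matrix. -/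
abbrev mink : Matrix (Fin 4) (Fin 4) ℝ := Matrix.diagonal ![(-1 : ℝ), 1, 1, 1]

lemma det_mink : mink.det = -1 := by
  simp [mink, Matrix.det_diagonal, Fin.prod_univ_four]

/-- The components of a Lorentz metric on an open set. -/
structure MetricOn (U : Set E4) (G : Comp2) : Prop where
  isOpen : IsOpen U
  smooth : SmM U G
  lorentz : ∀ y ∈ U, ∃ P : Matrix (Fin 4) (Fin 4) ℝ, Pᵀ * G y * P = mink

lemma lorentz_det {P g : Matrix (Fin 4) (Fin 4) ℝ} (h : Pᵀ * g * P = mink) :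
    P.det * P.det * g.det = -1 := by
  rw [← det_mink, ← h, Matrix.det_mul, Matrix.det_mul, Matrix.det_transpose]; ring

namespace MetricOn

variable {U : Set E4} {G : Comp2} (h : MetricOn U G)
include h

lemma det_neg {y : E4} (hy : y ∈ U) : (G y).det < 0 := by
  obtain ⟨P, hP⟩ := h.lorentz y hy
  have := lorentz_det hP
  nlinarith [mul_self_nonneg P.det]

lemma det_ne {y : E4} (hy : y ∈ U) : (G y).det ≠ 0 := (h.det_neg hy).ne

lemma isUnit {y : E4} (hy : y ∈ U) : IsUnit (G y).det := (h.det_ne hy).isUnit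

/-- Congruence to a diagonal matrix by an invertible frame already forces symmetry. -/
lemma symm {y : E4} (hy : y ∈ U) : (G y)ᵀ = G y := by
  obtain ⟨P, hP⟩ := h.lorentz y hy
  have hd : IsUnit P.det := by
    rw [isUnit_iff_ne_zero]; intro h0
    have := lorentz_det hP
    rw [h0] at this; norm_num at this
  have h2 : Pᵀ * (G y)ᵀ * P = Pᵀ * G y * P := by
    have := congrArg Matrix.transpose hP
    rw [Matrix.transpose_mul, Matrix.transpose_mul, Matrix.transpose_transpose,
      Matrix.diagonal_transpose, ← Matrix.mul_assoc] at this
    rw [this, hP]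
  have hd' : IsUnit (Pᵀ).det := by rwa [Matrix.det_transpose]
  have h3 := congrArg (fun X => (Pᵀ)⁻¹ * X * P⁻¹) h2
  simpa [Matrix.mul_assoc, Matrix.mul_nonsing_inv _ hd,
    Matrix.nonsing_inv_mul_cancel_left _ _ hd'] using h3

lemma symm_apply {y : E4} (hy : y ∈ U) (a b : Fin 4) : G y a b = G y b a := by
  rw [← congrFun (congrFun (h.symm hy) a) b]; rfl

lemma pd_symm {y : E4} (hy : y ∈ U) (a b c : Fin 4) :
    pd c (fun z => G z a b) y = pd c (fun z => G z b a) y :=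
  pd_congr h.isOpen (fun _ hz => h.symm_apply hz a b) hy c

lemma diffM {y : E4} (hy : y ∈ U) : DiffM G y := h.smooth.diffM h.isOpen hy

lemma inv_smooth : SmM U (fun z => (G z)⁻¹) := h.smooth.inv fun _ hx => h.det_ne hx

lemma christoffel_symm {y : E4} (hy : y ∈ U) (a b c : Fin 4) :
    christoffel G a b c y = christoffel G a c b y := by
  unfold christoffel
  congr 1
  refine Finset.sum_congr rfl fun d _ => ?_
  rw [h.pd_symm hy b c]; ring

end MetricOn

/-- The connection matrix in the coordinate direction `c`. -/
def christM (G : Comp2) (c : Fin 4) : Comp2 := fun y => Matrix.of fun a b => christoffel G a c b y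

lemma christM_apply (G : Comp2) (c : Fin 4) (y : E4) (a b : Fin 4) :
    christM G c y a b = christoffel G a c b y := rfl

lemma christM_eq (G : Comp2) (c : Fin 4) (y : E4) :
    christM G c y = (G y)⁻¹ * Matrix.of fun d b => (1 / 2 : ℝ) *
      (pd c (fun z => G z d b) y + pd b (fun z => G z d c) y - pd d (fun z => G z c b) y) := by
  ext a b
  rw [christM_apply, christoffel, Matrix.mul_apply, Finset.mul_sum]
  refine Finset.sum_congr rfl fun d _ => ?_
  simp only [Matrix.of_apply]; ring

lemma MetricOn.mul_christM {U : Set E4} {G : Comp2} (h : MetricOn U G) {y : E4} (hy : y ∈ U)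
    (c a b : Fin 4) : (G y * christM G c y) a b = (1 / 2 : ℝ) *
      (pd c (fun z => G z a b) y + pd b (fun z => G z a c) y - pd a (fun z => G z c b) y) := by
  rw [christM_eq, Matrix.mul_nonsing_inv_cancel_left _ _ (h.isUnit hy)]; rfl

/-- Metric compatibility ∇g = 0 in matrix form. -/
lemma MetricOn.dM_eq {U : Set E4} {G : Comp2} (h : MetricOn U G) {y : E4} (hy : y ∈ U)
    (c : Fin 4) : dM (bv c) G y = (christM G c y)ᵀ * G y + G y * christM G c y := by
  have : (christM G c y)ᵀ * G y = (G y * christM G c y)ᵀ := by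
    rw [Matrix.transpose_mul, h.symm hy]
  ext a b
  rw [this, Matrix.add_apply, Matrix.transpose_apply, h.mul_christM hy, h.mul_christM hy, dM_bv,
    h.pd_symm hy b a, h.pd_symm hy b c, h.pd_symm hy c a]
  ring

/-- The Levi-Civita connection is the only torsion-free metric connection. -/
lemma MetricOn.christM_unique {U : Set E4} {G : Comp2} (h : MetricOn U G) {y : E4} (hy : y ∈ U)
    (Δ : Fin 4 → Matrix (Fin 4) (Fin 4) ℝ) (hΔ : ∀ a b c, Δ c a b = Δ b a c)
    (hG : ∀ c, dM (bv c) G y = (Δ c)ᵀ * G y + G y * Δ c) (c : Fin 4) : christM G c y = Δ c := by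
  set l : Fin 4 → Fin 4 → Fin 4 → ℝ := fun c a b => (G y * Δ c) a b with hl
  have hs : ∀ c a b, l c a b = l b a c := by
    intro c a b
    simp only [hl, Matrix.mul_apply]
    exact Finset.sum_congr rfl fun d _ => by rw [hΔ]
  have hd : ∀ c a b, pd c (fun z => G z a b) y = l c b a + l c a b := by
    intro c a b
    have h1 : (Δ c)ᵀ * G y = (G y * Δ c)ᵀ := by rw [Matrix.transpose_mul, h.symm hy]
    rw [← dM_bv, hG, h1]; rfl
  -- Koszul's argument: with ∂g written through l = GΔ, the symmetry of l in its outer lower indices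
  -- collapses the three derivatives to 2l.
  have : (Matrix.of fun d b => (1 / 2 : ℝ) *
      (pd c (fun z => G z d b) y + pd b (fun z => G z d c) y - pd d (fun z => G z c b) y))
      = G y * Δ c := by
    ext d b
    simp only [Matrix.of_apply, hd]
    change _ = l c d b
    rw [hs c b d, hs b d c, hs d c b, hs b c d]; ring
  rw [christM_eq, this, Matrix.nonsing_inv_mul_cancel_left _ _ (h.isUnit hy)]

lemma covDeriv_eq (G : Comp2) (y : E4)
    (T : Comp2) (c a b : Fin 4) : covDeriv G T c a b y =
      (dM (bv c) T y - (christM G c y)ᵀ * T y - T y * christM G c y) a b := by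
  simp only [covDeriv, Matrix.sub_apply, dM_bv, Matrix.mul_apply, Matrix.transpose_apply,
    christM_apply, Finset.sum_add_distrib]
  rw [sub_sub]
  congr 2
  exact Finset.sum_congr rfl fun d _ => mul_comm _ _

/-- The curvature matrix in the coordinate plane `(c, d)`. -/
def riemM (G : Comp2) (c d : Fin 4) : Comp2 :=
  fun y => Matrix.of fun a b => riemannUp G a b c d y

/-- The curvature as dΓ + Γ ∧ Γ for the connection matrices; symmetry of the Christoffel symbols
moves the form index into the middle slot. -/
lemma MetricOn.riemM_eq {U : Set E4} {G : Comp2} (h : MetricOn U G) {y : E4} (hy : y ∈ U)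
    (c d : Fin 4) : riemM G c d y = dM (bv c) (christM G d) y - dM (bv d) (christM G c) y
      + christM G c y * christM G d y - christM G d y * christM G c y := by
  ext a b
  simp only [riemM, Matrix.of_apply, riemannUp, Matrix.add_apply, Matrix.sub_apply, dM_bv,
    Matrix.mul_apply, christM_apply, Finset.sum_sub_distrib]
  have e1 : ∀ c d, ∑ e, christoffel G e b d y * christoffel G a e c y =
      ∑ e, christoffel G a c e y * christoffel G e d b y := fun c d =>
    Finset.sum_congr rfl fun e _ => by
      rw [h.christoffel_symm hy e b d, h.christoffel_symm hy a e c]; ring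
  rw [pd_congr h.isOpen (fun z hz => h.christoffel_symm hz a b d) hy,
    pd_congr h.isOpen (fun z hz => h.christoffel_symm hz a b c) hy, e1, e1]
  ring

lemma MetricOn.christM_smooth {U : Set E4} {G : Comp2} (h : MetricOn U G) (c : Fin 4) :
    SmM U (christM G c) := by
  have : SmM U (fun y => (Matrix.of fun d b => (1 / 2 : ℝ) *
      (pd c (fun z => G z d b) y + pd b (fun z => G z d c) y - pd d (fun z => G z c b) y) :
        Matrix (Fin 4) (Fin 4) ℝ)) := fun i j =>
    contDiffOn_const.mul (((contDiffOn_pd (h.smooth _ _) h.isOpen _).add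
      (contDiffOn_pd (h.smooth _ _) h.isOpen _)).sub (contDiffOn_pd (h.smooth _ _) h.isOpen _))
  exact (h.inv_smooth.mul this).congr fun x _ => christM_eq G c x

/-! ### Pullbacks: transformation of connection, covariant derivative and curvature. -/

/-- The pullback of a covariant 2-tensor. -/
def pull (φ : E4 → E4) (T : Comp2) : Comp2 := fun x => (jac φ x)ᵀ * T (φ x) * jac φ x

/-- The pullback of a vector field. -/
def pullVec (φ : E4 → E4) (Z : E4 → E4) : E4 → E4 :=
  fun x => WithLp.toLp 2 ((jac φ x)⁻¹ *ᵥ (Z (φ x)).ofLp)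

/-- A smooth map between open sets with positive Jacobian determinant. -/
structure CoordMap (V U : Set E4) (φ : E4 → E4) : Prop where
  isOpen : IsOpen V
  isOpen' : IsOpen U
  mapsTo : Set.MapsTo φ V U
  smooth : ContDiffOn ℝ ∞ φ V
  det_pos : ∀ x ∈ V, 0 < (jac φ x).det

namespace CoordMap

variable {V U : Set E4} {φ : E4 → E4} (k : CoordMap V U φ)
include k

lemma isUnit {x : E4} (hx : x ∈ V) : IsUnit (jac φ x).det := (k.det_pos x hx).ne'.isUnit

lemma diffAt {x : E4} (hx : x ∈ V) : DifferentiableAt ℝ φ x := contDiffOn_diffAt k.smooth k.isOpen hx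

lemma jac_smooth : SmM V (jac φ) := SmM.jac k.smooth k.isOpen

lemma jac_diff {x : E4} (hx : x ∈ V) : DiffM (jac φ) x := k.jac_smooth.diffM k.isOpen hx

lemma pull_smooth {T : Comp2} (hT : SmM U T) : SmM V (pull φ T) :=
  (k.jac_smooth.transpose.mul (hT.comp k.smooth k.mapsTo)).mul k.jac_smooth

lemma dM_pull {T : Comp2} (hT : SmM U T) {x : E4} (hx : x ∈ V) (c : Fin 4) :
    dM (bv c) (pull φ T) x = (dM (bv c) (jac φ) x)ᵀ * T (φ x) * jac φ x
      + (jac φ x)ᵀ * (∑ i, jac φ x i c • dM (bv i) T (φ x)) * jac φ x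
      + (jac φ x)ᵀ * T (φ x) * dM (bv c) (jac φ) x := by
  have hT' : DiffM T (φ x) := hT.diffM k.isOpen' (k.mapsTo hx)
  have hJ := k.jac_diff hx
  have hTφ := hT'.comp (k.diffAt hx)
  unfold pull
  rw [dM_mul (hJ.transpose.mul hTφ) hJ, dM_mul hJ.transpose hTφ, dM_transpose,
    dM_comp hT' (k.diffAt hx), Matrix.add_mul]

lemma metricOn {G : Comp2} (h : MetricOn U G) : MetricOn V (pull φ G) where
  isOpen := k.isOpen
  smooth := k.pull_smooth h.smooth
  lorentz x hx := by
    obtain ⟨P, hP⟩ := h.lorentz _ (k.mapsTo hx)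
    refine ⟨(jac φ x)⁻¹ * P, ?_⟩
    have hu := k.isUnit hx
    rw [← hP, pull, Matrix.transpose_mul]
    have h1 : ((jac φ x)⁻¹)ᵀ * (jac φ x)ᵀ = 1 := by
      rw [← Matrix.transpose_mul, Matrix.mul_nonsing_inv _ hu, Matrix.transpose_one]
    calc _ = Pᵀ * (((jac φ x)⁻¹)ᵀ * (jac φ x)ᵀ) * G (φ x) * (jac φ x * (jac φ x)⁻¹) * P := by
          simp only [Matrix.mul_assoc]
      _ = _ := by rw [h1, Matrix.mul_nonsing_inv _ hu]; simp

/-- The gauge law. J⁻¹ times the right-hand side is torsion-free and compatible with the pulled-back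
metric, so `christM_unique` identifies it without expanding Christoffel symbols. -/
lemma jac_mul_christM {G : Comp2} (h : MetricOn U G) {x : E4} (hx : x ∈ V) (c : Fin 4) :
    jac φ x * christM (pull φ G) c x =
      (∑ i, jac φ x i c • christM G i (φ x)) * jac φ x + dM (bv c) (jac φ) x := by
  have hu := k.isUnit hx
  set J := jac φ x with hJ
  set Q : Fin 4 → Matrix (Fin 4) (Fin 4) ℝ := fun c =>
    (∑ i, J i c • christM G i (φ x)) * J + dM (bv c) (jac φ) x with hQ
  have key := (k.metricOn h).christM_unique hx (fun c => J⁻¹ * Q c) ?_ ?_ c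
  · rw [key, Matrix.mul_nonsing_inv_cancel_left _ _ hu]
  · intro a b c
    simp only [Matrix.mul_apply]
    refine Finset.sum_congr rfl fun d _ => ?_
    congr 1
    simp only [hQ, Matrix.add_apply, dM_jac_symm k.smooth k.isOpen hx c b d]
    congr 1
    simp only [Matrix.mul_apply, Matrix.sum_apply, Matrix.smul_apply, smul_eq_mul, christM_apply,
      Finset.sum_mul]
    rw [Finset.sum_comm]
    refine Finset.sum_congr rfl fun i _ => Finset.sum_congr rfl fun j _ => ?_
    rw [h.christoffel_symm (k.mapsTo hx)]; ring
  · intro c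
    have e1 : pull φ G x * (J⁻¹ * Q c) = Jᵀ * G (φ x) * Q c := by
      rw [pull, ← hJ, Matrix.mul_assoc _ J, Matrix.mul_nonsing_inv_cancel_left _ _ hu]
    have e2 : (J⁻¹ * Q c)ᵀ * pull φ G x = (Jᵀ * G (φ x) * Q c)ᵀ := by
      rw [← e1, Matrix.transpose_mul (pull φ G x), (k.metricOn h).symm hx]
    rw [e1, e2, k.dM_pull h.smooth hx]
    simp only [h.dM_eq (k.mapsTo hx), hQ, ← hJ, Matrix.transpose_mul, Matrix.transpose_add,
      Matrix.transpose_transpose, h.symm (k.mapsTo hx), Matrix.transpose_sum,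
      Matrix.transpose_smul, smul_add, Finset.sum_add_distrib, Matrix.mul_add, Matrix.add_mul,
      Matrix.mul_sum, Matrix.sum_mul, Matrix.mul_smul, Matrix.smul_mul, Matrix.mul_assoc]
    abel

/-- The ∂J terms from differentiating the pullback cancel the inhomogeneous terms of the gauge law.
-/
lemma covDeriv_pull {G T : Comp2} (h : MetricOn U G) (hT : SmM U T) {x : E4} (hx : x ∈ V)
    (c a b : Fin 4) : covDeriv (pull φ G) (pull φ T) c a b x =
      ∑ i, jac φ x i c * ((jac φ x)ᵀ *
        (Matrix.of fun p q => covDeriv G T i p q (φ x)) * jac φ x) a b := by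
  set J := jac φ x with hJ
  have hc : ∀ i, (Matrix.of fun p q => covDeriv G T i p q (φ x) : Matrix (Fin 4) (Fin 4) ℝ) =
      dM (bv i) T (φ x) - (christM G i (φ x))ᵀ * T (φ x) - T (φ x) * christM G i (φ x) := by
    intro i; ext p q; exact covDeriv_eq G (φ x) T i p q
  have hg := k.jac_mul_christM h hx c
  have hg' : (christM (pull φ G) c x)ᵀ * Jᵀ = ((∑ i, J i c • christM G i (φ x)) * J +
      dM (bv c) (jac φ) x)ᵀ := by rw [← hg, Matrix.transpose_mul]
  have e : dM (bv c) (pull φ T) x - (christM (pull φ G) c x)ᵀ * pull φ T x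
      - pull φ T x * christM (pull φ G) c x = ∑ i, J i c • (Jᵀ *
        (Matrix.of fun p q => covDeriv G T i p q (φ x)) * J) := by
    have e1 : pull φ T x * christM (pull φ G) c x = Jᵀ * T (φ x) *
        ((∑ i, J i c • christM G i (φ x)) * J + dM (bv c) (jac φ) x) := by
      rw [← hg, pull]; simp only [Matrix.mul_assoc, hJ]
    have e2 : (christM (pull φ G) c x)ᵀ * pull φ T x = ((∑ i, J i c • christM G i (φ x)) * J +
      dM (bv c) (jac φ) x)ᵀ * T (φ x) * J := by
      rw [← hg', pull]; simp only [Matrix.mul_assoc, hJ]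
    rw [e1, e2, k.dM_pull hT hx]
    simp only [hc, ← hJ, Matrix.transpose_mul, Matrix.transpose_add,
      Matrix.transpose_sum, smul_sub, Finset.sum_sub_distrib, Matrix.mul_sub, Matrix.sub_mul,
      Matrix.transpose_smul, Matrix.mul_add, Matrix.add_mul,
      Matrix.mul_sum, Matrix.sum_mul, Matrix.mul_smul, Matrix.smul_mul, Matrix.mul_assoc]
    abel
  rw [covDeriv_eq, e]
  simp [Matrix.sum_apply]

/-- Differentiate the gauge law JΓ = QJ + ∂J in a second direction and antisymmetrise: ∂∂J drops
out, leaving the curvature of Q. The remaining ∂J terms in dQ cancel by symmetry. -/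
lemma jac_mul_riemM {G : Comp2} (h : MetricOn U G) {x : E4} (hx : x ∈ V) (c d : Fin 4) :
    jac φ x * riemM (pull φ G) c d x =
      (∑ i, ∑ j, (jac φ x i c * jac φ x j d) • riemM G i j (φ x)) * jac φ x := by
  have hG' := k.metricOn h
  set Γ := fun c => christM (pull φ G) c with hΓ
  set Q : Fin 4 → Comp2 := fun c z => ∑ i, jac φ z i c • christM G i (φ z) with hQ
  have hΓd : ∀ c, DiffM (Γ c) x := fun c => (hG'.christM_smooth c).diffM k.isOpen hx
  have hQs : ∀ c, SmM V (Q c) := fun c => SmM.sum fun i _ =>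
    SmM.smul (k.jac_smooth i c) ((h.christM_smooth i).comp k.smooth k.mapsTo)
  have hQd : ∀ c, DiffM (Q c) x := fun c => (hQs c).diffM k.isOpen hx
  have hJd := k.jac_diff hx
  have hdJ : ∀ d, DiffM (dM (bv d) (jac φ)) x := fun d =>
    (k.jac_smooth.dM k.isOpen _).diffM k.isOpen hx
  have gauge : ∀ c, ∀ z ∈ V, jac φ z * Γ c z = Q c z * jac φ z + dM (bv c) (jac φ) z :=
    fun c z hz => k.jac_mul_christM h hz c
  have dgauge : ∀ c d, dM (bv c) (jac φ) x * Γ d x + jac φ x * dM (bv c) (Γ d) x =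
      dM (bv c) (Q d) x * jac φ x + Q d x * dM (bv c) (jac φ) x
        + dM (bv c) (dM (bv d) (jac φ)) x := by
    intro c d
    rw [← dM_mul hJd (hΓd d), ← dM_mul (hQd d) hJd, ← dM_add ((hQd d).mul hJd) (hdJ d)]
    exact dM_congr (Filter.eventuallyEq_of_mem (k.isOpen.mem_nhds hx) fun z hz => gauge d z hz) _
  have dQ : ∀ c d, dM (bv c) (Q d) x = ∑ i, (dM (bv c) (jac φ) x i d • christM G i (φ x)
      + jac φ x i d • ∑ j, jac φ x j c • dM (bv j) (christM G i) (φ x)) := by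
    intro c d
    ext p q
    have hd : ∀ i ∈ Finset.univ, DifferentiableAt ℝ
        (fun z => jac φ z i d * christM G i (φ z) p q) x := fun i _ =>
      (hJd i d).fun_mul (((h.christM_smooth i).diffM k.isOpen' (k.mapsTo hx)).comp
        (k.diffAt hx) p q)
    simp only [dM_bv, hQ, pd, Matrix.sum_apply, Matrix.smul_apply, smul_eq_mul]
    rw [fderiv_fun_sum hd]
    simp only [_root_.sum_apply, Matrix.add_apply, Matrix.sum_apply, Matrix.smul_apply, smul_eq_mul]
    refine Finset.sum_congr rfl fun i _ => ?_
    have hcd := ((h.christM_smooth i).diffM k.isOpen' (k.mapsTo hx))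
    rw [fderiv_fun_mul (hJd i d) (hcd.comp (k.diffAt hx) p q)]
    have := congrFun (congrFun (dM_comp hcd (k.diffAt hx) c) p) q
    simp only [dM_apply, Matrix.sum_apply, Matrix.smul_apply, smul_eq_mul] at this
    simp only [_root_.add_apply, _root_.smul_apply, smul_eq_mul, this, dM_bv, pd]
    ring
  have hcomm := dM_comm k.jac_smooth k.isOpen hx c d
  have g1 := gauge c x hx
  have g2 := gauge d x hx
  have key : jac φ x * riemM (pull φ G) c d x =
      (dM (bv c) (Q d) x - dM (bv d) (Q c) x + Q c x * Q d x - Q d x * Q c x) * jac φ x := by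
    rw [hG'.riemM_eq hx]
    calc _ = (dM (bv c) (jac φ) x * Γ d x + jac φ x * dM (bv c) (Γ d) x)
          - (dM (bv d) (jac φ) x * Γ c x + jac φ x * dM (bv d) (Γ c) x)
          + (jac φ x * Γ c x) * Γ d x - (jac φ x * Γ d x) * Γ c x
          - dM (bv c) (jac φ) x * Γ d x + dM (bv d) (jac φ) x * Γ c x := by
            simp only [hΓ]; noncomm_ring
      _ = dM (bv c) (Q d) x * jac φ x - dM (bv d) (Q c) x * jac φ x
          + Q d x * dM (bv c) (jac φ) x - Q c x * dM (bv d) (jac φ) x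
          + Q c x * (jac φ x * Γ d x) - Q d x * (jac φ x * Γ c x) := by
            rw [dgauge, dgauge, hcomm, g1, g2]
            simp only [Matrix.mul_add, Matrix.add_mul, Matrix.mul_assoc, g1, g2]
            abel
      _ = _ := by
            simp only [g1, g2, Matrix.mul_add, Matrix.add_mul, Matrix.sub_mul, Matrix.mul_assoc]
            abel
  have hR : ∀ i j, riemM G i j (φ x) = _ := fun i j => h.riemM_eq (k.mapsTo hx) i j
  rw [key]
  congr 1
  rw [dQ, dQ]
  simp only [hR, hQ, Finset.sum_add_distrib, dM_jac_symm k.smooth k.isOpen hx c d]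
  simp only [smul_sub, smul_add, Finset.sum_sub_distrib, Finset.sum_add_distrib,
    Matrix.sum_mul, Matrix.mul_sum, Matrix.smul_mul, Matrix.mul_smul, Finset.smul_sum, smul_smul]
  rw [Finset.sum_comm (f := fun i j => (jac φ x i d * jac φ x j c) • dM (bv j) (christM G i) (φ x)),
    Finset.sum_comm (f := fun i j => (jac φ x i c * jac φ x j d) • dM (bv j) (christM G i) (φ x)),
    Finset.sum_comm (f := fun i j => (jac φ x i d * jac φ x j c) • (christM G j (φ x) * christM G i (φ x)))]
  simp only [mul_comm (jac φ x _ d)]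
  abel

end CoordMap

/-! ### The Levi-Civita symbol and the Hodge dual under linear maps. -/

lemma leviCivita_eq (a b c d : Fin 4) : leviCivita a b c d =
    ((b : ℕ) - (a : ℕ) : ℝ) * ((c : ℕ) - (a : ℕ)) * ((d : ℕ) - (a : ℕ)) * ((c : ℕ) - (b : ℕ)) *
      ((d : ℕ) - (b : ℕ)) * ((d : ℕ) - (c : ℕ)) / 12 := by
  have vdet : ∀ v : Fin 4 → ℝ, (Matrix.vandermonde v).det =
      (v 1 - v 0) * (v 2 - v 0) * (v 3 - v 0) * (v 2 - v 1) * (v 3 - v 1) * (v 3 - v 2) := by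
    intro v
    rw [Matrix.det_succ_row_zero]
    simp [Fin.sum_univ_succ, Matrix.det_fin_three, Matrix.vandermonde_apply, Fin.succAbove]
    ring
  -- The selection matrix replaces the nodes 0, 1, 2, 3 of a Vandermonde matrix by a, b, c, d. The
  -- determinant for the original nodes is 12, the denominator in the formula.
  have h : (Matrix.of fun i j : Fin 4 => if ![a, b, c, d] i = j then (1 : ℝ) else 0) *
      Matrix.vandermonde (fun i : Fin 4 => ((i : ℕ) : ℝ)) =
      Matrix.vandermonde (fun i => ((![a, b, c, d] i : ℕ) : ℝ)) := by
    ext i j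
    simp [Matrix.mul_apply, Matrix.vandermonde_apply]
  have h2 := congrArg Matrix.det h
  rw [Matrix.det_mul, vdet, vdet] at h2
  change leviCivita a b c d * _ = _ at h2
  norm_num [show ![a, b, c, d] 2 = c from rfl, show ![a, b, c, d] 3 = d from rfl] at h2
  linarith

@[simp] lemma leviCivita_self_12 (a c d : Fin 4) : leviCivita a a c d = 0 := by
  rw [leviCivita_eq]; ring
@[simp] lemma leviCivita_self_13 (a b d : Fin 4) : leviCivita a b a d = 0 := by
  rw [leviCivita_eq]; ring
@[simp] lemma leviCivita_self_14 (a b c : Fin 4) : leviCivita a b c a = 0 := by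
  rw [leviCivita_eq]; ring
@[simp] lemma leviCivita_self_23 (a b d : Fin 4) : leviCivita a b b d = 0 := by
  rw [leviCivita_eq]; ring
@[simp] lemma leviCivita_self_24 (a b c : Fin 4) : leviCivita a b c b = 0 := by
  rw [leviCivita_eq]; ring
@[simp] lemma leviCivita_self_34 (a b c : Fin 4) : leviCivita a b c c = 0 := by
  rw [leviCivita_eq]; ring

lemma leviCivita_values :
    leviCivita 0 1 2 3 = 1 ∧
    leviCivita 0 1 3 2 = -1 ∧
    leviCivita 0 2 1 3 = -1 ∧
    leviCivita 0 2 3 1 = 1 ∧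
    leviCivita 0 3 1 2 = 1 ∧
    leviCivita 0 3 2 1 = -1 ∧
    leviCivita 1 0 2 3 = -1 ∧
    leviCivita 1 0 3 2 = 1 ∧
    leviCivita 1 2 0 3 = 1 ∧
    leviCivita 1 2 3 0 = -1 ∧
    leviCivita 1 3 0 2 = -1 ∧
    leviCivita 1 3 2 0 = 1 ∧
    leviCivita 2 0 1 3 = 1 ∧
    leviCivita 2 0 3 1 = -1 ∧
    leviCivita 2 1 0 3 = -1 ∧
    leviCivita 2 1 3 0 = 1 ∧
    leviCivita 2 3 0 1 = 1 ∧
    leviCivita 2 3 1 0 = -1 ∧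
    leviCivita 3 0 1 2 = -1 ∧
    leviCivita 3 0 2 1 = 1 ∧
    leviCivita 3 1 0 2 = 1 ∧
    leviCivita 3 1 2 0 = -1 ∧
    leviCivita 3 2 0 1 = -1 ∧
    leviCivita 3 2 1 0 = 1 := by
  refine ⟨?_, ?_, ?_, ?_, ?_, ?_, ?_, ?_, ?_, ?_, ?_, ?_, ?_, ?_, ?_, ?_, ?_, ?_, ?_, ?_, ?_, ?_,
    ?_, ?_⟩ <;> rw [leviCivita_eq] <;> norm_num

lemma sum_leviCivita (f : Fin 4 → Fin 4 → Fin 4 → Fin 4 → ℝ) :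
    ∑ i, ∑ j, ∑ k, ∑ l, leviCivita i j k l * f i j k l =
      f 0 1 2 3 - f 0 1 3 2 - f 0 2 1 3 + f 0 2 3 1 + f 0 3 1 2 - f 0 3 2 1 - f 1 0 2 3 + f 1
      0 3 2 + f 1 2 0 3 - f 1 2 3 0 - f 1 3 0 2 + f 1 3 2 0 + f 2 0 1 3 - f 2 0 3 1 - f 2 1 0
      3 + f 2 1 3 0 + f 2 3 0 1 - f 2 3 1 0 - f 3 0 1 2 + f 3 0 2 1 + f 3 1 0 2 - f 3 1 2 0 -
      f 3 2 0 1 + f 3 2 1 0 := by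
  simp only [Fin.sum_univ_four, leviCivita_values, leviCivita_self_12, leviCivita_self_13,
    leviCivita_self_14, leviCivita_self_23, leviCivita_self_24, leviCivita_self_34]
  ring

/-- Both sides are the determinant of the matrix made of columns a, b, c, d of J: by Leibniz
expansion, and by multiplicativity. -/
lemma leviCivita_transform (J : Matrix (Fin 4) (Fin 4) ℝ) (a b c d : Fin 4) :
    ∑ i, ∑ j, ∑ k, ∑ l, leviCivita i j k l * (J i a * J j b * J k c * J l d) =
      J.det * leviCivita a b c d := by
  have h : J * (Matrix.of fun i j : Fin 4 => if ![a, b, c, d] i = j then (1 : ℝ) else 0)ᵀ =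
      Matrix.of fun i s => J i (![a, b, c, d] s) := by
    ext i j; simp [Matrix.mul_apply]
  rw [leviCivita, ← Matrix.det_transpose (Matrix.of _), ← Matrix.det_mul, h, sum_leviCivita,
    Matrix.det_succ_row_zero]
  simp [Fin.sum_univ_succ, Matrix.det_fin_three, Fin.succAbove]
  ring

/-- The Hodge dual for a metric of determinant `-1`, on contravariant components. -/
def star (X : Matrix (Fin 4) (Fin 4) ℝ) : Matrix (Fin 4) (Fin 4) ℝ :=
  Matrix.of fun a b => (1 / 2 : ℝ) * ∑ c, ∑ d, leviCivita a b c d * X c d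

lemma raise_eq (G T : Comp2) (y : E4) : raise G T y = (G y)⁻¹ * T y * ((G y)⁻¹)ᵀ := by
  ext a b
  simp only [raise, Matrix.mul_apply, Matrix.transpose_apply, Finset.sum_mul]
  rw [Finset.sum_comm]
  exact Finset.sum_congr rfl fun c _ => Finset.sum_congr rfl fun d _ => by ring

lemma hodge_eq (G T : Comp2) (y : E4) :
    hodge G T y = Real.sqrt |(G y).det| • star (raise G T y) := by
  ext a b
  simp only [hodge, star, Matrix.smul_apply, Matrix.of_apply, smul_eq_mul, volumeElement,
    Finset.mul_sum]
  exact Finset.sum_congr rfl fun c _ => Finset.sum_congr rfl fun d _ => by ring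

lemma sum_rotate (F : Fin 4 → Fin 4 → Fin 4 → Fin 4 → Fin 4 → ℝ) :
    ∑ c, ∑ i, ∑ j, ∑ k, ∑ l, F c i j k l = ∑ i, ∑ j, ∑ k, ∑ l, ∑ c, F c i j k l := by
  rw [Finset.sum_comm]
  refine Finset.sum_congr rfl fun i _ => ?_
  rw [Finset.sum_comm]
  refine Finset.sum_congr rfl fun j _ => ?_
  rw [Finset.sum_comm]
  refine Finset.sum_congr rfl fun k _ => ?_
  rw [Finset.sum_comm]

lemma conj_apply (J X : Matrix (Fin 4) (Fin 4) ℝ) (a b : Fin 4) :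
    (Jᵀ * X * J) a b = ∑ i, ∑ j, J i a * J j b * X i j := by
  simp only [Matrix.mul_apply, Matrix.transpose_apply, Finset.sum_mul]
  rw [Finset.sum_comm]
  exact Finset.sum_congr rfl fun c _ => Finset.sum_congr rfl fun d _ => by ring

lemma conj_apply' (J X : Matrix (Fin 4) (Fin 4) ℝ) (a b : Fin 4) :
    (J * X * Jᵀ) a b = ∑ i, ∑ j, J a i * J b j * X i j := by
  have := conj_apply Jᵀ X a b
  simpa using this

lemma star_apply (X : Matrix (Fin 4) (Fin 4) ℝ) (a b : Fin 4) :
    star X a b = (1 / 2 : ℝ) * ∑ c, ∑ d, leviCivita a b c d * X c d := rfl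

/-- The symbol is a tensor density, so the algebraic dual is natural up to det J. This factor is
absorbed later by the volume factor √|det g|. -/
lemma star_transform (J X : Matrix (Fin 4) (Fin 4) ℝ) :
    Jᵀ * star (J * X * Jᵀ) * J = J.det • star X := by
  ext a b
  have h : ∀ c d, J.det * (leviCivita a b c d * X c d) = ∑ i, ∑ j, ∑ k, ∑ l,
      leviCivita i j k l * (J i a * J j b * J k c * J l d) * X c d := by
    intro c d
    rw [← mul_assoc, ← leviCivita_transform]
    simp only [Finset.sum_mul]
  have e : (J.det • star X) a b = ∑ c, ∑ d, ∑ i, ∑ j, ∑ k, ∑ l, (1 / 2 : ℝ) *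
      (leviCivita i j k l * (J i a * J j b * J k c * J l d) * X c d) := by
    rw [Matrix.smul_apply, star_apply, smul_eq_mul, mul_left_comm]
    simp only [Finset.mul_sum, h]
  rw [e, Finset.sum_congr rfl fun c _ => sum_rotate _, sum_rotate, conj_apply]
  refine Finset.sum_congr rfl fun i _ => Finset.sum_congr rfl fun j _ => ?_
  rw [star_apply]
  simp only [Finset.mul_sum, conj_apply']
  refine Finset.sum_congr rfl fun k _ => Finset.sum_congr rfl fun l _ => ?_
  exact Finset.sum_congr rfl fun c _ => Finset.sum_congr rfl fun d _ => by ring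

/-! ### The pair equation, Ricci and constant curvature under pullback. -/

/-- The equation `3 ∇_a A_{bc} = g_{ac} u_b - g_{ab} u_c + η_{abcd} w^d` at a point, where `u` and
`w` are vectors. -/
def PairEq (G A : Comp2) (u w : Fin 4 → ℝ) (y : E4) : Prop := ∀ a b c,
  3 * covDeriv G A a b c y = G y a c * (G y *ᵥ u) b - G y a b * (G y *ᵥ u) c
    + ∑ d, volumeElement G a b c d y * w d

/-- The metric has constant curvature `K` at the point `y`. -/
def ConstCurvAt (G : Comp2) (K : ℝ) (y : E4) : Prop := ∀ a b c d,
  riemann G a b c d y = K * (G y a c * G y b d - G y a d * G y b c)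

/-- The covariant derivative as a matrix. -/
def covM (G T : Comp2) (c : Fin 4) : Comp2 := fun y => Matrix.of fun a b => covDeriv G T c a b y

/-- The covariant curvature as a matrix. -/
def riemD (G : Comp2) (c d : Fin 4) : Comp2 := fun y => Matrix.of fun a b => riemann G a b c d y

lemma riemD_eq (G : Comp2) (c d : Fin 4) (y : E4) : riemD G c d y = G y * riemM G c d y := by
  ext a b; simp [riemD, riemann, riemM, Matrix.mul_apply]

lemma codiff_eq (G T : Comp2) (b : Fin 4) (y : E4) :
    codiff G T b y = - ∑ i, ((G y)⁻¹ * covM G T i y) i b := by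
  simp only [codiff, Matrix.mul_apply, covM, Matrix.of_apply]

lemma codiffVec_eq (G T : Comp2) (y : E4) :
    (codiffVec G T y).ofLp = (G y)⁻¹ *ᵥ fun b => codiff G T b y := by
  ext a; simp [codiffVec, Matrix.mulVec, dotProduct]

lemma lieDeriv_eq (Z : E4 → E4) (T : Comp2) (y : E4) : lieDeriv Z T y =
    ∑ c, Z y c • dM (bv c) T y + (jac Z y)ᵀ * T y + T y * jac Z y := by
  ext a b
  simp only [lieDeriv, Matrix.add_apply, Matrix.sum_apply, Matrix.smul_apply, smul_eq_mul,
    Matrix.mul_apply, Matrix.transpose_apply, jac_apply, dM_bv, Finset.sum_add_distrib]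
  congr 2
  exact Finset.sum_congr rfl fun c _ => mul_comm _ _

lemma sum_smul_conj (J : Matrix (Fin 4) (Fin 4) ℝ) (c : Fin 4 → ℝ)
    (X : Fin 4 → Matrix (Fin 4) (Fin 4) ℝ) :
    ∑ i, c i • (Jᵀ * X i * J) = Jᵀ * (∑ i, c i • X i) * J := by
  simp only [Matrix.mul_sum, Matrix.sum_mul, Matrix.mul_smul, Matrix.smul_mul]

lemma conj_cancel {J X Y : Matrix (Fin 4) (Fin 4) ℝ} (hJ : IsUnit J.det)
    (h : Jᵀ * X * J = Jᵀ * Y * J) : X = Y := by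
  have hJ' : IsUnit (Jᵀ).det := by rwa [Matrix.det_transpose]
  have h1 := congrArg (fun Z => (Jᵀ)⁻¹ * Z * J⁻¹) h
  simpa [Matrix.mul_assoc, Matrix.mul_nonsing_inv _ hJ,
    Matrix.nonsing_inv_mul_cancel_left _ _ hJ'] using h1

/-- Contract with J⁻¹ in the free index. Together with `conj_cancel` this lets tensor identities be
pulled back in both directions. -/
lemma contract_cancel {J : Matrix (Fin 4) (Fin 4) ℝ} (hJ : IsUnit J.det)
    {X Y : Fin 4 → Matrix (Fin 4) (Fin 4) ℝ}
    (h : ∀ c, ∑ i, J i c • X i = ∑ i, J i c • Y i) (k : Fin 4) : X k = Y k := by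
  have key : ∀ W : Fin 4 → Matrix (Fin 4) (Fin 4) ℝ,
      ∑ c, J⁻¹ c k • ∑ i, J i c • W i = W k := by
    intro W
    simp only [Finset.smul_sum, smul_smul]
    rw [Finset.sum_comm]
    have : ∀ i, ∑ c, (J⁻¹ c k * J i c) • W i = (1 : Matrix (Fin 4) (Fin 4) ℝ) i k • W i := by
      intro i
      rw [← Finset.sum_smul, ← Matrix.mul_nonsing_inv _ hJ, Matrix.mul_apply]
      congr 1
      exact Finset.sum_congr rfl fun c _ => mul_comm _ _
    simp [this, Matrix.one_apply]
  rw [← key X, ← key Y]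
  simp only [h]

namespace CoordMap

variable {V U : Set E4} {φ : E4 → E4} (k : CoordMap V U φ)
include k

lemma covM_pull {G T : Comp2} (h : MetricOn U G) (hT : SmM U T) {x : E4} (hx : x ∈ V)
    (c : Fin 4) : covM (pull φ G) (pull φ T) c x =
      (jac φ x)ᵀ * (∑ i, jac φ x i c • covM G T i (φ x)) * jac φ x := by
  rw [← sum_smul_conj]
  ext a b
  simp only [Matrix.sum_apply, Matrix.smul_apply, smul_eq_mul]
  exact k.covDeriv_pull h hT hx c a b

lemma inv_pull (G : Comp2) {x : E4} (hx : x ∈ V) :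
    jac φ x * (pull φ G x)⁻¹ * (jac φ x)ᵀ = (G (φ x))⁻¹ := by
  have hJ' : IsUnit ((jac φ x)ᵀ).det := by rw [Matrix.det_transpose]; exact k.isUnit hx
  rw [pull, Matrix.mul_inv_rev, Matrix.mul_inv_rev, Matrix.mul_nonsing_inv_cancel_left _ _
    (k.isUnit hx), Matrix.mul_assoc, Matrix.nonsing_inv_mul _ hJ', Matrix.mul_one]

lemma jac_mulVec_pullVec (Z : E4 → E4) {x : E4} (hx : x ∈ V) :
    jac φ x *ᵥ (pullVec φ Z x).ofLp = (Z (φ x)).ofLp := by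
  simp [pullVec, Matrix.mulVec_mulVec, Matrix.mul_nonsing_inv _ (k.isUnit hx)]

lemma eq_pullVec {Z : E4 → E4} {v : E4} {x : E4} (hx : x ∈ V)
    (h : jac φ x *ᵥ v.ofLp = (Z (φ x)).ofLp) : v = pullVec φ Z x := by
  ext i
  rw [pullVec, ← h, Matrix.mulVec_mulVec, Matrix.nonsing_inv_mul _ (k.isUnit hx)]; simp

lemma codiff_pull {G T : Comp2} (h : MetricOn U G) (hT : SmM U T) {x : E4} (hx : x ∈ V)
    (b : Fin 4) : codiff (pull φ G) (pull φ T) b x =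
      ((jac φ x)ᵀ *ᵥ fun j => codiff G T j (φ x)) b := by
  simp only [codiff_eq, k.covM_pull h hT hx, Matrix.mulVec, dotProduct, Matrix.transpose_apply,
    mul_neg, Finset.sum_neg_distrib, neg_inj]
  set J := jac φ x
  set C : Fin 4 → Matrix (Fin 4) (Fin 4) ℝ := fun i => covM G T i (φ x)
  calc ∑ a, ((pull φ G x)⁻¹ * (Jᵀ * (∑ i, J i a • C i) * J)) a b
      = ∑ a, ∑ i, J i a * ((pull φ G x)⁻¹ * (Jᵀ * (C i * J))) a b := by
        refine Finset.sum_congr rfl fun a _ => ?_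
        simp only [Matrix.mul_sum, Matrix.sum_mul, Matrix.mul_smul, Matrix.smul_mul,
          Matrix.sum_apply, Matrix.smul_apply, smul_eq_mul, Matrix.mul_assoc]
    _ = ∑ i, (J * ((pull φ G x)⁻¹ * (Jᵀ * (C i * J)))) i b := by
        rw [Finset.sum_comm]; simp only [Matrix.mul_apply (M := J)]
    _ = ∑ i, ((G (φ x))⁻¹ * C i * J) i b := by
        refine Finset.sum_congr rfl fun i _ => ?_
        rw [← k.inv_pull G hx]; simp only [Matrix.mul_assoc, J]
    _ = _ := by
        simp only [Matrix.mul_apply (N := J), Finset.mul_sum]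
        rw [Finset.sum_comm]
        exact Finset.sum_congr rfl fun i _ => Finset.sum_congr rfl fun j _ => mul_comm _ _

lemma codiffVec_pull {G T : Comp2} (h : MetricOn U G) (hT : SmM U T) {x : E4} (hx : x ∈ V) :
    codiffVec (pull φ G) (pull φ T) x = pullVec φ (codiffVec G T) x := by
  apply k.eq_pullVec hx
  rw [codiffVec_eq, codiffVec_eq, ← k.inv_pull G hx]
  have : (fun b => codiff (pull φ G) (pull φ T) b x) =
      (jac φ x)ᵀ *ᵥ fun j => codiff G T j (φ x) := funext (k.codiff_pull h hT hx)
  rw [this]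
  simp only [Matrix.mulVec_mulVec, Matrix.mul_assoc]

/-- Orientation enters here: with det J > 0 the factor is det J rather than its absolute value, so η
and the Hodge dual are natural without a sign. -/
lemma sqrt_det_pull (G : Comp2) {x : E4} (hx : x ∈ V) : Real.sqrt |(pull φ G x).det| =
    (jac φ x).det * Real.sqrt |(G (φ x)).det| := by
  have hp := (k.det_pos x hx).le
  rw [pull, Matrix.det_mul, Matrix.det_mul, Matrix.det_transpose, abs_mul, abs_mul,
    abs_of_nonneg hp, mul_comm _ |_|, mul_assoc, Real.sqrt_mul (abs_nonneg _),
    Real.sqrt_mul_self hp, mul_comm]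

lemma raise_pull (G T : Comp2) {x : E4} (hx : x ∈ V) :
    jac φ x * raise (pull φ G) (pull φ T) x * (jac φ x)ᵀ = raise G T (φ x) := by
  rw [raise_eq, raise_eq, ← k.inv_pull G hx]
  simp only [pull, Matrix.transpose_mul, Matrix.mul_assoc, Matrix.transpose_transpose]

lemma hodge_pull (G T : Comp2) {x : E4} (hx : x ∈ V) :
    hodge (pull φ G) (pull φ T) x = pull φ (hodge G T) x := by
  rw [pull, hodge_eq, hodge_eq, ← k.raise_pull G T hx, k.sqrt_det_pull G hx, Matrix.mul_smul,
    Matrix.smul_mul, star_transform, smul_smul, mul_comm]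

lemma vol_pull (G : Comp2) {x : E4} (hx : x ∈ V) (a b c d : Fin 4) :
    volumeElement (pull φ G) a b c d x = ∑ i, ∑ j, ∑ m, ∑ l,
      volumeElement G i j m l (φ x) * (jac φ x i a * jac φ x j b * jac φ x m c * jac φ x l d) := by
  simp only [volumeElement, k.sqrt_det_pull G hx]
  rw [mul_comm (jac φ x).det, mul_assoc, ← leviCivita_transform]
  simp only [Finset.mul_sum, mul_assoc]

/-- Both sides are covariant 3-tensors. Viewed as families of matrices indexed by a, they transform
by conjugation with J and contraction of a, and both operations can be cancelled. -/
lemma pairEq_pull {G A : Comp2} (h : MetricOn U G) (hA : SmM U A) {x : E4} (hx : x ∈ V)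
    (u w : E4 → E4) : PairEq (pull φ G) (pull φ A) (pullVec φ u x).ofLp (pullVec φ w x).ofLp x ↔
      PairEq G A (u (φ x)).ofLp (w (φ x)).ofLp (φ x) := by
  set J := jac φ x with hJ
  set v := (u (φ x)).ofLp
  set t := (w (φ x)).ofLp
  set S : Fin 4 → Matrix (Fin 4) (Fin 4) ℝ := fun a => Matrix.of fun b c =>
    G (φ x) a c * (G (φ x) *ᵥ v) b - G (φ x) a b * (G (φ x) *ᵥ v) c
    + ∑ d, volumeElement G a b c d (φ x) * t d with hS
  have hu : pull φ G x *ᵥ (pullVec φ u x).ofLp = Jᵀ *ᵥ (G (φ x) *ᵥ v) := by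
    rw [pull, ← Matrix.mulVec_mulVec, k.jac_mulVec_pullVec u hx, Matrix.mulVec_mulVec]
  have h2 : PairEq G A v t (φ x) ↔ ∀ i, (3 : ℝ) • covM G A i (φ x) = S i :=
    ⟨fun H i => by ext b c; exact H i b c, fun H a b c => congrFun (congrFun (H a) b) c⟩
  have hvol : ∀ a b c, ∑ d, volumeElement (pull φ G) a b c d x * (pullVec φ w x).ofLp d =
      ∑ i, ∑ j, ∑ m, J i a * (J j b * J m c * ∑ l, volumeElement G i j m l (φ x) * t l) := by
    intro a b c
    have ht : t = J *ᵥ (pullVec φ w x).ofLp := (k.jac_mulVec_pullVec w hx).symm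
    simp only [k.vol_pull G hx, Finset.sum_mul, ht, Matrix.mulVec, dotProduct,
      Finset.mul_sum]
    rw [sum_rotate]
    exact Finset.sum_congr rfl fun i _ => Finset.sum_congr rfl fun j _ =>
      Finset.sum_congr rfl fun m _ => Finset.sum_congr rfl fun l _ =>
      Finset.sum_congr rfl fun d _ => by ring
  have hS' : ∀ a b c, (Jᵀ * (∑ i, J i a • S i) * J) b c =
      pull φ G x a c * (Jᵀ *ᵥ (G (φ x) *ᵥ v)) b - pull φ G x a b * (Jᵀ *ᵥ (G (φ x) *ᵥ v)) c
        + ∑ d, volumeElement (pull φ G) a b c d x * (pullVec φ w x).ofLp d := by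
    intro a b c
    rw [hvol]
    set r := G (φ x) *ᵥ v
    have hp : ∀ c, pull φ G x a c = ∑ i, ∑ j, J i a * J j c * G (φ x) i j := fun c =>
      conj_apply _ _ _ _
    rw [← sum_smul_conj]
    simp only [Matrix.sum_apply, Matrix.smul_apply, smul_eq_mul, conj_apply, hS, Matrix.of_apply,
      mul_add, mul_sub, Finset.sum_add_distrib, Finset.sum_sub_distrib, hp]
    congr 1
    · congr 1
      · simp only [Matrix.mulVec, dotProduct, Matrix.transpose_apply, Finset.mul_sum,
          Finset.sum_mul]
        conv_rhs => rw [Finset.sum_comm]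
        exact Finset.sum_congr rfl fun i _ => Finset.sum_congr rfl fun j _ =>
          Finset.sum_congr rfl fun m _ => by ring
      · simp only [Matrix.mulVec, dotProduct, Matrix.transpose_apply, Finset.mul_sum,
          Finset.sum_mul]
        conv_rhs => rw [Finset.sum_comm]
        refine Finset.sum_congr rfl fun i _ => ?_
        rw [Finset.sum_comm]
        exact Finset.sum_congr rfl fun j _ => Finset.sum_congr rfl fun m _ => by ring
    · simp only [Finset.mul_sum]
  have h1 : PairEq (pull φ G) (pull φ A) (pullVec φ u x).ofLp (pullVec φ w x).ofLp x ↔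
      ∀ c, Jᵀ * (∑ i, J i c • ((3 : ℝ) • covM G A i (φ x))) * J =
        Jᵀ * (∑ i, J i c • S i) * J := by
    have h3 : ∀ c, Jᵀ * (∑ i, J i c • ((3 : ℝ) • covM G A i (φ x))) * J =
        (3 : ℝ) • covM (pull φ G) (pull φ A) c x := by
      intro c
      rw [k.covM_pull h hA hx]
      simp only [smul_comm _ (3 : ℝ), ← Finset.smul_sum, Matrix.mul_smul, Matrix.smul_mul, hJ]
    constructor
    · intro H c
      rw [h3]
      ext a b
      rw [hS']
      have := H c a b
      rw [hu] at this
      exact this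
    · intro H a b c
      rw [hu, ← hS', ← H, h3]; rfl
  rw [h1, h2]
  constructor
  · intro H i
    exact contract_cancel (k.isUnit hx) (fun c => conj_cancel (k.isUnit hx) (H c)) i
  · intro H c
    simp only [H]

lemma ricci_pull {G : Comp2} (h : MetricOn U G) {x : E4} (hx : x ∈ V) :
    ricci (pull φ G) x = pull φ (ricci G) x := by
  set J := jac φ x with hJ
  have hR : ∀ c d, riemM (pull φ G) c d x =
      ∑ i, J i c • (J⁻¹ * (∑ j, J j d • riemM G i j (φ x)) * J) := by
    intro c d
    rw [← Matrix.nonsing_inv_mul_cancel_left _ (riemM (pull φ G) c d x) (k.isUnit hx),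
      k.jac_mul_riemM h hx]
    simp only [Matrix.mul_sum, Matrix.sum_mul, Matrix.mul_smul, Matrix.smul_mul, Matrix.mul_assoc,
      Finset.smul_sum, smul_smul, hJ]
  ext a b
  have e1 : ricci (pull φ G) x a b = ∑ c, riemM (pull φ G) c b x c a := rfl
  have e2 : ∀ i j, ricci G (φ x) i j = ∑ c, riemM G c j (φ x) c i := fun i j => rfl
  rw [e1]
  simp only [hR, Matrix.sum_apply, Matrix.smul_apply, smul_eq_mul]
  rw [Finset.sum_comm]
  have e3 : ∀ i, ∑ c, J i c * (J⁻¹ * (∑ j, J j b • riemM G i j (φ x)) * J) c a =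
      ((∑ j, J j b • riemM G i j (φ x)) * J) i a := by
    intro i
    rw [← Matrix.mul_apply, Matrix.mul_assoc J⁻¹,
      Matrix.mul_nonsing_inv_cancel_left _ _ (k.isUnit hx)]
  simp only [e3]
  rw [pull, conj_apply]
  simp only [e2, Matrix.mul_apply, Matrix.sum_apply, Matrix.smul_apply, smul_eq_mul,
    Finset.sum_mul, Finset.mul_sum]
  rw [Finset.sum_comm]
  refine Finset.sum_congr rfl fun i _ => ?_
  rw [Finset.sum_comm]
  exact Finset.sum_congr rfl fun j _ => Finset.sum_congr rfl fun c _ => by ring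

lemma dotProd_pull (G S T : Comp2) {x : E4} (hx : x ∈ V) :
    dotProd (pull φ G) (pull φ S) (pull φ T) x = pull φ (dotProd G S T) x := by
  simp only [dotProd, pull]
  rw [← k.inv_pull G hx]
  simp only [Matrix.mul_assoc, pull]

lemma constCurvAt_pull {G : Comp2} (h : MetricOn U G) {x : E4} (hx : x ∈ V) (K : ℝ) :
    ConstCurvAt (pull φ G) K x ↔ ConstCurvAt G K (φ x) := by
  set J := jac φ x with hJ
  set S : Comp2 → E4 → Fin 4 → Fin 4 → Matrix (Fin 4) (Fin 4) ℝ := fun G x c d =>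
    K • Matrix.of fun a b => G x a c * G x b d - G x a d * G x b c with hS
  have hcc : ∀ G x, ConstCurvAt G K x ↔ ∀ c d, riemD G c d x = S G x c d := fun G x =>
    ⟨fun H c d => by ext a b; exact H a b c d, fun H a b c d => congrFun (congrFun (H c d) a) b⟩
  have hR : ∀ c d, riemD (pull φ G) c d x =
      Jᵀ * (∑ i, J i c • ∑ j, J j d • riemD G i j (φ x)) * J := by
    intro c d
    rw [riemD_eq, pull, Matrix.mul_assoc, k.jac_mul_riemM h hx]
    simp only [riemD_eq, Matrix.mul_sum, Matrix.sum_mul, Matrix.mul_smul, Matrix.smul_mul,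
      Matrix.mul_assoc, Finset.smul_sum, smul_smul, hJ]
  have hS' : ∀ c d, S (pull φ G) x c d =
      Jᵀ * (∑ i, J i c • ∑ j, J j d • S G (φ x) i j) * J := by
    intro c d
    have hp : ∀ a c, pull φ G x a c = ∑ i, J i c * (Jᵀ * G (φ x)) a i := fun a c => by
      rw [pull, Matrix.mul_apply]; exact Finset.sum_congr rfl fun i _ => mul_comm _ _
    have hT : ∀ i j, Jᵀ * (Matrix.of fun a b => G (φ x) a i * G (φ x) b j
        - G (φ x) a j * G (φ x) b i) * J = Matrix.of fun a b =>
        (Jᵀ * G (φ x)) a i * (Jᵀ * G (φ x)) b j - (Jᵀ * G (φ x)) a j * (Jᵀ * G (φ x)) b i := by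
      intro i j
      ext a b
      rw [conj_apply]
      simp only [Matrix.of_apply, Matrix.mul_apply, Matrix.transpose_apply, Finset.sum_mul_sum,
        ← Finset.sum_sub_distrib]
      exact Finset.sum_congr rfl fun i _ => Finset.sum_congr rfl fun j _ => by ring
    simp only [hS, Matrix.mul_sum, Matrix.sum_mul, Matrix.mul_smul, Matrix.smul_mul, hT,
      Finset.smul_sum, smul_smul]
    ext a b
    simp only [Matrix.sum_apply, Matrix.smul_apply, smul_eq_mul, Matrix.of_apply, hp,
      mul_sub, Finset.sum_sub_distrib, Finset.sum_mul_sum]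
    simp only [Finset.mul_sum]
    congr 1
    · exact Finset.sum_congr rfl fun i _ => Finset.sum_congr rfl fun j _ => by ring
    · rw [Finset.sum_comm]
      exact Finset.sum_congr rfl fun i _ => Finset.sum_congr rfl fun j _ => by ring
  rw [hcc, hcc]
  simp only [hR, hS']
  constructor
  · intro H i j
    have h1 : ∀ d i, ∑ j, J j d • riemD G i j (φ x) = ∑ j, J j d • S G (φ x) i j := fun d =>
      contract_cancel (k.isUnit hx) fun c => conj_cancel (k.isUnit hx) (H c d)
    exact contract_cancel (k.isUnit hx) (fun d => h1 d i) j
  · intro H c d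
    simp only [H]

end CoordMap

/-! ### Naturality of Lie derivatives and Lie brackets. -/

lemma contDiffOn_mulVec {U : Set E4} {F : Comp2} {Z : E4 → E4} (hF : SmM U F)
    (hZ : ContDiffOn ℝ ∞ Z U) :
    ContDiffOn ℝ ∞ (fun y => (WithLp.toLp 2 (F y *ᵥ (Z y).ofLp) : E4)) U := by
  refine contDiffOn_of_coord fun i => ?_
  simp only [Matrix.mulVec, dotProduct]
  exact ContDiffOn.sum fun j _ => (hF i j).mul (contDiffOn_coord hZ j)

lemma lieBracket_apply {Z W : E4 → E4} {y : E4} (hZ : DifferentiableAt ℝ Z y)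
    (hW : DifferentiableAt ℝ W y) : (VectorField.lieBracket ℝ Z W y).ofLp =
      jac W y *ᵥ (Z y).ofLp - jac Z y *ᵥ (W y).ofLp := by
  rw [VectorField.lieBracket, fderiv_apply_eq hZ, fderiv_apply_eq hW]; rfl

lemma contDiffOn_lieBracket {U : Set E4} {Z W : E4 → E4} (hU : IsOpen U)
    (hZ : ContDiffOn ℝ ∞ Z U) (hW : ContDiffOn ℝ ∞ W U) :
    ContDiffOn ℝ ∞ (VectorField.lieBracket ℝ Z W) U :=
  ((hW.fderiv_of_isOpen hU (by simp)).clm_apply hZ).sub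
    ((hZ.fderiv_of_isOpen hU (by simp)).clm_apply hW)

lemma smM_lieDeriv {U : Set E4} {Z : E4 → E4} {T : Comp2} (hU : IsOpen U)
    (hZ : ContDiffOn ℝ ∞ Z U) (hT : SmM U T) : SmM U (lieDeriv Z T) := by
  have : SmM U (fun y => ∑ c, Z y c • dM (bv c) T y + (jac Z y)ᵀ * T y + T y * jac Z y) :=
    ((SmM.sum fun c _ => SmM.smul (contDiffOn_coord hZ c) (hT.dM hU _)).add
      ((SmM.jac hZ hU).transpose.mul hT)).add (hT.mul (SmM.jac hZ hU))
  exact this.congr fun y _ => lieDeriv_eq Z T y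

namespace CoordMap

variable {V U : Set E4} {φ : E4 → E4} (k : CoordMap V U φ)
include k

lemma pullVec_smooth {Z : E4 → E4} (hZ : ContDiffOn ℝ ∞ Z U) :
    ContDiffOn ℝ ∞ (pullVec φ Z) V :=
  contDiffOn_mulVec (Z := fun x => Z (φ x)) (k.jac_smooth.inv fun x hx => (k.det_pos x hx).ne')
    (hZ.comp k.smooth k.mapsTo)

/-- Differentiate J·(φ^*Z) = Z ∘ φ. Working with this relation avoids differentiating J⁻¹. -/
lemma jac_pullVec {Z : E4 → E4} (hZ : ContDiffOn ℝ ∞ Z U) {x : E4} (hx : x ∈ V) :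
    jac φ x * jac (pullVec φ Z) x + ∑ a, (pullVec φ Z x) a • dM (bv a) (jac φ) x =
      jac Z (φ x) * jac φ x := by
  ext i b
  have hZ' := contDiffOn_diffAt hZ k.isOpen' (k.mapsTo hx)
  have h1 : pd b (fun z => ∑ a, jac φ z i a * pullVec φ Z z a) x =
      pd b (fun z => Z (φ z) i) x := by
    refine pd_congr k.isOpen (fun z hz => ?_) hx b
    have := congrFun (k.jac_mulVec_pullVec Z hz) i
    exact this
  have hpd : ∀ a, DifferentiableAt ℝ (fun z => pullVec φ Z z a) x := fun a =>
    contDiffOn_diffAt (contDiffOn_coord (k.pullVec_smooth hZ) a) k.isOpen hx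
  have hd : ∀ a ∈ Finset.univ, DifferentiableAt ℝ (fun z => jac φ z i a * pullVec φ Z z a) x :=
    fun a _ => (k.jac_diff hx i a).fun_mul (hpd a)
  rw [pd, fderiv_fun_sum hd, pd_comp (contDiffOn_diffAt (contDiffOn_coord hZ i) k.isOpen'
    (k.mapsTo hx)) (k.diffAt hx)] at h1
  simp only [Matrix.add_apply, Matrix.mul_apply, Matrix.sum_apply, Matrix.smul_apply, smul_eq_mul,
    dM_jac_symm k.smooth k.isOpen hx _ b i]
  rw [← Finset.sum_add_distrib]
  refine Eq.trans ?_ (h1.trans ?_)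
  · rw [_root_.sum_apply]
    refine Finset.sum_congr rfl fun a _ => ?_
    rw [fderiv_fun_mul (k.jac_diff hx i a) (hpd a)]
    rfl
  · exact Finset.sum_congr rfl fun j _ => mul_comm _ _

lemma lieDeriv_pull {Z : E4 → E4} (hZ : ContDiffOn ℝ ∞ Z U) {T : Comp2} (hT : SmM U T) {x : E4}
    (hx : x ∈ V) : lieDeriv (pullVec φ Z) (pull φ T) x = pull φ (lieDeriv Z T) x := by
  have hj := k.jac_pullVec hZ hx
  set J := jac φ x with hJ
  set N := jac (pullVec φ Z) x
  set H := ∑ a, (pullVec φ Z x) a • dM (bv a) (jac φ) x with hH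
  have hJN : J * N = jac Z (φ x) * J - H := eq_sub_of_add_eq hj
  have hNJ : Nᵀ * Jᵀ = (jac Z (φ x) * J - H)ᵀ := by rw [← hJN, Matrix.transpose_mul]
  have hD : ∑ c, pullVec φ Z x c • dM (bv c) (pull φ T) x =
      Hᵀ * T (φ x) * J + Jᵀ * (∑ i, Z (φ x) i • dM (bv i) T (φ x)) * J + Jᵀ * T (φ x) * H := by
    have hz : ∀ i, Z (φ x) i = ∑ c, J i c * pullVec φ Z x c := fun i =>
      (congrFun (k.jac_mulVec_pullVec Z hx) i).symm
    have hs : ∑ i, Z (φ x) i • dM (bv i) T (φ x) =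
        ∑ c, pullVec φ Z x c • ∑ i, J i c • dM (bv i) T (φ x) := by
      simp only [hz, Finset.sum_smul, Finset.smul_sum, smul_smul]
      rw [Finset.sum_comm]
      simp only [mul_comm]
    rw [hs]
    simp only [k.dM_pull hT hx, hH, smul_add, Finset.sum_add_distrib, Matrix.transpose_sum,
      Matrix.transpose_smul, Matrix.mul_sum, Matrix.sum_mul, Matrix.mul_smul, Matrix.smul_mul, hJ]
  rw [lieDeriv_eq, hD]
  have e1 : Nᵀ * pull φ T x = (jac Z (φ x) * J - H)ᵀ * T (φ x) * J := by
    rw [← hNJ, pull]; simp only [Matrix.mul_assoc, hJ]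
  have e2 : pull φ T x * N = Jᵀ * T (φ x) * (jac Z (φ x) * J - H) := by
    rw [← hJN, pull]; simp only [Matrix.mul_assoc, hJ]
  rw [e1, e2, pull, lieDeriv_eq]
  simp only [Matrix.transpose_sub, Matrix.transpose_mul, Matrix.sub_mul, Matrix.mul_sub,
    Matrix.mul_add, Matrix.add_mul, Matrix.mul_assoc, ← hJ]
  abel

/-- The corrections from the second derivatives of φ are symmetric in the two vectors, so they
cancel in the bracket. -/
lemma lieBracket_pull {Z W : E4 → E4} (hZ : ContDiffOn ℝ ∞ Z U) (hW : ContDiffOn ℝ ∞ W U) {x : E4}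
    (hx : x ∈ V) : VectorField.lieBracket ℝ (pullVec φ Z) (pullVec φ W) x =
      pullVec φ (VectorField.lieBracket ℝ Z W) x := by
  apply k.eq_pullVec hx
  rw [lieBracket_apply (contDiffOn_diffAt (k.pullVec_smooth hZ) k.isOpen hx)
      (contDiffOn_diffAt (k.pullVec_smooth hW) k.isOpen hx),
    lieBracket_apply (contDiffOn_diffAt hZ k.isOpen' (k.mapsTo hx))
      (contDiffOn_diffAt hW k.isOpen' (k.mapsTo hx)),
    Matrix.mulVec_sub, Matrix.mulVec_mulVec, Matrix.mulVec_mulVec,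
    eq_sub_of_add_eq (k.jac_pullVec hZ hx), eq_sub_of_add_eq (k.jac_pullVec hW hx),
    Matrix.sub_mulVec, Matrix.sub_mulVec, ← Matrix.mulVec_mulVec, ← Matrix.mulVec_mulVec,
    k.jac_mulVec_pullVec Z hx, k.jac_mulVec_pullVec W hx]
  have : (∑ a, (pullVec φ W x) a • dM (bv a) (jac φ) x) *ᵥ (pullVec φ Z x).ofLp =
      (∑ a, (pullVec φ Z x) a • dM (bv a) (jac φ) x) *ᵥ (pullVec φ W x).ofLp := by
    ext i
    simp only [Matrix.mulVec, dotProduct, Matrix.sum_apply, Matrix.smul_apply, smul_eq_mul,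
      Finset.sum_mul]
    rw [Finset.sum_comm]
    refine Finset.sum_congr rfl fun a _ => Finset.sum_congr rfl fun b _ => ?_
    rw [dM_jac_symm k.smooth k.isOpen hx b a i]; ring
  rw [this]; abel

end CoordMap

/-! ### Existence of oriented normal coordinates at a point. -/

lemma exists_frame_det_pos {g : Matrix (Fin 4) (Fin 4) ℝ}
    (h : ∃ P : Matrix (Fin 4) (Fin 4) ℝ, Pᵀ * g * P = mink) :
    ∃ P : Matrix (Fin 4) (Fin 4) ℝ, Pᵀ * g * P = mink ∧ 0 < P.det := by
  obtain ⟨P, hP⟩ := h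
  have h0 : P.det ≠ 0 := by
    intro h0
    have := lorentz_det hP
    rw [h0] at this; norm_num at this
  rcases lt_or_gt_of_ne h0 with hn | hp
  -- Reversing one spacelike frame vector changes the orientation and keeps the frame orthonormal.
  · refine ⟨P * Matrix.diagonal ![1, 1, 1, -1], ?_, ?_⟩
    · rw [Matrix.transpose_mul, Matrix.diagonal_transpose]
      calc _ = Matrix.diagonal ![1, 1, 1, -1] * (Pᵀ * g * P) * Matrix.diagonal ![1, 1, 1, -1] := by
            simp only [Matrix.mul_assoc]
        _ = _ := by
            rw [hP, mink, Matrix.diagonal_mul_diagonal, Matrix.diagonal_mul_diagonal]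
            congr 1; ext i; fin_cases i <;> simp
    · rw [Matrix.det_mul, Matrix.det_diagonal]
      simp [Fin.prod_univ_four, hn]
  · exact ⟨P, hP, hp⟩

/-- The quadratic map with prescribed value, Jacobian and second derivatives at the origin. -/
def quadMap (y : E4) (P : Matrix (Fin 4) (Fin 4) ℝ) (Q : Fin 4 → Matrix (Fin 4) (Fin 4) ℝ)
    (x : E4) : E4 :=
  WithLp.toLp 2 fun i => y i + ∑ a, P i a * x a - (1 / 2 : ℝ) * ∑ a, ∑ b, Q i a b * (x a * x b)

lemma contDiff_quadMap (y : E4) (P : Matrix (Fin 4) (Fin 4) ℝ)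
    (Q : Fin 4 → Matrix (Fin 4) (Fin 4) ℝ) : ContDiff ℝ ∞ (quadMap y P Q) := by
  have hc : ∀ a : Fin 4, ContDiff ℝ ∞ (fun x : E4 => x a) := fun a =>
    (EuclideanSpace.proj (𝕜 := ℝ) a).contDiff
  refine contDiff_euclidean.2 fun i => ?_
  exact (contDiff_const.add (ContDiff.sum fun a _ => contDiff_const.mul (hc a))).sub
    (contDiff_const.mul (ContDiff.sum fun a _ => ContDiff.sum fun b _ =>
      contDiff_const.mul ((hc a).mul (hc b))))

lemma jac_quadMap (y : E4) (P : Matrix (Fin 4) (Fin 4) ℝ) (Q : Fin 4 → Matrix (Fin 4) (Fin 4) ℝ)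
    (hQ : ∀ i a b, Q i a b = Q i b a) (x : E4) (i c : Fin 4) :
    jac (quadMap y P Q) x i c = P i c - ∑ b, Q i c b * x b := by
  have hc : ∀ a : Fin 4, HasFDerivAt (fun x : E4 => x a) (EuclideanSpace.proj (𝕜 := ℝ) a) x :=
    fun a => (EuclideanSpace.proj (𝕜 := ℝ) a).hasFDerivAt
  have h : HasFDerivAt (fun z : E4 => y i + ∑ a, P i a * z a
      - (1 / 2 : ℝ) * ∑ a, ∑ b, Q i a b * (z a * z b)) _ x :=
    ((HasFDerivAt.fun_sum (u := Finset.univ) fun a _ => (hc a).const_mul (P i a)).const_add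
      (y i)).sub ((HasFDerivAt.fun_sum (u := Finset.univ) fun a _ =>
        HasFDerivAt.fun_sum (u := Finset.univ) fun b _ =>
          ((hc a).fun_mul (hc b)).const_mul (Q i a b)).const_mul (1 / 2 : ℝ))
  rw [jac_apply, pd]
  change fderiv ℝ (fun z : E4 => y i + ∑ a, P i a * z a
      - (1 / 2 : ℝ) * ∑ a, ∑ b, Q i a b * (z a * z b)) x _ = _
  rw [h.fderiv]
  have hp : ∀ a, (EuclideanSpace.proj (𝕜 := ℝ) a : E4 →L[ℝ] ℝ) (bv c) = if a = c then 1 else 0 := by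
    intro a; simp [Pi.single_apply]
  simp only [_root_.sub_apply, _root_.sum_apply, _root_.smul_apply, _root_.add_apply, smul_eq_mul,
    hp, mul_ite, mul_one, mul_zero, mul_add,
    Finset.sum_add_distrib, Finset.sum_ite_eq', Finset.mem_univ, if_true, Finset.sum_ite_irrel,
    Finset.sum_const_zero]
  simp only [hQ i _ c]
  ring

/-- Normal coordinates at a point. -/
theorem MetricOn.exists_normal {U : Set E4} {G : Comp2} (h : MetricOn U G) {y : E4} (hy : y ∈ U) :
    ∃ (φ : E4 → E4) (V : Set E4), CoordMap V U φ ∧ 0 ∈ V ∧ φ 0 = y ∧ pull φ G 0 = mink ∧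
      ∀ a b c, pd c (fun z => pull φ G z a b) 0 = 0 := by
  obtain ⟨P, hP, hPd⟩ := exists_frame_det_pos (h.lorentz y hy)
  -- The quadratic term is the Christoffel form expressed in the frame P: the gauge law at the
  -- origin then reads P·Γ' = ΓP − Q = 0.
  set Q : Fin 4 → Matrix (Fin 4) (Fin 4) ℝ := fun i => Pᵀ * (Matrix.of fun j l =>
    christoffel G i j l y) * P with hQdef
  have hQe : ∀ i, Q i = Pᵀ * (Matrix.of fun j l => christoffel G i j l y) * P := fun _ => rfl
  have hQ : ∀ i a b, Q i a b = Q i b a := by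
    intro i a b
    have : (Q i)ᵀ = Q i := by
      have h1 : (Matrix.of fun j l => christoffel G i j l y)ᵀ =
          (Matrix.of fun j l => christoffel G i j l y : Matrix (Fin 4) (Fin 4) ℝ) := by
        ext j l; exact h.christoffel_symm hy i l j
      simp only [hQdef, Matrix.transpose_mul, Matrix.transpose_transpose, h1, Matrix.mul_assoc]
    exact (congrFun (congrFun this a) b).symm
  set φ := quadMap y P Q with hφ
  have hφs : ContDiff ℝ ∞ φ := contDiff_quadMap y P Q
  have hjac : ∀ x i c, jac φ x i c = P i c - ∑ b, Q i c b * x b := jac_quadMap y P Q hQ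
  have hJs : SmM Set.univ (jac φ) := SmM.jac hφs.contDiffOn isOpen_univ
  have hφ0 : φ 0 = y := by ext i; simp [hφ, quadMap]
  have hJ0 : jac φ 0 = P := by ext i c; simp [hjac]
  have hdc : Continuous fun x => (jac φ x).det := by
    have := (contDiffOn_det hJs).continuousOn
    rwa [← continuousOn_univ]
  have hk : CoordMap (φ ⁻¹' U ∩ {x | 0 < (jac φ x).det}) U φ :=
    -- No inverse function theorem is needed: a `CoordMap` only asks for a positive Jacobian, not
    -- for injectivity.
    { isOpen := (h.isOpen.preimage hφs.continuous).inter (isOpen_lt continuous_const hdc)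
      isOpen' := h.isOpen
      mapsTo := fun x hx => hx.1
      smooth := hφs.contDiffOn
      det_pos := fun x hx => hx.2 }
  have h0 : (0 : E4) ∈ φ ⁻¹' U ∩ {x | 0 < (jac φ x).det} := by
    refine ⟨?_, ?_⟩
    · simpa only [Set.mem_preimage, hφ0] using hy
    · simpa only [Set.mem_ofPred_eq, hJ0] using hPd
  refine ⟨φ, _, hk, h0, hφ0, by rw [pull, hφ0, hJ0, hP], fun a b c => ?_⟩
  have hdJ : ∀ c, dM (bv c) (jac φ) 0 = - Matrix.of fun i a => Q i a c := by
    intro c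
    ext i a
    have hc : ∀ a : Fin 4, HasFDerivAt (fun x : E4 => x a) (EuclideanSpace.proj (𝕜 := ℝ) a)
      (0 : E4) := fun a => (EuclideanSpace.proj (𝕜 := ℝ) a).hasFDerivAt
    have hd : HasFDerivAt (fun z : E4 => P i a - ∑ b, Q i a b * z b) _ (0 : E4) :=
      (HasFDerivAt.fun_sum (u := Finset.univ) fun b _ => (hc b).const_mul (Q i a b)).const_sub _
    rw [dM_apply]
    simp only [hjac]
    rw [hd.fderiv]
    simp [Pi.single_apply]
  have hΓ : ∀ c, christM (pull φ G) c 0 = 0 := by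
    intro c
    have := hk.jac_mul_christM h h0 c
    rw [hdJ, hJ0, hφ0] at this
    have h2 : (∑ i, P i c • christM G i y) * P - (Matrix.of fun i a => Q i a c) = 0 := by
      ext i a
      rw [Matrix.sub_apply, Matrix.of_apply, hQ, hQe, conj_apply]
      simp only [Matrix.sum_mul, Matrix.smul_mul, Matrix.sum_apply, Matrix.smul_apply,
        Matrix.mul_apply, smul_eq_mul, christM_apply, Matrix.of_apply, Matrix.zero_apply,
        Finset.mul_sum, Finset.sum_mul]
      rw [sub_eq_zero, Finset.sum_comm]
      exact Finset.sum_congr rfl fun i _ => Finset.sum_congr rfl fun j _ => by ring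
    rw [← sub_eq_add_neg, h2] at this
    rw [← Matrix.nonsing_inv_mul_cancel_left P (christM (pull φ G) c 0) hPd.ne'.isUnit, this,
      Matrix.mul_zero]
  rw [← dM_bv, (hk.metricOn h).dM_eq h0, hΓ]
  simp

/-! ### Tensor formulas at the origin of normal coordinates. -/

/-- The signs of the Minkowski metric. -/
def sg (a : Fin 4) : ℝ := ![(-1 : ℝ), 1, 1, 1] a

@[simp] lemma sg_zero : sg 0 = -1 := rfl
@[simp] lemma sg_one : sg 1 = 1 := rfl
@[simp] lemma sg_two : sg 2 = 1 := rfl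
@[simp] lemma sg_three : sg 3 = 1 := rfl

lemma sg_mul_self (a : Fin 4) : sg a * sg a = 1 := by fin_cases a <;> simp

lemma mink_apply (a b : Fin 4) : mink a b = if a = b then sg a else 0 := by
  simp [mink, Matrix.diagonal_apply, sg]

lemma mink_mul_mink : mink * mink = 1 := by
  rw [mink, Matrix.diagonal_mul_diagonal, ← Matrix.diagonal_one]
  congr 1; ext i; fin_cases i <;> simp

lemma mink_inv : mink⁻¹ = mink := Matrix.inv_eq_left_inv mink_mul_mink

lemma mink_mulVec (u : Fin 4 → ℝ) (a : Fin 4) : (mink *ᵥ u) a = sg a * u a := by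
  rw [Matrix.mulVec_diagonal, sg]

/-- A Lorentz metric near the origin that is Minkowskian to first order there. -/
structure Normal (V : Set E4) (G : Comp2) : Prop extends MetricOn V G where
  zero_mem : (0 : E4) ∈ V
  val : G 0 = mink
  deriv : ∀ a b c, pd c (fun z => G z a b) 0 = 0

lemma fderiv_ext_pd {f : E4 → ℝ} {x : E4} (h : ∀ c, pd c f x = 0) : fderiv ℝ f x = 0 := by
  ext v
  rw [fderiv_eq_sum_pd]
  simp [h]

lemma differentiable_sqrt_det {M : Fin 4 → Fin 4 → ℝ} (h : (Matrix.of M).det ≠ 0) :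
    DifferentiableAt ℝ (fun M : Fin 4 → Fin 4 → ℝ => Real.sqrt |(Matrix.of M).det|) M := by
  have hd : DifferentiableAt ℝ (fun M : Fin 4 → Fin 4 → ℝ => (Matrix.of M).det) M := by
    simp only [Matrix.det_apply, Matrix.of_apply]
    have : ContDiff ℝ 1 (fun M : Fin 4 → Fin 4 → ℝ =>
        ∑ σ : Equiv.Perm (Fin 4), Equiv.Perm.sign σ • ∏ i, M (σ i) i) :=
      ContDiff.sum fun σ _ => ContDiff.const_smul _ (contDiff_prod fun i _ =>
        (contDiff_apply ℝ ℝ i).comp (contDiff_apply ℝ (Fin 4 → ℝ) (σ i)))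
    exact this.contDiffAt.differentiableAt (by simp)
  exact (DifferentiableAt.abs hd h).sqrt (abs_ne_zero.2 h)

namespace Normal

variable {V : Set E4} {G : Comp2} (h : Normal V G)
include h

lemma val_apply (a b : Fin 4) : G 0 a b = if a = b then sg a else 0 := by
  rw [h.val, mink_apply]

lemma val_inv : (G 0)⁻¹ = mink := by rw [h.val, mink_inv]

lemma dM_zero (v : E4) : dM v G 0 = 0 := by
  ext a b
  rw [dM_apply, fderiv_ext_pd fun c => h.deriv a b c]; rfl

lemma inv_diff : DiffM (fun z => (G z)⁻¹) 0 := h.inv_smooth.diffM h.isOpen h.zero_mem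

lemma pd_inv (a b c : Fin 4) : pd c (fun z => (G z)⁻¹ a b) 0 = 0 := by
  have h1 : dM (bv c) (fun z => G z * (G z)⁻¹) 0 = 0 := by
    rw [dM_congr (H := fun _ => 1) (Filter.eventuallyEq_of_mem (h.isOpen.mem_nhds h.zero_mem)
      fun z hz => Matrix.mul_nonsing_inv _ (h.isUnit hz))]
    ext i j
    simp [dM_apply]
  rw [dM_mul (h.toMetricOn.diffM h.zero_mem) h.inv_diff, h.dM_zero, Matrix.zero_mul, zero_add] at h1
  have h2 := Matrix.nonsing_inv_mul_cancel_left (G 0) (dM (bv c) (fun z => (G z)⁻¹) 0)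
    (h.isUnit h.zero_mem)
  rw [h1, Matrix.mul_zero] at h2
  rw [← dM_bv (F := fun z => (G z)⁻¹), ← h2]; rfl

lemma christoffel_zero (a b c : Fin 4) : christoffel G a b c 0 = 0 := by
  simp [christoffel, h.deriv]

lemma covDeriv_zero (T : Comp2) (a b c : Fin 4) :
    covDeriv G T a b c 0 = pd a (fun z => T z b c) 0 := by
  simp [covDeriv, h.christoffel_zero]

lemma sqrt_det_zero : Real.sqrt |(G 0).det| = 1 := by
  rw [h.val, det_mink]; norm_num

/-- The volume factor is a differentiable function of the metric entries, whose first derivatives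
vanish at the origin. -/
lemma sqrt_det_diff : HasFDerivAt (fun z => Real.sqrt |(G z).det|) (0 : E4 →L[ℝ] ℝ) 0 := by
  have hG : HasFDerivAt (fun z => (fun a b => G z a b : Fin 4 → Fin 4 → ℝ))
      (0 : E4 →L[ℝ] (Fin 4 → Fin 4 → ℝ)) 0 := by
    refine hasFDerivAt_pi'.2 fun a => hasFDerivAt_pi'.2 fun b => ?_
    have := (h.toMetricOn.diffM h.zero_mem a b).hasFDerivAt
    rw [fderiv_ext_pd fun c => h.deriv a b c] at this
    simpa using this
  have hd := (differentiable_sqrt_det (M := fun a b => G 0 a b)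
    (h.det_ne h.zero_mem)).hasFDerivAt.comp (0 : E4) hG
  rw [ContinuousLinearMap.comp_zero] at hd
  exact hd

lemma vol_zero (a b c d : Fin 4) : volumeElement G a b c d 0 = leviCivita a b c d := by
  rw [volumeElement, h.sqrt_det_zero, one_mul]

lemma vol_hasFDerivAt (a b c d : Fin 4) :
    HasFDerivAt (volumeElement G a b c d) (0 : E4 →L[ℝ] ℝ) 0 := by
  have := h.sqrt_det_diff.mul_const (leviCivita a b c d)
  exact this.congr_fderiv (smul_zero _)

lemma raise_zero (T : Comp2) (a b : Fin 4) : raise G T 0 a b = sg a * sg b * T 0 a b := by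
  simp only [raise, h.val_inv, mink_apply]
  simp [Finset.sum_ite_eq]

lemma raise_hasFDerivAt {T : Comp2} (hT : DiffM T 0) (a b : Fin 4) :
    HasFDerivAt (fun z => raise G T z a b)
      ((sg a * sg b) • fderiv ℝ (fun z => T z a b) 0) 0 := by
  have hi : ∀ a b, HasFDerivAt (fun z => (G z)⁻¹ a b) (0 : E4 →L[ℝ] ℝ) 0 := fun a b => by
    have := (h.inv_diff a b).hasFDerivAt
    rwa [fderiv_ext_pd fun c => h.pd_inv a b c] at this
  have : HasFDerivAt (fun z => raise G T z a b) _ 0 :=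
    HasFDerivAt.fun_sum (u := Finset.univ) fun c _ => HasFDerivAt.fun_sum (u := Finset.univ)
      fun d _ => ((hi a c).fun_mul (hi b d)).fun_mul (hT c d).hasFDerivAt
  refine this.congr_fderiv ?_
  simp only [h.val_inv, mink_apply, smul_zero, add_zero]
  ext v
  simp [Finset.sum_ite_eq, _root_.sum_apply]

lemma hodge_hasFDerivAt {T : Comp2} (hT : DiffM T 0) (a b : Fin 4) :
    HasFDerivAt (fun z => hodge G T z a b) ((1 / 2 : ℝ) • ∑ c, ∑ d,
      (leviCivita a b c d * (sg c * sg d)) • fderiv ℝ (fun z => T z c d) 0) 0 := by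
  have : HasFDerivAt (fun z => hodge G T z a b) _ 0 :=
    (HasFDerivAt.fun_sum (u := Finset.univ) fun c _ => HasFDerivAt.fun_sum (u := Finset.univ)
      fun d _ => (h.vol_hasFDerivAt a b c d).fun_mul (h.raise_hasFDerivAt hT c d)).const_mul
        (1 / 2 : ℝ)
  refine this.congr_fderiv ?_
  simp only [h.vol_zero, smul_smul, smul_zero, add_zero]

lemma hodge_zero (T : Comp2) (a b : Fin 4) : hodge G T 0 a b =
    (1 / 2 : ℝ) * ∑ c, ∑ d, leviCivita a b c d * (sg c * sg d) * T 0 c d := by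
  simp only [hodge, h.vol_zero, h.raise_zero, mul_assoc]

/-- The metric and η are constant to first order at the origin, so the dual commutes with first
derivatives there. -/
lemma pd_hodge {T : Comp2} (hT : DiffM T 0) (e a b : Fin 4) :
    pd e (fun z => hodge G T z a b) 0 = (1 / 2 : ℝ) * ∑ c, ∑ d,
      leviCivita a b c d * (sg c * sg d) * pd e (fun z => T z c d) 0 := by
  rw [pd, (h.hodge_hasFDerivAt hT a b).fderiv]
  simp [_root_.sum_apply, pd]

lemma codiff_zero (T : Comp2) (b : Fin 4) :
    codiff G T b 0 = - ∑ a, sg a * pd a (fun z => T z a b) 0 := by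
  simp only [codiff, h.val_inv, mink_apply, h.covDeriv_zero]
  simp [Finset.sum_ite_eq]

lemma codiffVec_zero (T : Comp2) (a : Fin 4) :
    codiffVec G T 0 a = sg a * codiff G T a 0 := by
  rw [codiffVec_eq, h.val_inv, mink_mulVec]

lemma pairEq_zero (A : Comp2) (u w : Fin 4 → ℝ) : PairEq G A u w 0 ↔ ∀ a b c,
    3 * pd a (fun z => A z b c) 0 = (if a = c then sg a else 0) * (sg b * u b)
      - (if a = b then sg a else 0) * (sg c * u c) + ∑ d, leviCivita a b c d * w d := by
  simp only [PairEq, h.covDeriv_zero, h.val, mink_mulVec, mink_apply, h.vol_zero]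

end Normal

/-! ### From the conformal Killing-Yano equation to the pair equation. -/

lemma three_form_eq (F : Fin 4 → Fin 4 → Fin 4 → ℝ) (h1 : ∀ a b c, F a b c = - F b a c)
    (h2 : ∀ a b c, F a b c = - F a c b) (a b c : Fin 4) : F a b c =
      ∑ d, leviCivita a b c d * (sg d * ((1 / 6 : ℝ) * - ∑ p, sg p * ∑ q, ∑ r,
        leviCivita p d q r * (sg q * sg r) * F p q r)) := by
  have e1 : ∀ a c, F a a c = 0 := fun a c => by linarith [h1 a a c]
  have e2 : ∀ a c, F a c c = 0 := fun a c => by linarith [h2 a c c]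
  have e3 : ∀ a c, F a c a = 0 := fun a c => by linarith [h1 a c a, e2 c a]
  have p1 : ∀ a b c, F b a c = - F a b c := fun a b c => h1 _ _ _
  have p2 : ∀ a b c, F a c b = - F a b c := fun a b c => h2 _ _ _
  have p3 : ∀ a b c, F b c a = F a b c := fun a b c => by linarith [h1 a b c, h2 b a c]
  have p4 : ∀ a b c, F c a b = F a b c := fun a b c => by linarith [h2 a c b, h1 c a b, h2 a b c]
  have p5 : ∀ a b c, F c b a = - F a b c := fun a b c => by linarith [p3 a b c, h1 b c a]
  -- The vector dual to the 3-form. The factor 1/6 is the 1/2 of the Hodge dual times 1/3, since F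
  -- will be 3∇A up to trace terms; w then becomes exactly δ*A.
  set w : Fin 4 → ℝ := fun d => sg d * ((1 / 6 : ℝ) * - ∑ p, sg p * ∑ q, ∑ r,
        leviCivita p d q r * (sg q * sg r) * F p q r) with hw
  have w0 : w 0 = - F 1 2 3 := by
    simp only [hw, Fin.sum_univ_four, leviCivita_values, leviCivita_self_12, leviCivita_self_13,
      leviCivita_self_14, leviCivita_self_23, leviCivita_self_24, leviCivita_self_34, sg_zero,
      sg_one, sg_two, sg_three, p1 1 2 3, p2 1 2 3, p3 1 2 3, p4 1 2 3, p5 1 2 3]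
    ring
  have w1 : w 1 = F 0 2 3 := by
    simp only [hw, Fin.sum_univ_four, leviCivita_values, leviCivita_self_12, leviCivita_self_13,
      leviCivita_self_14, leviCivita_self_23, leviCivita_self_24, leviCivita_self_34, sg_zero,
      sg_one, sg_two, sg_three, p1 0 2 3, p2 0 2 3, p3 0 2 3, p4 0 2 3, p5 0 2 3]
    ring
  have w2 : w 2 = - F 0 1 3 := by
    simp only [hw, Fin.sum_univ_four, leviCivita_values, leviCivita_self_12, leviCivita_self_13,
      leviCivita_self_14, leviCivita_self_23, leviCivita_self_24, leviCivita_self_34, sg_zero,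
      sg_one, sg_two, sg_three, p1 0 1 3, p2 0 1 3, p3 0 1 3, p4 0 1 3, p5 0 1 3]
    ring
  have w3 : w 3 = F 0 1 2 := by
    simp only [hw, Fin.sum_univ_four, leviCivita_values, leviCivita_self_12, leviCivita_self_13,
      leviCivita_self_14, leviCivita_self_23, leviCivita_self_24, leviCivita_self_34, sg_zero,
      sg_one, sg_two, sg_three, p1 0 1 2, p2 0 1 2, p3 0 1 2, p4 0 1 2, p5 0 1 2]
    ring
  change F a b c = ∑ d, leviCivita a b c d * w d
  rw [Fin.sum_univ_four, w0, w1, w2, w3]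
  clear_value w
  fin_cases a <;> fin_cases b <;> fin_cases c <;>
    simp [leviCivita_values, e1, e2, e3, p1 1 2 3, p2 1 2 3, p3 1 2 3, p4 1 2 3, p5 1 2 3,
      p1 0 2 3, p2 0 2 3, p3 0 2 3, p4 0 2 3, p5 0 2 3,
      p1 0 1 3, p2 0 1 3, p3 0 1 3, p4 0 1 3, p5 0 1 3,
      p1 0 1 2, p2 0 1 2, p3 0 1 2, p4 0 1 2, p5 0 1 2]

/-- The conformal Killing-Yano equation at a point. -/
def CKYEq (G A : Comp2) (y : E4) : Prop := ∀ a b c,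
  3 * (covDeriv G A a b c y + covDeriv G A b a c y) =
    G y a c * codiff G A b y + G y b c * codiff G A a y - 2 * G y a b * codiff G A c y

/-- Antisymmetry of the components on a set. -/
def AntisymmOn (U : Set E4) (A : Comp2) : Prop := ∀ y ∈ U, ∀ a b, A y a b = - A y b a

lemma AntisymmOn.transpose {U : Set E4} {A : Comp2} (h : AntisymmOn U A) {y : E4} (hy : y ∈ U) :
    (A y)ᵀ = - A y := by
  ext a b; exact h y hy b a

lemma AntisymmOn.pd {U : Set E4} {A : Comp2} (h : AntisymmOn U A) (hU : IsOpen U) {y : E4}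
    (hy : y ∈ U) (c a b : Fin 4) : pd c (fun z => A z a b) y = - pd c (fun z => A z b a) y := by
  rw [pd_congr hU (fun z hz => h z hz a b) hy, CKY.pd, CKY.pd, fderiv_fun_neg]; rfl

namespace CoordMap

variable {V U : Set E4} {φ : E4 → E4} (k : CoordMap V U φ)
include k

lemma antisymmOn {A : Comp2} (hA : AntisymmOn U A) : AntisymmOn V (pull φ A) := by
  intro x hx a b
  have : (pull φ A x)ᵀ = - pull φ A x := by
    simp only [pull, Matrix.transpose_mul, Matrix.transpose_transpose,
      hA.transpose (k.mapsTo hx), Matrix.mul_assoc, Matrix.neg_mul, Matrix.mul_neg]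
  exact congrFun (congrFun this b) a

lemma ckyEq_pull {G A : Comp2} (h : MetricOn U G) (hA : SmM U A) {x : E4} (hx : x ∈ V)
    (hc : CKYEq G A (φ x)) : CKYEq (pull φ G) (pull φ A) x := by
  set J := jac φ x with hJ
  have h1 : ∀ a b c, covDeriv (pull φ G) (pull φ A) a b c x =
      ∑ i, ∑ j, ∑ m, J i a * J j b * J m c * covDeriv G A i j m (φ x) := by
    intro a b c
    rw [k.covDeriv_pull h hA hx]
    simp only [conj_apply, Finset.mul_sum, Matrix.of_apply, mul_assoc, hJ]
  have h2 : ∀ a b c, pull φ G x a c * codiff (pull φ G) (pull φ A) b x =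
      ∑ i, ∑ j, ∑ m, J i a * J j b * J m c * (G (φ x) i m * codiff G A j (φ x)) := by
    intro a b c
    rw [k.codiff_pull h hA hx, pull, conj_apply]
    simp only [Matrix.mulVec, dotProduct, Matrix.transpose_apply, Finset.mul_sum, Finset.sum_mul]
    rw [Finset.sum_comm]
    refine Finset.sum_congr rfl fun i _ => Finset.sum_congr rfl fun j _ =>
      Finset.sum_congr rfl fun m _ => by ring
  have sw : ∀ (X : Fin 4 → Fin 4 → Fin 4 → ℝ) (a b c : Fin 4),
      ∑ i, ∑ j, ∑ m, J i b * J j a * J m c * X i j m =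
      ∑ i, ∑ j, ∑ m, J i a * J j b * J m c * X j i m := by
    intro X a b c
    rw [Finset.sum_comm]
    exact Finset.sum_congr rfl fun i _ => Finset.sum_congr rfl fun j _ =>
      Finset.sum_congr rfl fun m _ => by ring
  have sw' : ∀ (X : Fin 4 → Fin 4 → Fin 4 → ℝ) (a b c : Fin 4),
      ∑ i, ∑ j, ∑ m, J i a * J j c * J m b * X i j m =
      ∑ i, ∑ j, ∑ m, J i a * J j b * J m c * X i m j := by
    intro X a b c
    refine Finset.sum_congr rfl fun i _ => ?_
    rw [Finset.sum_comm]
    exact Finset.sum_congr rfl fun j _ => Finset.sum_congr rfl fun m _ => by ring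
  intro a b c
  rw [mul_assoc 2, h1, h1, sw _ a b c, h2 a b c, h2 b a c, h2 a c b, sw _ a b c, sw' _ a b c]
  simp only [← Finset.sum_add_distrib, ← Finset.sum_sub_distrib, Finset.mul_sum]
  refine Finset.sum_congr rfl fun i _ => Finset.sum_congr rfl fun j _ =>
    Finset.sum_congr rfl fun m _ => ?_
  linear_combination (J i a * J j b * J m c) * hc i j m

end CoordMap

/-- Reduction of a pointwise statement to normal coordinates. -/
lemma MetricOn.exists_normal' {U : Set E4} {G : Comp2} (h : MetricOn U G) {y : E4} (hy : y ∈ U) :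
    ∃ (φ : E4 → E4) (V : Set E4), CoordMap V U φ ∧ φ 0 = y ∧ Normal V (pull φ G) := by
  obtain ⟨φ, V, k, h0, hφ, hv, hd⟩ := h.exists_normal hy
  exact ⟨φ, V, k, hφ, ⟨k.metricOn h, h0, hv, hd⟩⟩

namespace Normal

variable {V : Set E4} {G : Comp2} (h : Normal V G)
include h

/-- Subtracting the trace terms from 3∇A leaves F, antisymmetric in the first pair by the conformal
Killing-Yano equation and in the last by antisymmetry of A. So F is a 3-form, and the trace terms do
not contribute to its dual vector because η kills symmetric index pairs. -/
lemma pairEq_of_ckyEq {A : Comp2} (hA : SmM V A) (ha : AntisymmOn V A) (hc : CKYEq G A 0) :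
    PairEq G A (codiffVec G A 0).ofLp (codiffVec G (hodge G A) 0).ofLp 0 := by
  rw [h.pairEq_zero]
  set Z : Fin 4 → ℝ := fun b => codiff G A b 0
  set T : Fin 4 → Fin 4 → Fin 4 → ℝ := fun a b c => pd a (fun z => A z b c) 0 with hT
  set g : Fin 4 → Fin 4 → ℝ := fun a b => if a = b then sg a else 0 with hg
  have gs : ∀ a b, g a b = g b a := fun a b => by
    simp only [hg, eq_comm (a := a)]; split_ifs with hab
    · rw [hab]
    · rfl
  have hc' : ∀ a b c, 3 * (T a b c + T b a c) = g a c * Z b + g b c * Z a - 2 * g a b * Z c := by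
    intro a b c
    have := hc a b c
    simpa only [h.covDeriv_zero, h.val_apply] using this
  have ht : ∀ a b c, T a b c = - T a c b := fun a b c => ha.pd h.isOpen h.zero_mem a b c
  set F : Fin 4 → Fin 4 → Fin 4 → ℝ := fun a b c => 3 * T a b c - g a c * Z b + g a b * Z c with hF
  have key := three_form_eq F
    (fun a b c => by simp only [hF]; linear_combination hc' a b c - gs a b * Z c)
    (fun a b c => by simp only [hF]; linear_combination 3 * ht a b c)
  have hw : ∀ d, (codiffVec G (hodge G A) 0).ofLp d = sg d * ((1 / 6 : ℝ) * - ∑ p, sg p * ∑ q, ∑ r,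
        leviCivita p d q r * (sg q * sg r) * F p q r) := by
    intro d
    rw [h.codiffVec_zero, h.codiff_zero]
    simp only [h.pd_hodge (hA.diffM h.isOpen h.zero_mem)]
    rw [mul_neg, mul_neg, mul_neg, neg_inj]
    congr 1
    rw [Finset.mul_sum]
    refine Finset.sum_congr rfl fun p _ => ?_
    rw [← mul_assoc, ← mul_assoc, mul_comm (1 / 6 : ℝ), mul_assoc, mul_assoc]
    congr 1
    simp only [Finset.mul_sum]
    refine Finset.sum_congr rfl fun q _ => Finset.sum_congr rfl fun r _ => ?_
    have e1 : leviCivita p d q r * g p r = 0 := by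
      simp only [hg]; split_ifs with hpr
      · rw [hpr]; simp
      · simp
    have e2 : leviCivita p d q r * g p q = 0 := by
      simp only [hg]; split_ifs with hpr
      · rw [hpr]; simp
      · simp
    simp only [hF, hT]
    linear_combination (1 / 6 * sg q * sg r * Z q) * e1 - (1 / 6 * sg q * sg r * Z r) * e2
  intro a b c
  have hu : ∀ b, sg b * (codiffVec G A 0).ofLp b = Z b := fun b => by
    rw [h.codiffVec_zero, ← mul_assoc, sg_mul_self, one_mul]
  simp only [hu, hw, ← key]
  simp only [hF, hT, hg]; ring

/-- Dualising in b, c exchanges the trace term and the η term; the sign of −u reflects ** = −1 in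
Lorentz signature. -/
lemma pairEq_hodge {A : Comp2} (hA : SmM V A) {u w : Fin 4 → ℝ} (hp : PairEq G A u w 0) :
    PairEq G (hodge G A) w (fun i => - u i) 0 := by
  rw [h.pairEq_zero] at hp ⊢
  intro a b c
  rw [h.pd_hodge (hA.diffM h.isOpen h.zero_mem)]
  have e : 3 * ((1 / 2 : ℝ) * ∑ d, ∑ e, leviCivita b c d e * (sg d * sg e) *
      pd a (fun z => A z d e) 0) = (1 / 2 : ℝ) * ∑ d, ∑ e, leviCivita b c d e * (sg d * sg e) *
      (3 * pd a (fun z => A z d e) 0) := by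
    simp only [Finset.mul_sum]
    exact Finset.sum_congr rfl fun i _ => Finset.sum_congr rfl fun j _ => by ring
  rw [e]
  simp only [hp]
  clear e hp
  fin_cases a <;> fin_cases b <;> fin_cases c <;>
    simp [Fin.sum_univ_four, leviCivita_values] <;> ring

end Normal

/-! ### Curvature symmetries and the integrability condition at the origin. -/

section Rules

variable {f g : E4 → ℝ} {x : E4} (c : Fin 4)

lemma pd_add (hf : DifferentiableAt ℝ f x) (hg : DifferentiableAt ℝ g x) :
    pd c (fun z => f z + g z) x = pd c f x + pd c g x := by
  rw [pd, fderiv_fun_add hf hg]; rfl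

lemma pd_sub (hf : DifferentiableAt ℝ f x) (hg : DifferentiableAt ℝ g x) :
    pd c (fun z => f z - g z) x = pd c f x - pd c g x := by
  rw [pd, fderiv_fun_sub hf hg]; rfl

lemma pd_mul (hf : DifferentiableAt ℝ f x) (hg : DifferentiableAt ℝ g x) :
    pd c (fun z => f z * g z) x = f x * pd c g x + g x * pd c f x := by
  rw [pd, fderiv_fun_mul hf hg]; rfl

lemma pd_const_mul (r : ℝ) (hf : DifferentiableAt ℝ f x) :
    pd c (fun z => r * f z) x = r * pd c f x := by
  rw [pd, fderiv_const_mul hf]; rfl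

lemma pd_sum {ι : Type*} {s : Finset ι} {F : ι → E4 → ℝ}
    (hF : ∀ i ∈ s, DifferentiableAt ℝ (F i) x) :
    pd c (fun z => ∑ i ∈ s, F i z) x = ∑ i ∈ s, pd c (F i) x := by
  rw [pd, fderiv_fun_sum hF, _root_.sum_apply]; rfl

end Rules

lemma MetricOn.christoffel_smooth {U : Set E4} {G : Comp2} (h : MetricOn U G) (a b c : Fin 4) :
    ContDiffOn ℝ ∞ (christoffel G a b c) U := h.christM_smooth b a c

namespace Normal

variable {V : Set E4} {G : Comp2} (h : Normal V G)
include h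

lemma diffAt {E : Type*} [NormedAddCommGroup E] [NormedSpace ℝ E] {f : E4 → E}
    (hf : ContDiffOn ℝ ∞ f V) : DifferentiableAt ℝ f 0 :=
  contDiffOn_diffAt hf h.isOpen h.zero_mem

lemma pd_christoffel (e a b c : Fin 4) : pd e (christoffel G a b c) 0 = (1 / 2) * (sg a *
    (pd e (pd b fun z => G z a c) 0 + pd e (pd c fun z => G z a b) 0
      - pd e (pd a fun z => G z b c) 0)) := by
  have hG : ∀ b c d, DifferentiableAt ℝ (pd b fun z => G z c d) 0 := fun b c d =>
    h.diffAt (contDiffOn_pd (h.smooth c d) h.isOpen b)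
  have hin : ∀ d, DifferentiableAt ℝ (fun y => pd b (fun z => G z d c) y +
      pd c (fun z => G z d b) y - pd d (fun z => G z b c) y) 0 := fun d =>
    ((hG b d c).add (hG c d b)).sub (hG d b c)
  have e1 : pd e (christoffel G a b c) 0 = pd e (fun y => (1 / 2) * ∑ d, (G y)⁻¹ a d *
    (pd b (fun z => G z d c) y + pd c (fun z => G z d b) y - pd d (fun z => G z b c) y)) 0 := rfl
  have hm : ∀ d ∈ Finset.univ, DifferentiableAt ℝ (fun y => (G y)⁻¹ a d * (pd b (fun z => G z d c) y +
      pd c (fun z => G z d b) y - pd d (fun z => G z b c) y)) 0 := fun d _ =>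
    (h.inv_diff a d).fun_mul (hin d)
  rw [e1, pd_const_mul e _ (DifferentiableAt.fun_sum hm), pd_sum e hm]
  congr 1
  have e2 : ∀ d, pd e (fun y => (G y)⁻¹ a d * (pd b (fun z => G z d c) y +
      pd c (fun z => G z d b) y - pd d (fun z => G z b c) y)) 0 = (if a = d then sg a else 0) *
      (pd e (pd b fun z => G z d c) 0 + pd e (pd c fun z => G z d b) 0
      - pd e (pd d fun z => G z b c) 0) := by
    intro d
    have hia : DifferentiableAt ℝ (fun y => (G y)⁻¹ a d) 0 := h.inv_diff a d
    rw [pd_mul e hia (hin d), h.pd_inv, mul_zero, add_zero, h.val_inv, mink_apply,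
      pd_sub e ((hG b d c).fun_add (hG c d b)) (hG d b c), pd_add e (hG b d c) (hG c d b)]
  simp only [e2, ite_mul, zero_mul, Finset.sum_ite_eq, Finset.mem_univ, if_true]

lemma riemannUp_zero (a b c d : Fin 4) : riemannUp G a b c d 0 =
    pd c (christoffel G a b d) 0 - pd d (christoffel G a b c) 0 := by
  simp [riemannUp, h.christoffel_zero]

lemma riemann_zero (a b c d : Fin 4) : riemann G a b c d 0 = sg a * riemannUp G a b c d 0 := by
  simp [riemann, h.val_apply]

/-- With Γ = 0 only second derivatives of the metric survive. All algebraic symmetries of the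
curvature follow from this formula, symmetry of g and equality of mixed partials. -/
lemma riemann_eq (a b c d : Fin 4) : riemann G a b c d 0 = (1 / 2) *
    (pd b (pd c fun z => G z a d) 0 - pd a (pd c fun z => G z b d) 0
      - pd b (pd d fun z => G z a c) 0 + pd a (pd d fun z => G z b c) 0) := by
  have hs := fun a b c d => pd_comm (h.smooth a b) h.isOpen h.zero_mem c d
  rw [h.riemann_zero, h.riemannUp_zero, h.pd_christoffel, h.pd_christoffel, hs a d c b,
    hs a b c d, hs b d c a, hs a c d b, hs b c d a]
  linear_combination ((1 / 2) * (pd b (pd c fun z => G z a d) 0 - pd a (pd c fun z => G z b d) 0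
      - pd b (pd d fun z => G z a c) 0 + pd a (pd d fun z => G z b c) 0)) * sg_mul_self a

lemma pd_pd_symm (a b c d : Fin 4) :
    pd a (pd b fun z => G z c d) 0 = pd a (pd b fun z => G z d c) 0 :=
  pd_congr h.isOpen (fun _ hz => h.pd_symm hz c d b) h.zero_mem a

lemma riemann_antisymm_right (a b c d : Fin 4) : riemann G a b c d 0 = - riemann G a b d c 0 := by
  rw [h.riemann_eq, h.riemann_eq]; ring

lemma riemann_antisymm_left (a b c d : Fin 4) : riemann G a b c d 0 = - riemann G b a c d 0 := by
  rw [h.riemann_eq, h.riemann_eq]; ring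

lemma riemann_pair (a b c d : Fin 4) : riemann G a b c d 0 = riemann G c d a b 0 := by
  have hs := fun a b c d => pd_comm (h.smooth a b) h.isOpen h.zero_mem c d
  rw [h.riemann_eq, h.riemann_eq, h.pd_pd_symm _ _ a d, h.pd_pd_symm _ _ b d,
    h.pd_pd_symm _ _ a c, h.pd_pd_symm _ _ b c, hs d a b c, hs d b a c, hs c a b d, hs c b a d]
  ring

lemma riemann_bianchi (a b c d : Fin 4) :
    riemann G a b c d 0 + riemann G a c d b 0 + riemann G a d b c 0 = 0 := by
  have hs := fun a b c d => pd_comm (h.smooth a b) h.isOpen h.zero_mem c d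
  rw [h.riemann_eq, h.riemann_eq, h.riemann_eq, hs a b d c, hs a d c b, hs a c d b,
    h.pd_pd_symm _ _ d c, h.pd_pd_symm _ _ d b, h.pd_pd_symm _ _ c b]
  ring

lemma ricci_zero (a b : Fin 4) : ricci G 0 a b = ∑ c, sg c * riemann G c a c b 0 := by
  simp only [ricci, h.riemann_zero, ← mul_assoc, sg_mul_self, one_mul]

lemma ricci_symm (a b : Fin 4) : ricci G 0 a b = ricci G 0 b a := by
  rw [h.ricci_zero, h.ricci_zero]
  exact Finset.sum_congr rfl fun c _ => by rw [h.riemann_pair]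

lemma pd_covDeriv {T : Comp2} (hT : SmM V T) (a b c d : Fin 4) :
    pd a (fun z => covDeriv G T b c d z) 0 = pd a (pd b fun z => T z c d) 0
      - ∑ e, (pd a (christoffel G e b c) 0 * T 0 e d + pd a (christoffel G e b d) 0 * T 0 c e) := by
  have hc : ∀ e b c, DifferentiableAt ℝ (christoffel G e b c) 0 := fun e b c =>
    h.diffAt (h.christoffel_smooth e b c)
  have ht : ∀ a b, DifferentiableAt ℝ (fun z => T z a b) 0 := fun a b => h.diffAt (hT a b)
  have hm : ∀ e ∈ Finset.univ, DifferentiableAt ℝ (fun z =>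
      christoffel G e b c z * T z e d + christoffel G e b d z * T z c e) 0 := fun e _ =>
    ((hc e b c).fun_mul (ht e d)).fun_add ((hc e b d).fun_mul (ht c e))
  have e1 : ∀ z, covDeriv G T b c d z = pd b (fun z => T z c d) z - ∑ e,
      (christoffel G e b c z * T z e d + christoffel G e b d z * T z c e) := fun z => rfl
  simp only [e1]
  rw [pd_sub a (h.diffAt (contDiffOn_pd (hT c d) h.isOpen b)) (DifferentiableAt.fun_sum hm),
    pd_sum a hm]
  congr 1
  refine Finset.sum_congr rfl fun e _ => ?_
  rw [pd_add a ((hc e b c).fun_mul (ht e d)) ((hc e b d).fun_mul (ht c e)),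
    pd_mul a (hc e b c) (ht e d), pd_mul a (hc e b d) (ht c e), h.christoffel_zero,
    h.christoffel_zero]
  ring

/-- The derivative of the right-hand side of `PairEq` at the origin of normal coordinates. -/
lemma pd_pairEq {u w : E4 → E4} (hu : ContDiffOn ℝ ∞ u V) (hw : ContDiffOn ℝ ∞ w V)
    (e a b c : Fin 4) :
    pd e (fun z => G z a c * (G z *ᵥ (u z).ofLp) b - G z a b * (G z *ᵥ (u z).ofLp) c
      + ∑ d, volumeElement G a b c d z * w z d) 0 =
    (if a = c then sg a else 0) * (sg b * pd e (fun z => u z b) 0)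
      - (if a = b then sg a else 0) * (sg c * pd e (fun z => u z c) 0)
      + ∑ d, leviCivita a b c d * pd e (fun z => w z d) 0 := by
  have hG : ∀ a b, DifferentiableAt ℝ (fun z => G z a b) 0 := fun a b => h.diffAt (h.smooth a b)
  have hu' : ∀ b, DifferentiableAt ℝ (fun z => u z b) 0 := fun b => h.diffAt (contDiffOn_coord hu b)
  have hw' : ∀ b, DifferentiableAt ℝ (fun z => w z b) 0 := fun b => h.diffAt (contDiffOn_coord hw b)
  have hm : ∀ b, ∀ d ∈ Finset.univ, DifferentiableAt ℝ (fun z => G z b d * u z d) 0 := fun b d _ =>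
    (hG b d).fun_mul (hu' d)
  have hGu : ∀ b, DifferentiableAt ℝ (fun z => (G z *ᵥ (u z).ofLp) b) 0 := fun b =>
    DifferentiableAt.fun_sum (hm b)
  have hv : ∀ d ∈ Finset.univ, DifferentiableAt ℝ (fun z => volumeElement G a b c d z * w z d) 0 :=
    fun d _ => (h.vol_hasFDerivAt a b c d).differentiableAt.fun_mul (hw' d)
  have hpGu : ∀ b, pd e (fun z => (G z *ᵥ (u z).ofLp) b) 0 = sg b * pd e (fun z => u z b) 0 := by
    intro b
    have : pd e (fun z => (G z *ᵥ (u z).ofLp) b) 0 = pd e (fun z => ∑ d, G z b d * u z d) 0 := rfl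
    rw [this, pd_sum e (hm b)]
    simp only [pd_mul e (hG b _) (hu' _), h.deriv, h.val_apply]
    simp
  rw [pd_add e (((hG a c).fun_mul (hGu b)).fun_sub ((hG a b).fun_mul (hGu c)))
      (DifferentiableAt.fun_sum hv),
    pd_sub e ((hG a c).fun_mul (hGu b)) ((hG a b).fun_mul (hGu c)), pd_mul e (hG a c) (hGu b),
    pd_mul e (hG a b) (hGu c), hpGu, hpGu, h.deriv, h.deriv, h.val_apply, h.val_apply, pd_sum e hv]
  have : ∀ d, pd e (fun z => volumeElement G a b c d z * w z d) 0 =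
      leviCivita a b c d * pd e (fun z => w z d) 0 := by
    intro d
    rw [pd_mul e (h.vol_hasFDerivAt a b c d).differentiableAt (hw' d), h.vol_zero, pd,
      pd, (h.vol_hasFDerivAt a b c d).fderiv]
    simp
  simp only [this]
  ring

/-- The derivative of `PairEq` at the origin of normal coordinates. -/
lemma pd_pairEq' {A : Comp2} (hA : SmM V A) {u w : E4 → E4} (hu : ContDiffOn ℝ ∞ u V)
    (hw : ContDiffOn ℝ ∞ w V) (hp : ∀ x ∈ V, PairEq G A (u x).ofLp (w x).ofLp x)
    (e a b c : Fin 4) : 3 * (pd e (pd a fun z => A z b c) 0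
      - ∑ m, (pd e (christoffel G m a b) 0 * A 0 m c + pd e (christoffel G m a c) 0 * A 0 b m)) =
    (if a = c then sg a else 0) * (sg b * pd e (fun z => u z b) 0)
      - (if a = b then sg a else 0) * (sg c * pd e (fun z => u z c) 0)
      + ∑ d, leviCivita a b c d * pd e (fun z => w z d) 0 := by
  have hcd : DifferentiableAt ℝ (fun z => covDeriv G A a b c z) 0 := by
    have hs : SmM V (fun z => dM (bv a) A z - (christM G a z)ᵀ * A z - A z * christM G a z) :=
      ((hA.dM h.isOpen _).sub ((h.christM_smooth a).transpose.mul hA)).sub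
        (hA.mul (h.christM_smooth a))
    have := h.diffAt (hs b c)
    simpa only [← covDeriv_eq] using this
  rw [← h.pd_covDeriv hA, ← h.pd_pairEq hu hw, ← pd_const_mul e 3 hcd]
  exact pd_congr h.isOpen (fun z hz => hp z hz a b c) h.zero_mem e

/-- The integrability condition. -/
lemma integrability {A : Comp2} (hA : SmM V A) {u w : E4 → E4} (hu : ContDiffOn ℝ ∞ u V)
    (hw : ContDiffOn ℝ ∞ w V) (hp : ∀ x ∈ V, PairEq G A (u x).ofLp (w x).ofLp x)
    (a b c d : Fin 4) : -3 * ∑ e, sg e * (riemann G e c a b 0 * A 0 e d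
      + riemann G e d a b 0 * A 0 c e) =
    ((if b = d then sg b else 0) * (sg c * pd a (fun z => u z c) 0)
      - (if b = c then sg b else 0) * (sg d * pd a (fun z => u z d) 0)
      + ∑ e, leviCivita b c d e * pd a (fun z => w z e) 0)
    - ((if a = d then sg a else 0) * (sg c * pd b (fun z => u z c) 0)
      - (if a = c then sg a else 0) * (sg d * pd b (fun z => u z d) 0)
      + ∑ e, leviCivita a c d e * pd b (fun z => w z e) 0) := by
  rw [← h.pd_pairEq' hA hu hw hp a b c d, ← h.pd_pairEq' hA hu hw hp b a c d,
    pd_comm (hA c d) h.isOpen h.zero_mem a b]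
  have hs : ∀ m p q r, pd p (christoffel G m q r) 0 = pd p (christoffel G m r q) 0 :=
    fun m p q r => pd_congr h.isOpen (fun z hz => h.christoffel_symm hz m q r) h.zero_mem p
  -- The second derivatives of A have cancelled in the antisymmetrisation; the remaining derivatives
  -- of Γ assemble into the curvature.
  have : ∑ e, sg e * (riemann G e c a b 0 * A 0 e d + riemann G e d a b 0 * A 0 c e) =
      ∑ m, (pd a (christoffel G m b c) 0 * A 0 m d + pd a (christoffel G m b d) 0 * A 0 c m)
      - ∑ m, (pd b (christoffel G m a c) 0 * A 0 m d + pd b (christoffel G m a d) 0 * A 0 c m) := by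
    rw [← Finset.sum_sub_distrib]
    refine Finset.sum_congr rfl fun m _ => ?_
    rw [h.riemann_zero, h.riemann_zero, h.riemannUp_zero, h.riemannUp_zero, hs m a b c, hs m a b d,
      hs m b a c, hs m b a d]
    linear_combination ((pd a (christoffel G m c b) 0 - pd b (christoffel G m c a) 0) * A 0 m d
      + (pd a (christoffel G m d b) 0 - pd b (christoffel G m d a) 0) * A 0 c m) * sg_mul_self m
  rw [this]; ring

end Normal

/-! ### The Killing equation for the vectors of a pair. -/

lemma contraction_right (M N : Fin 4 → Fin 4 → ℝ) (a d : Fin 4) :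
    let X : Fin 4 → Fin 4 → ℝ := fun a d => ∑ b, sg b * (((if b = d then sg b else 0) * (sg b * M a b)
      - (if b = b then sg b else 0) * (sg d * M a d) + ∑ e, leviCivita b b d e * N a e)
    - ((if a = d then sg a else 0) * (sg b * M b b)
      - (if a = b then sg a else 0) * (sg d * M b d) + ∑ e, leviCivita a b d e * N b e))
    X a d + X d a = -2 * (sg d * M a d + sg a * M d a)
      - 2 * (if a = d then sg a else 0) * ∑ b, M b b := by
  -- X is the right-hand side of the integrability condition traced over b and c. Its surviving
  -- Levi-Civita term is antisymmetric in a, d and disappears from the symmetrised sum.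
  intro X
  fin_cases a <;> fin_cases d <;>
    simp [X, Fin.sum_univ_four, leviCivita_values] <;> ring

/-- `Z` satisfies the Killing equation at `y`. -/
abbrev KillingEq (G : Comp2) (Z : E4 → E4) (y : E4) : Prop := lieDeriv Z G y = 0

namespace Normal

variable {V : Set E4} {G : Comp2} (h : Normal V G)
include h

lemma lieDeriv_metric_zero (Z : E4 → E4) (a b : Fin 4) : lieDeriv Z G 0 a b =
    sg b * pd a (fun z => Z z b) 0 + sg a * pd b (fun z => Z z a) 0 := by
  simp only [lieDeriv, h.deriv, h.val_apply]
  simp [Finset.sum_add_distrib]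

lemma killingEq_iff (Z : E4 → E4) : KillingEq G Z 0 ↔ ∀ a b,
    sg b * pd a (fun z => Z z b) 0 + sg a * pd b (fun z => Z z a) 0 = 0 := by
  constructor
  · intro H a b
    rw [← h.lieDeriv_metric_zero, H]; rfl
  · intro H
    ext a b
    rw [h.lieDeriv_metric_zero, H]; rfl

/-- Trace the integrability condition over b, c and symmetrise in a, d. One curvature term becomes
Ric·A, whose symmetric part is the commutator [A, Ric]; the other, `Q`, is antisymmetric by the pair
symmetry of Riemann. The source side is the Killing operator of u plus a multiple of (div u) g. -/
lemma killingEq_of_pairEq {A : Comp2} (hA : SmM V A) (ha : AntisymmOn V A) {u w : E4 → E4}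
    (hu : ContDiffOn ℝ ∞ u V) (hw : ContDiffOn ℝ ∞ w V)
    (hp : ∀ x ∈ V, PairEq G A (u x).ofLp (w x).ofLp x) (hc : commutator G A (ricci G) 0 = 0) :
    KillingEq G u 0 := by
  rw [h.killingEq_iff]
  set R := fun a b c d => riemann G a b c d 0 with hR
  set M : Fin 4 → Fin 4 → ℝ := fun a c => pd a (fun z => u z c) 0 with hM
  set N : Fin 4 → Fin 4 → ℝ := fun a c => pd a (fun z => w z c) 0 with hN
  have hA0 : ∀ a b, A 0 a b = - A 0 b a := ha 0 h.zero_mem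
  have hcm : ∀ a d, ∑ e, sg e * (ricci G 0 e a * A 0 e d + ricci G 0 e d * A 0 e a) = 0 := by
    intro a d
    have := congrFun (congrFun hc a) d
    have hmul : ∀ (S : Matrix (Fin 4) (Fin 4) ℝ) e, (S * mink) a e = S a e * sg e := fun S e =>
      Matrix.mul_diagonal _ _ _ _
    simp only [commutator, dotProd, h.val_inv, Matrix.sub_apply] at this
    simp only [Matrix.mul_apply (M := _ * mink), hmul, Matrix.zero_apply,
      ← Finset.sum_sub_distrib] at this
    rw [← neg_eq_zero, ← this, ← Finset.sum_neg_distrib]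
    refine Finset.sum_congr rfl fun e _ => ?_
    rw [hA0 a e, h.ricci_symm a e]; ring
  set Q : Fin 4 → Fin 4 → ℝ := fun a d => ∑ b, ∑ e, sg b * (sg e * (R e d a b * A 0 b e)) with hQ
  have hQs : ∀ a d, Q a d + Q d a = 0 := by
    intro a d
    have : Q d a = ∑ b, ∑ e, sg e * (sg b * (R b a d e * A 0 e b)) := Finset.sum_comm
    rw [this, hQ, ← Finset.sum_add_distrib]
    refine Finset.sum_eq_zero fun b _ => ?_
    rw [← Finset.sum_add_distrib]
    refine Finset.sum_eq_zero fun e _ => ?_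
    have : R b a d e = R e d a b := by
      simp only [hR]
      rw [h.riemann_pair, h.riemann_antisymm_left, h.riemann_antisymm_right, neg_neg]
    rw [this, hA0 e b]; ring
  set X : Fin 4 → Fin 4 → ℝ := fun a d => ∑ b, sg b * (((if b = d then sg b else 0) * (sg b * M a b)
      - (if b = b then sg b else 0) * (sg d * M a d) + ∑ e, leviCivita b b d e * N a e)
    - ((if a = d then sg a else 0) * (sg b * M b b)
      - (if a = b then sg a else 0) * (sg d * M b d) + ∑ e, leviCivita a b d e * N b e)) with hX
  have hL : ∀ a d, X a d = -3 * ((∑ e, sg e * (ricci G 0 e a * A 0 e d)) + Q a d) := by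
    intro a d
    have e1 : X a d = ∑ b, sg b * (-3 * ∑ e, sg e * (R e b a b * A 0 e d + R e d a b * A 0 b e)) := by
      refine Finset.sum_congr rfl fun b _ => ?_
      rw [h.integrability hA hu hw hp a b b d]
    have e2 : ∑ e, sg e * (ricci G 0 e a * A 0 e d) =
        ∑ b, ∑ e, sg b * (sg e * (R e b a b * A 0 e d)) := by
      rw [Finset.sum_comm]
      refine Finset.sum_congr rfl fun e _ => ?_
      rw [h.ricci_zero, Finset.sum_mul, Finset.mul_sum]
      refine Finset.sum_congr rfl fun b _ => ?_
      have : riemann G b e b a 0 = R e b a b := by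
        simp only [hR]
        rw [h.riemann_antisymm_left, h.riemann_antisymm_right, neg_neg]
      rw [this]; ring
    rw [e1, e2, hQ, ← Finset.sum_add_distrib, Finset.mul_sum]
    refine Finset.sum_congr rfl fun b _ => ?_
    rw [← Finset.sum_add_distrib, Finset.mul_sum, Finset.mul_sum, Finset.mul_sum]
    exact Finset.sum_congr rfl fun e _ => by ring
  have hfin : ∀ a d, -2 * (sg d * M a d + sg a * M d a)
      - 2 * (if a = d then sg a else 0) * ∑ b, M b b = 0 := by
    intro a d
    rw [← contraction_right M N a d]
    change X a d + X d a = 0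
    have := hcm a d
    simp only [mul_add, Finset.sum_add_distrib] at this
    rw [hL, hL]
    linear_combination -3 * this - 3 * hQs a d
  -- The trace of `hfin` is −12 div u.
  have hdiv : ∑ b, M b b = 0 := by
    have h0 := hfin 0 0
    have h1 := hfin 1 1
    have h2 := hfin 2 2
    have h3 := hfin 3 3
    simp [Fin.sum_univ_four] at h0 h1 h2 h3 ⊢
    linarith
  intro a b
  have := hfin a b
  rw [hdiv] at this
  linarith

/-- Tracing the pair equation over a, b gives u_c − 4u_c = −3u_c. Thus the pair is determined by the
tensor, which later turns vanishing of the tensor into vanishing of the pair. -/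
lemma codiffVec_of_pairEq {A : Comp2} {u w : Fin 4 → ℝ} (ha : AntisymmOn V A)
    (hp : PairEq G A u w 0) : (codiffVec G A 0).ofLp = u := by
  rw [h.pairEq_zero] at hp
  ext b
  have e : sg b * u b = - ∑ a, sg a * pd a (fun z => A z a b) 0 := by
    have h1 : ∑ a, sg a * (3 * pd a (fun z => A z a b) 0) = - 3 * (sg b * u b) := by
      simp only [hp]
      fin_cases b <;> simp [Fin.sum_univ_four] <;> ring
    have h2 : ∑ a, sg a * (3 * pd a (fun z => A z a b) 0) =
        3 * ∑ a, sg a * pd a (fun z => A z a b) 0 := by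
      rw [Finset.mul_sum]; exact Finset.sum_congr rfl fun a _ => by ring
    linarith
  rw [h.codiffVec_zero, h.codiff_zero, ← e, ← mul_assoc, sg_mul_self, one_mul]

end Normal

/-! ### Transfer from the origin of normal coordinates to every point of a chart. -/

lemma CoordMap.pull_eq_zero {V U : Set E4} {φ : E4 → E4} (k : CoordMap V U φ) {x : E4} (hx : x ∈ V)
    {T : Comp2} : pull φ T x = 0 ↔ T (φ x) = 0 := by
  constructor
  · intro H
    apply conj_cancel (k.isUnit hx)
    rw [Matrix.mul_zero, Matrix.zero_mul]; exact H
  · intro H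
    rw [pull, H, Matrix.mul_zero, Matrix.zero_mul]

lemma CoordMap.killingEq_pull {V U : Set E4} {φ : E4 → E4} (k : CoordMap V U φ) {G : Comp2}
    (h : MetricOn U G) {Z : E4 → E4} (hZ : ContDiffOn ℝ ∞ Z U) {x : E4} (hx : x ∈ V) :
    KillingEq (pull φ G) (pullVec φ Z) x ↔ KillingEq G Z (φ x) := by
  rw [KillingEq, k.lieDeriv_pull hZ h.smooth hx, k.pull_eq_zero hx]

lemma hodge_congr {G G' A A' : Comp2} {y : E4} (hG : G y = G' y) (hA : A y = A' y) :
    hodge G A y = hodge G' A' y := by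
  rw [hodge_eq, hodge_eq, raise_eq, raise_eq, hG, hA]

lemma MetricOn.hodge_smooth {U : Set E4} {G A : Comp2} (h : MetricOn U G) (hA : SmM U A) :
    SmM U (hodge G A) := by
  intro a b
  have hr : SmM U (raise G A) := by
    have : SmM U (fun y => (G y)⁻¹ * A y * ((G y)⁻¹)ᵀ) :=
      (h.inv_smooth.mul hA).mul h.inv_smooth.transpose
    exact this.congr fun y _ => raise_eq G A y
  have hd : ContDiffOn ℝ ∞ (fun y => Real.sqrt |(G y).det|) U := by
    -- A Lorentz metric has negative determinant, so the absolute value is smooth.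
    have : ContDiffOn ℝ ∞ (fun y => Real.sqrt (-(G y).det)) U := fun y hy =>
      ((contDiffOn_det h.smooth).neg y hy).sqrt (by have := h.det_neg hy; linarith)
    exact this.congr fun y hy => by rw [abs_of_neg (h.det_neg hy)]
  simp only [hodge, volumeElement]
  exact contDiffOn_const.mul (ContDiffOn.sum fun c _ => ContDiffOn.sum fun d _ =>
    (hd.mul contDiffOn_const).mul (hr c d))

lemma hodge_antisymm (G A : Comp2) (y : E4) (a b : Fin 4) : hodge G A y a b = - hodge G A y b a := by
  have : ∀ c d, leviCivita a b c d = - leviCivita b a c d := fun c d => by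
    rw [leviCivita_eq, leviCivita_eq]; ring
  simp only [hodge, volumeElement, this, mul_neg, neg_mul, Finset.sum_neg_distrib]

lemma MetricOn.codiffVec_smooth {U : Set E4} {G A : Comp2} (h : MetricOn U G) (hA : SmM U A) :
    ContDiffOn ℝ ∞ (codiffVec G A) U := by
  have hc : ∀ c, SmM U (covM G A c) := by
    intro c
    have hs : SmM U (fun z => dM (bv c) A z - (christM G c z)ᵀ * A z - A z * christM G c z) :=
      ((hA.dM h.isOpen _).sub ((h.christM_smooth c).transpose.mul hA)).sub
        (hA.mul (h.christM_smooth c))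
    exact hs.congr fun y _ => by ext a b; exact covDeriv_eq G y A c a b
  refine contDiffOn_of_coord fun a => ?_
  simp only [codiffVec_eq, Matrix.mulVec, dotProduct, codiff_eq]
  exact ContDiffOn.sum fun b _ => (h.inv_smooth a b).mul
    (ContDiffOn.sum fun i _ => (h.inv_smooth.mul (hc i)) i b).neg

section Chart

variable {U : Set E4} {G : Comp2} (h : MetricOn U G)
include h

theorem MetricOn.pairEq_of_ckyEq {A : Comp2} (hA : SmM U A) (ha : AntisymmOn U A) {y : E4}
    (hy : y ∈ U) (hc : CKYEq G A y) :
    PairEq G A (codiffVec G A y).ofLp (codiffVec G (hodge G A) y).ofLp y := by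
  obtain ⟨φ, V, k, rfl, hN⟩ := h.exists_normal' hy
  have h0 := hN.zero_mem
  have hA' := k.pull_smooth hA
  rw [← k.pairEq_pull h hA h0, ← k.codiffVec_pull h hA h0,
    ← k.codiffVec_pull h (h.hodge_smooth hA) h0]
  -- Duals and pullbacks commute only on V; an open neighbourhood of the origin suffices for first
  -- derivatives.
  have e : codiffVec (pull φ G) (pull φ (hodge G A)) 0 =
      codiffVec (pull φ G) (hodge (pull φ G) (pull φ A)) 0 := by
    have hev : ∀ a b c, pd a (fun z => pull φ (hodge G A) z b c) 0 =
        pd a (fun z => hodge (pull φ G) (pull φ A) z b c) 0 := fun a b c =>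
      pd_congr k.isOpen (fun z hz => by rw [k.hodge_pull G A hz]) h0 a
    ext i
    rw [hN.codiffVec_zero, hN.codiffVec_zero, hN.codiff_zero, hN.codiff_zero]
    simp only [hev]
  rw [e]
  exact hN.pairEq_of_ckyEq hA' (k.antisymmOn ha) (k.ckyEq_pull h hA h0 hc)

theorem MetricOn.pairEq_hodge {A : Comp2} (hA : SmM U A) {u w : Fin 4 → ℝ} {y : E4}
    (hy : y ∈ U) (hp : PairEq G A u w y) : PairEq G (hodge G A) w (fun i => - u i) y := by
  obtain ⟨φ, V, k, rfl, hN⟩ := h.exists_normal' hy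
  have h0 := hN.zero_mem
  set u' : E4 := WithLp.toLp 2 u
  set w' : E4 := WithLp.toLp 2 w
  have h1 := (k.pairEq_pull h hA h0 (fun _ => u') (fun _ => w')).2 hp
  have h2 := hN.pairEq_hodge (k.pull_smooth hA) h1
  have h3 := (k.pairEq_pull h (h.hodge_smooth hA) h0 (fun _ => w') (fun _ => - u')).1
  refine h3 ?_
  have e : (pullVec φ (fun _ => - u') 0).ofLp = fun i => - (pullVec φ (fun _ => u') 0).ofLp i := by
    ext i; simp [pullVec, Matrix.mulVec_neg]
  rw [e]
  intro a b c
  have := h2 a b c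
  rw [hN.covDeriv_zero] at this ⊢
  have hev : pd a (fun z => pull φ (hodge G A) z b c) 0 =
      pd a (fun z => hodge (pull φ G) (pull φ A) z b c) 0 :=
    pd_congr k.isOpen (fun z hz => by rw [k.hodge_pull G A hz]) h0 a
  rw [hev, ← this]

theorem MetricOn.codiffVec_of_pairEq {A : Comp2} (hA : SmM U A) (ha : AntisymmOn U A)
    {u w : Fin 4 → ℝ} {y : E4} (hy : y ∈ U) (hp : PairEq G A u w y) :
    (codiffVec G A y).ofLp = u := by
  obtain ⟨φ, V, k, rfl, hN⟩ := h.exists_normal' hy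
  have h0 := hN.zero_mem
  set u' : E4 := WithLp.toLp 2 u
  set w' : E4 := WithLp.toLp 2 w
  have h1 := (k.pairEq_pull h hA h0 (fun _ => u') (fun _ => w')).2 hp
  have h2 := hN.codiffVec_of_pairEq (k.antisymmOn ha) h1
  rw [k.codiffVec_pull h hA h0] at h2
  have h3 := congrArg (fun v => jac φ 0 *ᵥ v) h2
  simp only [k.jac_mulVec_pullVec _ h0] at h3
  exact h3

theorem MetricOn.codiffVec_hodge_of_pairEq {A : Comp2} (hA : SmM U A)
    {u w : Fin 4 → ℝ} {y : E4} (hy : y ∈ U) (hp : PairEq G A u w y) :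
    (codiffVec G (hodge G A) y).ofLp = w :=
  h.codiffVec_of_pairEq (h.hodge_smooth hA) (fun y _ a b => hodge_antisymm G A y a b) hy
    (h.pairEq_hodge hA hy hp)

theorem MetricOn.killingEq_of_pairEq {A : Comp2} (hA : SmM U A) (ha : AntisymmOn U A)
    {u w : E4 → E4} (hu : ContDiffOn ℝ ∞ u U) (hw : ContDiffOn ℝ ∞ w U)
    (hp : ∀ x ∈ U, PairEq G A (u x).ofLp (w x).ofLp x) {y : E4} (hy : y ∈ U)
    (hc : commutator G A (ricci G) y = 0) : KillingEq G u y := by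
  obtain ⟨φ, V, k, rfl, hN⟩ := h.exists_normal' hy
  have h0 := hN.zero_mem
  rw [← k.killingEq_pull h hu h0]
  refine hN.killingEq_of_pairEq (k.pull_smooth hA) (k.antisymmOn ha) (k.pullVec_smooth hu)
    (k.pullVec_smooth hw) (fun x hx => (k.pairEq_pull h hA hx u w).2 (hp _ (k.mapsTo hx))) ?_
  have e : commutator (pull φ G) (pull φ A) (ricci (pull φ G)) 0 =
      pull φ (commutator G A (ricci G)) 0 := by
    have h1 : ∀ S, dotProd (pull φ G) S (ricci (pull φ G)) 0 =
        dotProd (pull φ G) S (pull φ (ricci G)) 0 := fun S => by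
      simp only [dotProd, k.ricci_pull h h0]
    have h2 : ∀ S, dotProd (pull φ G) (ricci (pull φ G)) S 0 =
        dotProd (pull φ G) (pull φ (ricci G)) S 0 := fun S => by
      simp only [dotProd, k.ricci_pull h h0]
    rw [commutator, h1, h2, k.dotProd_pull G A _ h0, k.dotProd_pull G _ A h0]
    simp only [pull, commutator, Matrix.mul_sub, Matrix.sub_mul]
  rw [e, (k.pull_eq_zero h0).2 hc]

end Chart

/-! ### Killing vectors acting on Killing vectors and on solutions of the pair equation. -/

/-- The algebraic form of `3 ∇_a A_{bc}` for a conformal Killing-Yano tensor in an orthonormal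
frame. -/
def pairForm (u w : Fin 4 → ℝ) (a b c : Fin 4) : ℝ :=
  (if a = c then sg a else 0) * (sg b * u b) - (if a = b then sg a else 0) * (sg c * u c)
    + ∑ d, leviCivita a b c d * w d

/-- The form is built from g and ε, which are invariant under so(1,3), so an infinitesimal rotation
of its indices can be moved onto the two vectors. -/
lemma pairForm_lie (N : Fin 4 → Fin 4 → ℝ) (hN : ∀ a b, sg b * N a b + sg a * N b a = 0)
    (u w : Fin 4 → ℝ) (a b c : Fin 4) :
    ∑ d, (N a d * pairForm u w d b c + N b d * pairForm u w a d c + N c d * pairForm u w a b d) =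
      - pairForm (fun b => ∑ d, N d b * u d) (fun b => ∑ d, N d b * w d) a b c := by
  have n00 : N 0 0 = 0 := by have := hN 0 0; simp at this; linarith
  have n11 : N 1 1 = 0 := by have := hN 1 1; simp at this; linarith
  have n22 : N 2 2 = 0 := by have := hN 2 2; simp at this; linarith
  have n33 : N 3 3 = 0 := by have := hN 3 3; simp at this; linarith
  have n10 : N 1 0 = N 0 1 := by have := hN 0 1; simp at this; linarith
  have n20 : N 2 0 = N 0 2 := by have := hN 0 2; simp at this; linarith
  have n30 : N 3 0 = N 0 3 := by have := hN 0 3; simp at this; linarith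
  have n21 : N 2 1 = - N 1 2 := by have := hN 1 2; simp at this; linarith
  have n31 : N 3 1 = - N 1 3 := by have := hN 1 3; simp at this; linarith
  have n32 : N 3 2 = - N 2 3 := by have := hN 2 3; simp at this; linarith
  fin_cases a <;> fin_cases b <;> fin_cases c <;>
    simp [pairForm, Fin.sum_univ_four, leviCivita_values, n00, n11, n22, n33, n10, n20, n30, n21,
      n31, n32] <;> ring

/-- so(1,3) is closed under commutators. -/
lemma killing_commutator (N P : Fin 4 → Fin 4 → ℝ) (hN : ∀ a b, sg b * N a b + sg a * N b a = 0)
    (hP : ∀ a b, sg b * P a b + sg a * P b a = 0) (a b : Fin 4) :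
    sg b * ∑ d, (N a d * P d b - P a d * N d b) + sg a * ∑ d, (N b d * P d a - P b d * N d a) =
      0 := by
  have key : ∀ (N P : Fin 4 → Fin 4 → ℝ) (_ : ∀ a b, sg b * N a b + sg a * N b a = 0)
      (_ : ∀ a b, sg b * P a b + sg a * P b a = 0),
      sg b * ∑ d, N a d * P d b = sg a * ∑ d, P b d * N d a := by
    intro N P hN hP
    rw [Finset.mul_sum, Finset.mul_sum]
    refine Finset.sum_congr rfl fun d _ => ?_
    have h1 := hN a d
    have h2 := hP d b
    linear_combination (sg b * P d b) * sg d * h1 - (sg a * N d a) * sg d * h2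
      - (sg b * P d b * N a d - sg a * N d a * P b d) * sg_mul_self d
  rw [Finset.sum_sub_distrib, Finset.sum_sub_distrib, mul_sub, mul_sub, key N P hN hP, key P N hP hN]
  ring

lemma lieDeriv_smul_vec (T : Comp2) {Z W : E4 → E4} {y : E4} (hZ : DifferentiableAt ℝ Z y)
    (hW : DifferentiableAt ℝ W y) (r s : ℝ) : lieDeriv (fun z => r • Z z + s • W z) T y =
      r • lieDeriv Z T y + s • lieDeriv W T y := by
  have hj : jac (fun z => r • Z z + s • W z) y = r • jac Z y + s • jac W y := by
    ext i a
    have hc : ∀ {Z : E4 → E4}, DifferentiableAt ℝ Z y → DifferentiableAt ℝ (fun z => Z z i) y :=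
      fun hZ => ((EuclideanSpace.proj (𝕜 := ℝ) i).hasFDerivAt.comp y hZ.hasFDerivAt).differentiableAt
    change pd a (fun z => r * Z z i + s * W z i) y = r * pd a (fun z => Z z i) y
      + s * pd a (fun z => W z i) y
    rw [pd, pd, pd, fderiv_fun_add ((hc hZ).const_mul r) ((hc hW).const_mul s),
      fderiv_const_mul (hc hZ), fderiv_const_mul (hc hW)]
    rfl
  rw [lieDeriv_eq, lieDeriv_eq, lieDeriv_eq, hj]
  have hz : ∀ c, (r • Z y + s • W y) c = r * Z y c + s * W y c := fun c => rfl
  simp only [hz, add_smul, mul_smul, Finset.sum_add_distrib, ← Finset.smul_sum,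
    Matrix.transpose_add, Matrix.transpose_smul, Matrix.add_mul, Matrix.mul_add, Matrix.smul_mul,
    Matrix.mul_smul, smul_add]
  abel

lemma pd_lieDeriv {U : Set E4} (hU : IsOpen U) {A : Comp2} (hA : SmM U A) {Z : E4 → E4}
    (hZ : ContDiffOn ℝ ∞ Z U) {y : E4} (hy : y ∈ U) (e b c : Fin 4) :
    pd e (fun z => lieDeriv Z A z b c) y = ∑ d,
      ((Z y d * pd e (pd d fun z => A z b c) y + pd d (fun z => A z b c) y * pd e (fun z => Z z d) y)
      + (A y d c * pd e (pd b fun z => Z z d) y + pd b (fun z => Z z d) y * pd e (fun z => A z d c) y)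
      + (A y b d * pd e (pd c fun z => Z z d) y
        + pd c (fun z => Z z d) y * pd e (fun z => A z b d) y)) := by
  have hz : ∀ d, DifferentiableAt ℝ (fun z => Z z d) y := fun d =>
    contDiffOn_diffAt (contDiffOn_coord hZ d) hU hy
  have hz' : ∀ c d, DifferentiableAt ℝ (pd c fun z => Z z d) y := fun c d =>
    contDiffOn_diffAt (contDiffOn_pd (contDiffOn_coord hZ d) hU c) hU hy
  have ha : ∀ a b, DifferentiableAt ℝ (fun z => A z a b) y := fun a b =>
    contDiffOn_diffAt (hA a b) hU hy
  have ha' : ∀ c a b, DifferentiableAt ℝ (pd c fun z => A z a b) y := fun c a b =>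
    contDiffOn_diffAt (contDiffOn_pd (hA a b) hU c) hU hy
  have e1 : ∀ z, lieDeriv Z A z b c = ∑ d, (Z z d * pd d (fun z => A z b c) z
      + A z d c * pd b (fun z => Z z d) z + A z b d * pd c (fun z => Z z d) z) := fun z => rfl
  simp only [e1]
  have h1 : ∀ d, DifferentiableAt ℝ (fun z => Z z d * pd d (fun z => A z b c) z) y := fun d =>
    (hz d).fun_mul (ha' d b c)
  have h2 : ∀ d, DifferentiableAt ℝ (fun z => A z d c * pd b (fun z => Z z d) z) y := fun d =>
    (ha d c).fun_mul (hz' b d)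
  have h3 : ∀ d, DifferentiableAt ℝ (fun z => A z b d * pd c (fun z => Z z d) z) y := fun d =>
    (ha b d).fun_mul (hz' c d)
  rw [pd_sum e fun d _ => ((h1 d).fun_add (h2 d)).fun_add (h3 d)]
  refine Finset.sum_congr rfl fun d _ => ?_
  rw [pd_add e ((h1 d).fun_add (h2 d)) (h3 d), pd_add e (h1 d) (h2 d),
    pd_mul e (hz d) (ha' d b c), pd_mul e (ha d c) (hz' b d), pd_mul e (ha b d) (hz' c d)]

lemma lieBracket_coord {U : Set E4} (hU : IsOpen U) {Z W : E4 → E4} (hZ : ContDiffOn ℝ ∞ Z U)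
    (hW : ContDiffOn ℝ ∞ W U) {y : E4} (hy : y ∈ U) (b : Fin 4) :
    VectorField.lieBracket ℝ Z W y b =
      ∑ d, (Z y d * pd d (fun z => W z b) y - W y d * pd d (fun z => Z z b) y) := by
  rw [lieBracket_apply (contDiffOn_diffAt hZ hU hy) (contDiffOn_diffAt hW hU hy), Pi.sub_apply,
    Finset.sum_sub_distrib]
  simp only [Matrix.mulVec, dotProduct, jac_apply, mul_comm]

lemma pd_lieBracket {U : Set E4} (hU : IsOpen U) {Z W : E4 → E4} (hZ : ContDiffOn ℝ ∞ Z U)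
    (hW : ContDiffOn ℝ ∞ W U) {y : E4} (hy : y ∈ U) (a b : Fin 4) :
    pd a (fun z => VectorField.lieBracket ℝ Z W z b) y =
      ∑ d, ((Z y d * pd a (pd d fun z => W z b) y + pd d (fun z => W z b) y * pd a (fun z => Z z d) y)
      - (W y d * pd a (pd d fun z => Z z b) y + pd d (fun z => Z z b) y * pd a (fun z => W z d) y)) := by
  have hz : ∀ {Z : E4 → E4} (_ : ContDiffOn ℝ ∞ Z U) d, DifferentiableAt ℝ (fun z => Z z d) y :=
    fun hZ d => contDiffOn_diffAt (contDiffOn_coord hZ d) hU hy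
  have hz' : ∀ {Z : E4 → E4} (_ : ContDiffOn ℝ ∞ Z U) c d,
      DifferentiableAt ℝ (pd c fun z => Z z d) y := fun hZ c d =>
    contDiffOn_diffAt (contDiffOn_pd (contDiffOn_coord hZ d) hU c) hU hy
  rw [pd_congr hU (fun z hz => lieBracket_coord hU hZ hW hz b) hy]
  have h1 : ∀ d, DifferentiableAt ℝ (fun z => Z z d * pd d (fun z => W z b) z) y := fun d =>
    (hz hZ d).fun_mul (hz' hW d b)
  have h2 : ∀ d, DifferentiableAt ℝ (fun z => W z d * pd d (fun z => Z z b) z) y := fun d =>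
    (hz hW d).fun_mul (hz' hZ d b)
  rw [pd_sum a fun d _ => (h1 d).fun_sub (h2 d)]
  refine Finset.sum_congr rfl fun d _ => ?_
  rw [pd_sub a (h1 d) (h2 d), pd_mul a (hz hZ d) (hz' hW d b), pd_mul a (hz hW d) (hz' hZ d b)]

namespace Normal

variable {V : Set E4} {G : Comp2} (h : Normal V G)
include h

lemma pairEq_zero' (A : Comp2) (u w : Fin 4 → ℝ) : PairEq G A u w 0 ↔ ∀ a b c,
    3 * pd a (fun z => A z b c) 0 = pairForm u w a b c := h.pairEq_zero A u w

/-- This is L_Z Γ = 0 at a point where Γ vanishes: differentiate the Killing equation and take the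
Koszul combination of three index arrangements. -/
lemma killing_hessian {Z : E4 → E4} (hZ : ContDiffOn ℝ ∞ Z V) (hk : ∀ x ∈ V, KillingEq G Z x)
    (a b c : Fin 4) : pd a (pd b fun z => Z z c) 0 =
      - ∑ d, Z 0 d * pd d (christoffel G c a b) 0 := by
  have K : ∀ e a b, (∑ d, Z 0 d * pd e (pd d fun z => G z a b) 0)
      + sg b * pd e (pd a fun z => Z z b) 0 + sg a * pd e (pd b fun z => Z z a) 0 = 0 := by
    intro e a b
    have h1 : pd e (fun z => lieDeriv Z G z a b) 0 = 0 := by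
      have : pd e (fun z => lieDeriv Z G z a b) 0 = pd e (fun _ => (0 : ℝ)) 0 :=
        pd_congr h.isOpen (fun z hz => by rw [hk z hz]; rfl) h.zero_mem e
      rw [this, pd]; simp
    rw [pd_lieDeriv h.isOpen h.smooth hZ h.zero_mem] at h1
    simp only [h.deriv, h.val_apply, mul_zero, zero_mul, add_zero] at h1
    rw [← h1]
    simp [Finset.sum_add_distrib]
  have hs : ∀ a b c, pd a (pd b fun z => Z z c) 0 = pd b (pd a fun z => Z z c) 0 := fun a b c =>
    pd_comm (contDiffOn_coord hZ c) h.isOpen h.zero_mem a b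
  have hS := fun a b c d => pd_comm (h.smooth a b) h.isOpen h.zero_mem c d
  have e : ∑ d, Z 0 d * pd d (christoffel G c a b) 0 = (1 / 2) * (sg c *
      ((∑ d, Z 0 d * pd a (pd d fun z => G z b c) 0) + (∑ d, Z 0 d * pd b (pd d fun z => G z a c) 0)
      - ∑ d, Z 0 d * pd c (pd d fun z => G z a b) 0)) := by
    rw [← Finset.sum_add_distrib, ← Finset.sum_sub_distrib, Finset.mul_sum, Finset.mul_sum]
    refine Finset.sum_congr rfl fun d _ => ?_
    rw [h.pd_christoffel, hS c b d a, hS c a d b, hS a b d c, h.pd_pd_symm _ _ c b,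
      h.pd_pd_symm _ _ c a]
    ring
  rw [e]
  have k1 := K a b c
  have k2 := K b a c
  have k3 := K c a b
  rw [hs b a c] at k2
  rw [hs c a b, hs c b a] at k3
  linear_combination (1 / 2 * sg c) * (k1 + k2 - k3)
    - (pd a (pd b fun z => Z z c) 0) * sg_mul_self c

/-- In ∂_a [Z, W]_b the second derivatives combine, by `killing_hessian`, into R_{bade} Z^d W^e,
antisymmetric in a, b; the products of first derivatives form a commutator in so(1,3). -/
lemma killingEq_lieBracket {Z W : E4 → E4} (hZ : ContDiffOn ℝ ∞ Z V) (hW : ContDiffOn ℝ ∞ W V)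
    (kZ : ∀ x ∈ V, KillingEq G Z x) (kW : ∀ x ∈ V, KillingEq G W x) :
    KillingEq G (VectorField.lieBracket ℝ Z W) 0 := by
  rw [h.killingEq_iff]
  intro a b
  have nZ := (h.killingEq_iff Z).1 (kZ 0 h.zero_mem)
  have nW := (h.killingEq_iff W).1 (kW 0 h.zero_mem)
  have key := killing_commutator (fun a d => pd a (fun z => Z z d) 0)
    (fun a d => pd a (fun z => W z d) 0) nZ nW a b
  have hR : ∀ a b, sg b * ∑ d, (Z 0 d * pd a (pd d fun z => W z b) 0
      - W 0 d * pd a (pd d fun z => Z z b) 0) = ∑ d, ∑ e, Z 0 d * W 0 e * riemann G b a d e 0 := by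
    intro a b
    have hs : ∀ m p q r, pd p (christoffel G m q r) 0 = pd p (christoffel G m r q) 0 :=
      fun m p q r => pd_congr h.isOpen (fun z hz => h.christoffel_symm hz m q r) h.zero_mem p
    simp only [h.killing_hessian hZ kZ, h.killing_hessian hW kW, h.riemann_zero, h.riemannUp_zero]
    rw [Finset.sum_sub_distrib]
    have e2 : ∑ d, W 0 d * -∑ e, Z 0 e * pd e (christoffel G b a d) 0 =
        ∑ d, ∑ e, - (Z 0 d * W 0 e * pd d (christoffel G b a e) 0) := by
      rw [Finset.sum_comm]
      simp only [← Finset.sum_neg_distrib, Finset.mul_sum]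
      exact Finset.sum_congr rfl fun d _ => Finset.sum_congr rfl fun e _ => by ring
    rw [e2, ← Finset.sum_sub_distrib, Finset.mul_sum]
    refine Finset.sum_congr rfl fun d _ => ?_
    rw [← Finset.sum_neg_distrib, Finset.mul_sum, ← Finset.sum_sub_distrib, Finset.mul_sum]
    exact Finset.sum_congr rfl fun e _ => by ring
  have hanti : (∑ d, ∑ e, Z 0 d * W 0 e * riemann G b a d e 0)
      + ∑ d, ∑ e, Z 0 d * W 0 e * riemann G a b d e 0 = 0 := by
    simp only [← Finset.sum_add_distrib]
    exact Finset.sum_eq_zero fun d _ => Finset.sum_eq_zero fun e _ => by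
      rw [h.riemann_antisymm_left]; ring
  rw [← hR, ← hR] at hanti
  rw [pd_lieBracket h.isOpen hZ hW h.zero_mem, pd_lieBracket h.isOpen hZ hW h.zero_mem]
  have e : ∀ a b, ∑ d, ((Z 0 d * pd a (pd d fun z => W z b) 0
        + pd d (fun z => W z b) 0 * pd a (fun z => Z z d) 0)
      - (W 0 d * pd a (pd d fun z => Z z b) 0 + pd d (fun z => Z z b) 0 * pd a (fun z => W z d) 0)) =
      (∑ d, (Z 0 d * pd a (pd d fun z => W z b) 0 - W 0 d * pd a (pd d fun z => Z z b) 0))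
      + ∑ d, (pd a (fun z => Z z d) 0 * pd d (fun z => W z b) 0
        - pd a (fun z => W z d) 0 * pd d (fun z => Z z b) 0) := by
    intro a b
    rw [← Finset.sum_add_distrib]
    exact Finset.sum_congr rfl fun d _ => by ring
  rw [e, e]
  linear_combination hanti + key

/-- A Killing vector preserves g, ∇ and η, so applying L_Z to the pair equation only replaces A, u,
w by their Lie derivatives. -/
lemma pairEq_lieDeriv {A : Comp2} (hA : SmM V A) {Z u w : E4 → E4} (hZ : ContDiffOn ℝ ∞ Z V)
    (hu : ContDiffOn ℝ ∞ u V) (hw : ContDiffOn ℝ ∞ w V) (kZ : ∀ x ∈ V, KillingEq G Z x)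
    (hp : ∀ x ∈ V, PairEq G A (u x).ofLp (w x).ofLp x) :
    PairEq G (lieDeriv Z A) (VectorField.lieBracket ℝ Z u 0).ofLp
      (VectorField.lieBracket ℝ Z w 0).ofLp 0 := by
  rw [h.pairEq_zero']
  intro a b c
  have hp0 := (h.pairEq_zero' A _ _).1 (hp 0 h.zero_mem)
  have nZ := (h.killingEq_iff Z).1 (kZ 0 h.zero_mem)
  have key := pairForm_lie (fun a d => pd a (fun z => Z z d) 0) nZ (u 0).ofLp (w 0).ofLp a b c
  have hd := fun d => h.pd_pairEq' hA hu hw hp d a b c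
  have hS := fun d => pd_comm (hA b c) h.isOpen h.zero_mem a d
  have hsum : ∑ d, Z 0 d * (3 * (pd d (pd a fun z => A z b c) 0
      - ∑ m, (pd d (christoffel G m a b) 0 * A 0 m c + pd d (christoffel G m a c) 0 * A 0 b m))) =
      pairForm (fun b => ∑ d, Z 0 d * pd d (fun z => u z b) 0)
        (fun b => ∑ d, Z 0 d * pd d (fun z => w z b) 0) a b c := by
    simp only [hd]
    simp only [pairForm, mul_add, mul_sub, Finset.sum_add_distrib, Finset.sum_sub_distrib,
      Finset.mul_sum]
    congr 1
    · congr 1 <;> exact Finset.sum_congr rfl fun d _ => by ring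
    · rw [Finset.sum_comm]
      exact Finset.sum_congr rfl fun d _ => Finset.sum_congr rfl fun e _ => by ring
  -- The second derivatives of Z become derivatives of Γ, matching the connection terms of the
  -- differentiated pair equation in `hsum`: this is [L_Z, ∇] = 0.
  have hΓ : ∀ b c : Fin 4, ∑ d, A 0 d c * pd a (pd b fun z => Z z d) 0 =
      - ∑ d, Z 0 d * ∑ m, pd d (christoffel G m a b) 0 * A 0 m c := by
    intro b c
    simp only [h.killing_hessian hZ kZ, Finset.mul_sum, mul_neg, Finset.sum_neg_distrib]
    rw [Finset.sum_comm]
    congr 1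
    exact Finset.sum_congr rfl fun d _ => Finset.sum_congr rfl fun e _ => by ring
  have hΓ' : ∀ b c : Fin 4, ∑ d, A 0 b d * pd a (pd c fun z => Z z d) 0 =
      - ∑ d, Z 0 d * ∑ m, pd d (christoffel G m a c) 0 * A 0 b m := by
    intro b c
    simp only [h.killing_hessian hZ kZ, Finset.mul_sum, mul_neg, Finset.sum_neg_distrib]
    rw [Finset.sum_comm]
    congr 1
    exact Finset.sum_congr rfl fun d _ => Finset.sum_congr rfl fun e _ => by ring
  have hbr : pairForm (VectorField.lieBracket ℝ Z u 0).ofLp (VectorField.lieBracket ℝ Z w 0).ofLp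
      a b c = pairForm (fun b => ∑ d, Z 0 d * pd d (fun z => u z b) 0)
        (fun b => ∑ d, Z 0 d * pd d (fun z => w z b) 0) a b c
      - pairForm (fun b => ∑ d, pd d (fun z => Z z b) 0 * u 0 d)
        (fun b => ∑ d, pd d (fun z => Z z b) 0 * w 0 d) a b c := by
    simp only [pairForm, lieBracket_coord h.isOpen hZ hu h.zero_mem,
      lieBracket_coord h.isOpen hZ hw h.zero_mem, Finset.sum_sub_distrib, mul_sub,
      mul_comm (pd _ (fun z => Z z _) 0)]
    ring
  rw [pd_lieDeriv h.isOpen hA hZ h.zero_mem, hbr, ← hsum]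
  simp only [← hp0] at key
  have e3 : ∑ d, (pd a (fun z => Z z d) 0 * (3 * pd d (fun z => A z b c) 0)
      + pd b (fun z => Z z d) 0 * (3 * pd a (fun z => A z d c) 0)
      + pd c (fun z => Z z d) 0 * (3 * pd a (fun z => A z b d) 0)) =
      3 * ((∑ d, pd d (fun z => A z b c) 0 * pd a (fun z => Z z d) 0)
      + (∑ d, pd b (fun z => Z z d) 0 * pd a (fun z => A z d c) 0)
      + ∑ d, pd c (fun z => Z z d) 0 * pd a (fun z => A z b d) 0) := by
    rw [← Finset.sum_add_distrib, ← Finset.sum_add_distrib, Finset.mul_sum]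
    exact Finset.sum_congr rfl fun d _ => by ring
  rw [e3] at key
  have e4 : ∑ d, Z 0 d * (3 * (pd d (pd a fun z => A z b c) 0
      - ∑ m, (pd d (christoffel G m a b) 0 * A 0 m c + pd d (christoffel G m a c) 0 * A 0 b m))) =
      3 * ((∑ d, Z 0 d * pd a (pd d fun z => A z b c) 0)
      - (∑ d, Z 0 d * ∑ m, pd d (christoffel G m a b) 0 * A 0 m c)
      - ∑ d, Z 0 d * ∑ m, pd d (christoffel G m a c) 0 * A 0 b m) := by
    rw [← Finset.sum_sub_distrib, ← Finset.sum_sub_distrib, Finset.mul_sum]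
    refine Finset.sum_congr rfl fun d _ => ?_
    rw [hS d, Finset.sum_add_distrib]; ring
  rw [e4]
  simp only [Finset.sum_add_distrib, hΓ, hΓ']
  linear_combination key

end Normal

section Chart

variable {U : Set E4} {G : Comp2} (h : MetricOn U G)
include h

/-- Killing vectors are closed under the Lie bracket. -/
theorem MetricOn.killingEq_lieBracket {Z W : E4 → E4} (hZ : ContDiffOn ℝ ∞ Z U)
    (hW : ContDiffOn ℝ ∞ W U) (kZ : ∀ x ∈ U, KillingEq G Z x) (kW : ∀ x ∈ U, KillingEq G W x)
    {y : E4} (hy : y ∈ U) : KillingEq G (VectorField.lieBracket ℝ Z W) y := by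
  obtain ⟨φ, V, k, rfl, hN⟩ := h.exists_normal' hy
  have h0 := hN.zero_mem
  rw [← k.killingEq_pull h (contDiffOn_lieBracket h.isOpen hZ hW) h0]
  have := hN.killingEq_lieBracket (k.pullVec_smooth hZ) (k.pullVec_smooth hW)
    (fun x hx => (k.killingEq_pull h hZ hx).2 (kZ _ (k.mapsTo hx)))
    (fun x hx => (k.killingEq_pull h hW hx).2 (kW _ (k.mapsTo hx)))
  rw [KillingEq, lieDeriv_eq] at this ⊢
  have e : ∀ x ∈ V, VectorField.lieBracket ℝ (pullVec φ Z) (pullVec φ W) x =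
      pullVec φ (VectorField.lieBracket ℝ Z W) x := fun x hx => k.lieBracket_pull hZ hW hx
  have ej : jac (VectorField.lieBracket ℝ (pullVec φ Z) (pullVec φ W)) 0 =
      jac (pullVec φ (VectorField.lieBracket ℝ Z W)) 0 := by
    ext i a
    exact pd_congr k.isOpen (fun x hx => by rw [e x hx]) h0 a
  rwa [← ej, ← e 0 h0]

/-- The Lie derivative along a Killing vector of a conformal Killing-Yano tensor. -/
theorem MetricOn.pairEq_lieDeriv {A : Comp2} (hA : SmM U A) {Z u w : E4 → E4}
    (hZ : ContDiffOn ℝ ∞ Z U) (hu : ContDiffOn ℝ ∞ u U) (hw : ContDiffOn ℝ ∞ w U)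
    (kZ : ∀ x ∈ U, KillingEq G Z x) (hp : ∀ x ∈ U, PairEq G A (u x).ofLp (w x).ofLp x)
    {y : E4} (hy : y ∈ U) : PairEq G (lieDeriv Z A) (VectorField.lieBracket ℝ Z u y).ofLp
      (VectorField.lieBracket ℝ Z w y).ofLp y := by
  obtain ⟨φ, V, k, rfl, hN⟩ := h.exists_normal' hy
  have h0 := hN.zero_mem
  rw [← k.pairEq_pull h (smM_lieDeriv h.isOpen hZ hA) h0, ← k.lieBracket_pull hZ hu h0,
    ← k.lieBracket_pull hZ hw h0]
  have := hN.pairEq_lieDeriv (k.pull_smooth hA) (k.pullVec_smooth hZ) (k.pullVec_smooth hu)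
    (k.pullVec_smooth hw) (fun x hx => (k.killingEq_pull h hZ hx).2 (kZ _ (k.mapsTo hx)))
    (fun x hx => (k.pairEq_pull h hA hx u w).2 (hp _ (k.mapsTo hx)))
  rw [hN.pairEq_zero] at this ⊢
  intro a b c
  rw [← this]
  congr 1
  exact pd_congr k.isOpen (fun x hx => by rw [k.lieDeriv_pull hZ hA hx]) h0 a

end Chart

/-! ### Self-dual 2-forms as complex 3-vectors -/

/-- The complex 3-vector of the self-dual part of a 2-form. -/
def sdv (X : Fin 4 → Fin 4 → ℝ) : Fin 3 → ℂ :=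
  ![X 0 1 + Complex.I * X 2 3, X 0 2 + Complex.I * X 3 1, X 0 3 + Complex.I * X 1 2]

lemma antisymm_values {X : Fin 4 → Fin 4 → ℝ} (hX : ∀ a b, X a b = - X b a) :
    X 0 0 = 0 ∧ X 1 1 = 0 ∧ X 2 2 = 0 ∧ X 3 3 = 0 ∧ X 1 0 = - X 0 1 ∧ X 2 0 = - X 0 2 ∧
      X 3 0 = - X 0 3 ∧ X 2 1 = - X 1 2 ∧ X 3 2 = - X 2 3 ∧ X 1 3 = - X 3 1 :=
  ⟨by linarith [hX 0 0], by linarith [hX 1 1], by linarith [hX 2 2], by linarith [hX 3 3],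
    hX 1 0, hX 2 0, hX 3 0, hX 2 1, hX 3 2, hX 1 3⟩

/-- The isomorphism of so(1,3) with so(3, ℂ), whose bracket is the cross product. -/
lemma sdv_commutator {X A : Fin 4 → Fin 4 → ℝ} (hX : ∀ a b, X a b = - X b a)
    (hA : ∀ a b, A a b = - A b a) :
    sdv (fun c d => ∑ e, sg e * (X e c * A e d + X e d * A c e)) =
      Complex.I • (sdv A ⨯₃ sdv X) := by
  obtain ⟨x0, x1, x2, x3, x10, x20, x30, x21, x32, x13⟩ := antisymm_values hX
  obtain ⟨a0, a1, a2, a3, a10, a20, a30, a21, a32, a13⟩ := antisymm_values hA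
  funext k
  fin_cases k <;>
  · simp only [sdv, Fin.sum_univ_four, cross_apply, sg_zero, sg_one, sg_two, sg_three, x0, x1, x2,
      x3, x10, x20, x30, x21, x32, x13, a0, a1, a2, a3, a10, a20, a30, a21, a32, a13]
    apply Complex.ext <;> simp <;> ring

/-- The source term of the integrability condition. -/
def sourceForm (n m : Fin 4 → Fin 4 → ℝ) (a b c d : Fin 4) : ℝ :=
  ((if b = d then sg b else 0) * n a c - (if b = c then sg b else 0) * n a d
      + ∑ e, leviCivita b c d e * (sg e * m a e))
    - ((if a = d then sg a else 0) * n b c - (if a = c then sg a else 0) * n b d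
      + ∑ e, leviCivita a c d e * (sg e * m b e))

/-- The dual pair of spatial indices. -/
def dualPair : Fin 3 → Fin 4 × Fin 4 := ![(2, 3), (3, 1), (1, 2)]

/-- Besides the form indices, the plane indices are also complexified, pairing the plane (0, l) with
its dual. In this combination the source depends on n and m only through a single complex vector. -/
lemma sdv_sourceForm {n m : Fin 4 → Fin 4 → ℝ} (hn : ∀ a b, n a b = - n b a)
    (hm : ∀ a b, m a b = - m b a) (l : Fin 3) :
    sdv (sourceForm n m 0 l.succ) + Complex.I • sdv (sourceForm n m (dualPair l).1 (dualPair l).2) =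
      (2 * Complex.I) • ((sdv n + Complex.I • sdv m) ⨯₃ Pi.single l 1) := by
  obtain ⟨x0, x1, x2, x3, x10, x20, x30, x21, x32, x13⟩ := antisymm_values hn
  obtain ⟨a0, a1, a2, a3, a10, a20, a30, a21, a32, a13⟩ := antisymm_values hm
  obtain ⟨q1, q2, q3, q4, q5, q6, q7, q8, q9, q10, q11, q12, q13, q14, q15, q16, q17, q18, q19, q20,
    q21, q22, q23, q24⟩ := leviCivita_values
  funext k
  fin_cases l <;> fin_cases k <;>
  · simp [sdv, sourceForm, dualPair, Fin.sum_univ_four, cross_apply, x0, x1, x2,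
      x3, x10, x20, x30, x21, x32, x13, a0, a1, a2, a3, a10, a20, a30, a21, a32, a13,
      leviCivita_self_12, leviCivita_self_13, leviCivita_self_14, leviCivita_self_23,
      leviCivita_self_24, leviCivita_self_34, q1, q2, q3, q4, q5, q6, q7, q8, q9, q10, q11, q12,
      q13, q14, q15, q16, q17, q18, q19, q20, q21, q22, q23, q24]
    try (apply Complex.ext <;> simp <;> ring)

/-- The source has no mixed part, so the mixed block of the curvature will satisfy a homogeneous
equation. -/
lemma sdv_sourceForm' {n m : Fin 4 → Fin 4 → ℝ} (hn : ∀ a b, n a b = - n b a)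
    (hm : ∀ a b, m a b = - m b a) (l : Fin 3) :
    sdv (sourceForm n m 0 l.succ) - Complex.I • sdv (sourceForm n m (dualPair l).1 (dualPair l).2) =
      0 := by
  obtain ⟨x0, x1, x2, x3, x10, x20, x30, x21, x32, x13⟩ := antisymm_values hn
  obtain ⟨a0, a1, a2, a3, a10, a20, a30, a21, a32, a13⟩ := antisymm_values hm
  obtain ⟨q1, q2, q3, q4, q5, q6, q7, q8, q9, q10, q11, q12, q13, q14, q15, q16, q17, q18, q19, q20,
    q21, q22, q23, q24⟩ := leviCivita_values
  funext k
  fin_cases l <;> fin_cases k <;>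
  · simp [sdv, sourceForm, dualPair, Fin.sum_univ_four, x0, x1, x2,
      x3, x10, x20, x30, x21, x32, x13, a0, a1, a2, a3, a10, a20, a30, a21, a32, a13,
      leviCivita_self_12, leviCivita_self_13, leviCivita_self_14, leviCivita_self_23,
      leviCivita_self_24, leviCivita_self_34, q1, q2, q3, q4, q5, q6, q7, q8, q9, q10, q11, q12,
      q13, q14, q15, q16, q17, q18, q19, q20, q21, q22, q23, q24]
    try (apply Complex.ext <;> simp <;> ring)

/-! ### Algebra of complex 3-vectors -/

/-- Expand α × (α × x) = (α·x) α − (α·α) x. -/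
lemma eq_smul_of_cross_eq_zero {α x : Fin 3 → ℂ} (hα : α ⬝ᵥ α ≠ 0) (h : α ⨯₃ x = 0) :
    x = ((α ⬝ᵥ x) / (α ⬝ᵥ α)) • α := by
  have h0 := congrFun h 0
  have h1 := congrFun h 1
  have h2 := congrFun h 2
  simp [cross_apply] at h0 h1 h2
  funext k
  rw [Pi.smul_apply, smul_eq_mul, div_mul_eq_mul_div, eq_div_iff hα]
  simp only [dotProduct, Fin.sum_univ_three]
  fin_cases k <;> simp
  · linear_combination α 2 * h1 - α 1 * h2
  · linear_combination α 0 * h2 - α 2 * h0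
  · linear_combination α 1 * h0 - α 0 * h1

/-- Pairing the first equation with α shows ν = κα, so each W_l − κe_l is parallel to α, and
symmetry gives W = κ·1 + μ α⊗α. The equation for β then makes μ(α_l γ_k + α_k γ_l) vanish with γ = α
× β; contracting with α yields μ (α·α) γ = 0, so μ = 0. Each P_l is parallel to α and killed by β ×
·, hence zero. -/
lemma cross_rigidity {α β : Fin 3 → ℂ} (hα : α ⬝ᵥ α ≠ 0) (hγ : α ⨯₃ β ≠ 0)
    {W P : Fin 3 → Fin 3 → ℂ} (hW : ∀ k l, W k l = W l k) {ν ν' : Fin 3 → ℂ}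
    (h1 : ∀ l, α ⨯₃ (W l) = ν ⨯₃ Pi.single l 1) (h2 : ∀ l, β ⨯₃ (W l) = ν' ⨯₃ Pi.single l 1)
    (h3 : ∀ l, α ⨯₃ (P l) = 0) (h4 : ∀ l, β ⨯₃ (P l) = 0) :
    (∃ κ : ℂ, ∀ k l, W k l = if k = l then κ else 0) ∧ ∀ k l, P k l = 0 := by
  have hν : α ⨯₃ ν = 0 := by
    have d : ∀ l, α ⬝ᵥ (ν ⨯₃ Pi.single l 1) = 0 := fun l => by rw [← h1 l, dot_self_cross]
    have d0 := d 0
    have d1 := d 1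
    have d2 := d 2
    simp [cross_apply, dotProduct, Fin.sum_univ_three] at d0 d1 d2
    funext k
    fin_cases k <;> simp [cross_apply]
    · linear_combination d0
    · linear_combination d1
    · linear_combination d2
  obtain ⟨κ, hκ⟩ : ∃ κ : ℂ, ν = κ • α := ⟨_, eq_smul_of_cross_eq_zero hα hν⟩
  have hm : ∃ m : Fin 3 → ℂ, ∀ l, W l = κ • Pi.single l 1 + m l • α := by
    refine ⟨fun l => (α ⬝ᵥ (W l - κ • Pi.single l 1)) / (α ⬝ᵥ α), fun l => ?_⟩
    have : α ⨯₃ (W l - κ • Pi.single l 1) = 0 := by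
      rw [map_sub, h1, hκ, map_smul, map_smul, LinearMap.smul_apply, sub_self]
    rw [← eq_smul_of_cross_eq_zero hα this]
    abel
  obtain ⟨m, hm⟩ := hm
  have hmα : ∃ μ : ℂ, m = μ • α := by
    refine ⟨_, eq_smul_of_cross_eq_zero hα ?_⟩
    have s := fun k l => hW k l
    simp only [hm] at s
    have s1 := s 0 1
    have s2 := s 1 2
    have s3 := s 2 0
    simp at s1 s2 s3
    funext k
    fin_cases k <;> simp [cross_apply]
    · linear_combination - s2
    · linear_combination - s3
    · linear_combination - s1
  obtain ⟨μ, hμ⟩ := hmα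
  -- Symmetrise `h2` in k, l: the matrices of β × · and ν' × · are antisymmetric and drop out.
  have key : ∀ k l, μ * (α l * (α ⨯₃ β) k + α k * (α ⨯₃ β) l) = 0 := by
    intro k l
    have e1 := congrFun (h2 l) k
    have e2 := congrFun (h2 k) l
    rw [hm, hμ] at e1 e2
    fin_cases k <;> fin_cases l <;> simp [cross_apply, -mul_eq_zero] at e1 e2 ⊢ <;>
      linear_combination - e1 - e2
  have hγμ : μ = 0 := by
    by_contra hne
    apply hγ
    have orth : α ⬝ᵥ (α ⨯₃ β) = 0 := dot_self_cross α β
    funext k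
    have key' : ∀ l, α l * (α ⨯₃ β) k + α k * (α ⨯₃ β) l = 0 := fun l =>
      (mul_eq_zero.1 (key k l)).resolve_left hne
    have : (α ⬝ᵥ α) * (α ⨯₃ β) k = 0 := by
      simp only [dotProduct, Fin.sum_univ_three] at orth ⊢
      linear_combination α 0 * key' 0 + α 1 * key' 1 + α 2 * key' 2 - α k * orth
    simpa using (mul_eq_zero.1 this).resolve_left hα
  refine ⟨⟨κ, fun k l => ?_⟩, fun k l => ?_⟩
  · rw [hm, hμ, hγμ]
    simp [Pi.single_apply, eq_comm]
  · obtain ⟨c, hc⟩ : ∃ c : ℂ, P k = c • α := ⟨_, eq_smul_of_cross_eq_zero hα (h3 k)⟩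
    have := h4 k
    rw [hc, map_smul, ← cross_anticomm, smul_neg, neg_eq_zero, smul_eq_zero] at this
    rw [hc, this.resolve_right hγ]
    simp

/-! ### Non-nullity, and constant curvature from two independent solutions. -/

/-- A 2-form is non null at a point. -/
def NonNullAt (G A : Comp2) (y : E4) : Prop :=
  pairing G A A y ≠ 0 ∨ pairing G A (hodge G A) y ≠ 0

lemma pairing_eq_trace (G S T : Comp2) (y : E4) :
    pairing G S T y = (1 / 2) * (S y * (raise G T y)ᵀ).trace := by
  simp only [pairing, Matrix.trace, Matrix.diag_apply, Matrix.mul_apply, Matrix.transpose_apply]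

lemma pairing_congr {G S T S' T' : Comp2} {y : E4} (hS : S y = S' y) (hT : T y = T' y) :
    pairing G S T y = pairing G S' T' y := by
  simp only [pairing, raise, hS, hT]

namespace CoordMap

variable {V U : Set E4} {φ : E4 → E4} (k : CoordMap V U φ)
include k

lemma pairing_pull (G S T : Comp2) {x : E4} (hx : x ∈ V) :
    pairing (pull φ G) (pull φ S) (pull φ T) x = pairing G S T (φ x) := by
  rw [pairing_eq_trace, pairing_eq_trace, ← k.raise_pull G T hx, pull]
  simp only [Matrix.transpose_mul, Matrix.transpose_transpose, Matrix.mul_assoc]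
  rw [Matrix.trace_mul_comm]
  simp only [Matrix.mul_assoc]

lemma nonNullAt_pull (G A : Comp2) {x : E4} (hx : x ∈ V) :
    NonNullAt (pull φ G) (pull φ A) x ↔ NonNullAt G A (φ x) := by
  rw [NonNullAt, NonNullAt, k.pairing_pull G A A hx, ← k.pairing_pull G A (hodge G A) hx,
    pairing_congr rfl (k.hodge_pull G A hx)]

end CoordMap

lemma sdv_injective {X Y : Fin 4 → Fin 4 → ℝ} (hX : ∀ a b, X a b = - X b a)
    (hY : ∀ a b, Y a b = - Y b a) (h : sdv X = sdv Y) : X = Y := by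
  obtain ⟨x0, x1, x2, x3, x10, x20, x30, x21, x32, x13⟩ := antisymm_values hX
  obtain ⟨a0, a1, a2, a3, a10, a20, a30, a21, a32, a13⟩ := antisymm_values hY
  have h0 := congrFun h 0
  have h1 := congrFun h 1
  have h2 := congrFun h 2
  simp [sdv, Complex.ext_iff] at h0 h1 h2
  obtain ⟨h0, h0'⟩ := h0
  obtain ⟨h1, h1'⟩ := h1
  obtain ⟨h2, h2'⟩ := h2
  funext a b
  fin_cases a <;> fin_cases b <;> simp only [Fin.zero_eta, Fin.mk_one, Fin.reduceFinMk, x0, x1, x2,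
    x3, x10, x20, x30, x21, x32, x13, a0, a1, a2, a3, a10, a20, a30, a21, a32, a13, h0, h1, h2, h0',
    h1', h2']

lemma sdv_apply (X : Fin 4 → Fin 4 → ℝ) (l : Fin 3) :
    sdv X l = X 0 l.succ + Complex.I * X (dualPair l).1 (dualPair l).2 := by
  fin_cases l <;> rfl

lemma antisymm_zero {X : Fin 4 → Fin 4 → ℝ} (hX : ∀ a b, X a b = - X b a)
    (h : ∀ k : Fin 3, X 0 k.succ = 0 ∧ X (dualPair k).1 (dualPair k).2 = 0) (a b : Fin 4) :
    X a b = 0 := by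
  have h0 := h 0
  have h1 := h 1
  have h2 := h 2
  simp [dualPair] at h0 h1 h2
  have : X = fun _ _ => 0 := sdv_injective hX (by simp) (by simp [sdv, h0, h1, h2])
  rw [this]

lemma sdv_add_smul (X Y : Fin 4 → Fin 4 → ℝ) (a b : ℝ) :
    sdv (fun i j => a * X i j + b * Y i j) = (a : ℂ) • sdv X + (b : ℂ) • sdv Y := by
  funext k
  fin_cases k <;> simp [sdv] <;> ring

lemma sdv_smul (X : Fin 4 → Fin 4 → ℝ) (a : ℝ) :
    sdv (fun i j => a * X i j) = (a : ℂ) • sdv X := by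
  funext k
  fin_cases k <;> simp [sdv] <;> ring

namespace Normal

variable {V : Set E4} {G : Comp2} (h : Normal V G)
include h

/-- Consequently aA + b*A corresponds to the complex multiple (a − ib) of the vector of A: real
combinations of A and *A are a complex line. -/
lemma sdv_hodge {A : Comp2} (hA : ∀ a b, A 0 a b = - A 0 b a) :
    sdv (hodge G A 0) = (-Complex.I) • sdv (A 0) := by
  obtain ⟨a0, a1, a2, a3, a10, a20, a30, a21, a32, a13⟩ := antisymm_values hA
  obtain ⟨q1, q2, q3, q4, q5, q6, q7, q8, q9, q10, q11, q12, q13, q14, q15, q16, q17, q18, q19, q20,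
    q21, q22, q23, q24⟩ := leviCivita_values
  funext k
  fin_cases k <;>
  · simp [sdv, h.hodge_zero, Fin.sum_univ_four, a0, a1, a2, a3, a10, a20, a30, a21, a32, a13,
      leviCivita_self_12, leviCivita_self_13, leviCivita_self_14, leviCivita_self_23,
      leviCivita_self_24, leviCivita_self_34, q1, q2, q3, q4, q5, q6, q7, q8, q9, q10, q11, q12,
      q13, q14, q15, q16, q17, q18, q19, q20, q21, q22, q23, q24]
    apply Complex.ext <;> simp <;> ring

lemma pairing_zero (S T : Comp2) : pairing G S T 0 =
    (1 / 2) * ∑ a, ∑ b, S 0 a b * (sg a * sg b * T 0 a b) := by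
  simp only [pairing, h.raise_zero]

/-- The complex bilinear form packs both real invariants, so non null means non isotropic in ℂ³. -/
lemma sdv_dotProduct {S T : Comp2} (hS : ∀ a b, S 0 a b = - S 0 b a)
    (hT : ∀ a b, T 0 a b = - T 0 b a) :
    sdv (S 0) ⬝ᵥ sdv (T 0) = - (pairing G S T 0 + Complex.I * pairing G S (hodge G T) 0) := by
  have e := h.sdv_hodge hT
  have e0 := congrFun e 0
  have e1 := congrFun e 1
  have e2 := congrFun e 2
  obtain ⟨a0, a1, a2, a3, a10, a20, a30, a21, a32, a13⟩ := antisymm_values hT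
  obtain ⟨x0, x1, x2, x3, x10, x20, x30, x21, x32, x13⟩ := antisymm_values hS
  obtain ⟨y0, y1, y2, y3, y10, y20, y30, y21, y32, y13⟩ :=
    antisymm_values (hodge_antisymm G T 0)
  simp [sdv, Complex.ext_iff] at e0 e1 e2
  obtain ⟨e00, e01⟩ := e0
  obtain ⟨e10, e11⟩ := e1
  obtain ⟨e20, e21⟩ := e2
  simp only [dotProduct, h.pairing_zero, Fin.sum_univ_three, Fin.sum_univ_four, a0, a1, a2, a3, a10,
    a20, a30, a21, a32, a13, x0, x1, x2, x3, x10, x20, x30, x21, x32, x13, y0, y1, y2, y3, y10, y20,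
    y30, y21, y32, y13, e00, e01, e10, e11, e20, e21, sdv]
  apply Complex.ext <;> simp <;> ring

lemma nonNullAt_iff {A : Comp2} (hA : ∀ a b, A 0 a b = - A 0 b a) :
    NonNullAt G A 0 ↔ sdv (A 0) ⬝ᵥ sdv (A 0) ≠ 0 := by
  rw [h.sdv_dotProduct hA hA, neg_ne_zero, NonNullAt, Ne, Ne, Ne, Complex.ext_iff]
  simp
  tauto

lemma pairing_hodge_hodge {A : Comp2} (hA : ∀ a b, A 0 a b = - A 0 b a) :
    pairing G (hodge G A) A 0 = pairing G A (hodge G A) 0 ∧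
      pairing G (hodge G A) (hodge G A) 0 = - pairing G A A 0 := by
  have h1 := h.sdv_dotProduct hA hA
  have h2 := h.sdv_dotProduct (S := hodge G A) (hodge_antisymm G A 0) hA
  rw [h.sdv_hodge hA, smul_dotProduct, h1] at h2
  rw [Complex.ext_iff] at h2
  simp at h2
  constructor <;> linarith [h2.1, h2.2]

/-- Two independent solutions of the pair equation exist only where the curvature is constant. -/
lemma constCurv_or_combination {A B : Comp2} (hA : SmM V A) (hB : SmM V B) (aA : AntisymmOn V A)
    (aB : AntisymmOn V B) {u w u' w' : E4 → E4} (hu : ContDiffOn ℝ ∞ u V)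
    (hw : ContDiffOn ℝ ∞ w V) (hu' : ContDiffOn ℝ ∞ u' V) (hw' : ContDiffOn ℝ ∞ w' V)
    (ku : KillingEq G u 0) (kw : KillingEq G w 0) (ku' : KillingEq G u' 0)
    (kw' : KillingEq G w' 0) (hp : ∀ x ∈ V, PairEq G A (u x).ofLp (w x).ofLp x)
    (hp' : ∀ x ∈ V, PairEq G B (u' x).ofLp (w' x).ofLp x) (hn : NonNullAt G A 0) :
    (∃ K, ConstCurvAt G K 0) ∨ ∃ a b : ℝ, B 0 = a • A 0 + b • hodge G A 0 := by
  have a0 := aA 0 h.zero_mem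
  have b0 := aB 0 h.zero_mem
  rw [h.nonNullAt_iff a0] at hn
  by_cases hγ : sdv (A 0) ⨯₃ sdv (B 0) = 0
  -- Parallel complex vectors: the complex ratio c supplies the coefficients Re c and −Im c.
  · right
    obtain ⟨c, hc⟩ : ∃ c : ℂ, sdv (B 0) = c • sdv (A 0) := ⟨_, eq_smul_of_cross_eq_zero hn hγ⟩
    refine ⟨c.re, - c.im, ?_⟩
    have := sdv_injective (X := B 0) (Y := fun i j => c.re * A 0 i j + (-c.im) * hodge G A 0 i j)
      b0 (fun i j => by rw [a0 i j, hodge_antisymm G A 0 i j]; ring) (by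
        refine Eq.trans ?_ (sdv_add_smul (A 0) (hodge G A 0) c.re (-c.im)).symm
        rw [h.sdv_hodge a0, hc, smul_smul, ← add_smul]
        congr 1
        apply Complex.ext <;> simp)
    rw [this]
    rfl
  · left
    -- The first index pair of `R` labels the plane and the last pair is the 2-form read by `sdv`.
    set R : Fin 4 → Fin 4 → Fin 4 → Fin 4 → ℝ := fun a b c d => riemann G c d a b 0 with hR
    have R1 : ∀ a b c d, R a b c d = - R a b d c := fun a b c d => h.riemann_antisymm_left c d a b
    have R2 : ∀ a b c d, R a b c d = - R b a c d := fun a b c d => h.riemann_antisymm_right c d a b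
    have R3 : ∀ a b c d, R a b c d = R c d a b := fun a b c d => h.riemann_pair c d a b
    have main : ∀ (A : Comp2) (u w : E4 → E4), SmM V A → AntisymmOn V A → ContDiffOn ℝ ∞ u V →
        ContDiffOn ℝ ∞ w V → KillingEq G u 0 → KillingEq G w 0 →
        (∀ x ∈ V, PairEq G A (u x).ofLp (w x).ofLp x) → ∃ ν : Fin 3 → ℂ, ∀ l : Fin 3,
        sdv (A 0) ⨯₃ (sdv (R 0 l.succ)
          + Complex.I • sdv (R (dualPair l).1 (dualPair l).2)) = ν ⨯₃ Pi.single l 1 ∧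
        sdv (A 0) ⨯₃ (sdv (R 0 l.succ)
          - Complex.I • sdv (R (dualPair l).1 (dualPair l).2)) = 0 := by
      intro A u w hA aA hu hw ku kw hp
      have a0 := aA 0 h.zero_mem
      set n : Fin 4 → Fin 4 → ℝ := fun a c => sg c * pd a (fun z => u z c) 0 with hn
      set m : Fin 4 → Fin 4 → ℝ := fun a c => sg c * pd a (fun z => w z c) 0 with hm
      have an : ∀ a b, n a b = - n b a := fun a b => by
        have := (h.killingEq_iff u).1 ku a b
        simp only [hn]; linarith
      have am : ∀ a b, m a b = - m b a := fun a b => by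
        have := (h.killingEq_iff w).1 kw a b
        simp only [hm]; linarith
      have hint : ∀ a b c d, -3 * ∑ e, sg e * (R a b e c * A 0 e d + R a b e d * A 0 c e) =
          sourceForm n m a b c d := by
        intro a b c d
        rw [h.integrability hA hu hw hp a b c d]
        simp only [sourceForm, hm, ← mul_assoc, sg_mul_self, one_mul, hn, mul_comm (sg _) (sg _)]
      have hs : ∀ a b, (-3 * Complex.I) • (sdv (A 0) ⨯₃ sdv (R a b)) = sdv (sourceForm n m a b) := by
        intro a b
        have e : sourceForm n m a b = fun c d => (-3 : ℝ) *
            (fun c d => ∑ e, sg e * (R a b e c * A 0 e d + R a b e d * A 0 c e)) c d := by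
          funext c d; rw [← hint]
        rw [e, sdv_smul, sdv_commutator (R1 a b) a0, smul_smul]
        push_cast
        rfl
      -- The self-dual source carries 2i and the curvature side −3i, whence −2/3.
      refine ⟨(-2 / 3 : ℂ) • (sdv n + Complex.I • sdv m), fun l => ⟨?_, ?_⟩⟩
      · have e := sdv_sourceForm an am l
        rw [← hs, ← hs] at e
        have h3 : (-3 * Complex.I) ≠ 0 := by simp
        apply smul_right_injective _ h3
        simp only [map_add, map_smul, LinearMap.smul_apply, smul_add] at e ⊢
        rw [smul_comm (-3 * Complex.I) Complex.I, e]
        simp only [smul_smul, LinearMap.add_apply, LinearMap.smul_apply, smul_add]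
        congr 2 <;> ring_nf
      · have e := sdv_sourceForm' an am l
        rw [← hs, ← hs] at e
        have h3 : (-3 * Complex.I) ≠ 0 := by simp
        apply smul_right_injective _ h3
        simp only [map_sub, map_smul, smul_sub, smul_zero] at e ⊢
        rw [smul_comm (-3 * Complex.I) Complex.I, e]
    obtain ⟨ν, hν⟩ := main A u w hA aA hu hw ku kw hp
    obtain ⟨ν', hν'⟩ := main B u' w' hB aB hu' hw' ku' kw' hp'
    have p01 := R3 0 1 0 2
    have p02 := R3 0 1 0 3
    have p12 := R3 0 2 0 3
    have q01 := R3 2 3 3 1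
    have q02 := R3 2 3 1 2
    have q12 := R3 3 1 1 2
    have r00 := R3 0 1 2 3
    have r01 := R3 0 1 3 1
    have r02 := R3 0 1 1 2
    have r10 := R3 0 2 2 3
    have r11 := R3 0 2 3 1
    have r12 := R3 0 2 1 2
    have r20 := R3 0 3 2 3
    have r21 := R3 0 3 3 1
    have r22 := R3 0 3 1 2
    have hsymm : ∀ k l, (sdv (R 0 k.succ) + Complex.I • sdv (R (dualPair k).1 (dualPair k).2)) l =
        (sdv (R 0 l.succ) + Complex.I • sdv (R (dualPair l).1 (dualPair l).2)) k := by
      intro k l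
      fin_cases k <;> fin_cases l <;> simp [sdv, dualPair] <;> apply Complex.ext <;> simp <;>
        linarith
    obtain ⟨⟨κ, hκ⟩, hΦ⟩ := cross_rigidity hn hγ hsymm (fun l => (hν l).1) (fun l => (hν' l).1)
      (fun l => (hν l).2) (fun l => (hν' l).2)
    -- The electric block is R_{0k0k} = κ/2, while constant curvature K gives K g_{00} g_{kk} = −K.
    refine ⟨- κ.re / 2, ?_⟩
    have bi := h.riemann_bianchi 0 1 2 3
    change R 2 3 0 1 + R 3 1 0 2 + R 1 2 0 3 = 0 at bi
    have cW : ∀ k l : Fin 3, (R 0 k.succ 0 l.succ - R (dualPair k).1 (dualPair k).2 (dualPair l).1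
        (dualPair l).2 = (if k = l then κ else 0).re ∧ R 0 k.succ (dualPair l).1 (dualPair l).2
        + R (dualPair k).1 (dualPair k).2 0 l.succ = (if k = l then κ else 0).im) ∧
        R 0 k.succ 0 l.succ + R (dualPair k).1 (dualPair k).2 (dualPair l).1 (dualPair l).2 = 0 ∧
        R 0 k.succ (dualPair l).1 (dualPair l).2
        - R (dualPair k).1 (dualPair k).2 0 l.succ = 0 := by
      intro k l
      have e1 := hκ k l
      have e2 := hΦ k l
      simp only [Pi.add_apply, Pi.sub_apply, Pi.smul_apply, sdv_apply, smul_eq_mul] at e1 e2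
      have e1r := congrArg Complex.re e1
      have e1i := congrArg Complex.im e1
      have e2r := congrArg Complex.re e2
      have e2i := congrArg Complex.im e2
      clear e1 e2
      simp at e1r e1i e2r e2i
      exact ⟨⟨by linarith, by linarith⟩, by linarith, by linarith⟩
    -- With the mixed block zero, each diagonal magnetic component equals Im κ / 2, and the first
    -- Bianchi identity says that the three sum to zero.
    have hκi : κ.im = 0 := by
      have e0 := cW 0 0
      have e1 := cW 1 1
      have e2 := cW 2 2
      simp only [if_true] at e0 e1 e2
      change _ ∧ _ ∧ R 0 1 2 3 - R 2 3 0 1 = 0 at e0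
      change _ ∧ _ ∧ R 0 2 3 1 - R 3 1 0 2 = 0 at e1
      change _ ∧ _ ∧ R 0 3 1 2 - R 1 2 0 3 = 0 at e2
      have f0 : R 0 1 2 3 + R 2 3 0 1 = κ.im := e0.1.2
      have f1 : R 0 2 3 1 + R 3 1 0 2 = κ.im := e1.1.2
      have f2 : R 0 3 1 2 + R 1 2 0 3 = κ.im := e2.1.2
      linarith [e0.2.2, e1.2.2, e2.2.2]
    have cR : ∀ k l : Fin 3, (R 0 k.succ 0 l.succ = (if k = l then κ.re / 2 else 0) ∧
        R (dualPair k).1 (dualPair k).2 0 l.succ = 0) ∧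
        (R 0 k.succ (dualPair l).1 (dualPair l).2 = 0 ∧ R (dualPair k).1 (dualPair k).2
        (dualPair l).1 (dualPair l).2 = - (if k = l then κ.re / 2 else 0)) := by
      intro k l
      have := cW k l
      by_cases hkl : k = l
      · simp only [hkl, if_true, hκi] at this ⊢
        exact ⟨⟨by linarith [this.1.1, this.2.1], by linarith [this.1.2, this.2.2]⟩,
          by linarith [this.1.2, this.2.2], by linarith [this.1.1, this.2.1]⟩
      · simp only [hkl, if_false, Complex.zero_re, Complex.zero_im] at this ⊢
        exact ⟨⟨by linarith [this.1.1, this.2.1], by linarith [this.1.2, this.2.2]⟩,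
          by linarith [this.1.2, this.2.2], by linarith [this.1.1, this.2.1]⟩
    -- The deviation from constant curvature is antisymmetric in both pairs, so it need only vanish
    -- on the six coordinate planes.
    set D : Fin 4 → Fin 4 → Fin 4 → Fin 4 → ℝ := fun a b c d =>
      R a b c d - -κ.re / 2 * (G 0 c a * G 0 d b - G 0 c b * G 0 d a) with hD
    have D1 : ∀ a b c d, D a b c d = - D a b d c := fun a b c d => by
      simp only [hD]; rw [R1]; ring
    have D2 : ∀ a b c d, D a b c d = - D b a c d := fun a b c d => by
      simp only [hD]; rw [R2]; ring
    have D0 : ∀ k l : Fin 3, (D 0 k.succ 0 l.succ = 0 ∧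
        D (dualPair k).1 (dualPair k).2 0 l.succ = 0) ∧
        (D 0 k.succ (dualPair l).1 (dualPair l).2 = 0 ∧
        D (dualPair k).1 (dualPair k).2 (dualPair l).1 (dualPair l).2 = 0) := by
      intro k l
      have m1 : G 0 0 0 = -1 := by simp [h.val_apply]
      have m2 : G 0 l.succ k.succ = if k = l then 1 else 0 := by
        rw [h.val_apply]; fin_cases k <;> fin_cases l <;> simp [Fin.ext_iff, sg]
      have m3 : ∀ i : Fin 3, G 0 0 i.succ = 0 ∧ G 0 i.succ 0 = 0 := by
        intro i; rw [h.val_apply, h.val_apply]; fin_cases i <;> simp [Fin.ext_iff]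
      have m4 : ∀ i : Fin 3, (G 0 (dualPair i).1 0 = 0 ∧ G 0 (dualPair i).2 0 = 0) ∧
          G 0 0 (dualPair i).1 = 0 ∧ G 0 0 (dualPair i).2 = 0 := by
        intro i; simp only [h.val_apply]; fin_cases i <;> simp [dualPair]
      have m5 : G 0 (dualPair l).1 (dualPair k).1 * G 0 (dualPair l).2 (dualPair k).2
          - G 0 (dualPair l).1 (dualPair k).2 * G 0 (dualPair l).2 (dualPair k).1 =
          if k = l then 1 else 0 := by
        simp only [h.val_apply]; fin_cases k <;> fin_cases l <;> simp [dualPair]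
      simp only [hD, cR k l, m1, m2, m3, m4, m5]
      refine ⟨⟨?_, by ring⟩, by ring, ?_⟩ <;> split_ifs <;> ring
    intro a b c d
    have D3 : ∀ a b (l : Fin 3), D a b 0 l.succ = 0 ∧ D a b (dualPair l).1 (dualPair l).2 = 0 :=
      fun a b l => ⟨antisymm_zero (X := fun a b => D a b 0 l.succ) (fun a b => D2 a b _ _)
        (fun k => (D0 k l).1) a b, antisymm_zero (X := fun a b => D a b (dualPair l).1 (dualPair l).2)
        (fun a b => D2 a b _ _) (fun k => (D0 k l).2) a b⟩
    have := antisymm_zero (X := D c d) (fun a b => D1 c d a b) (fun l => D3 c d l) a b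
    simp only [hD, hR] at this
    linarith

end Normal

/-- Two independent solutions of the pair equation exist only where the curvature is constant. -/
theorem MetricOn.constCurv_or_combination {U : Set E4} {G : Comp2} (h : MetricOn U G)
    {A B : Comp2} (hA : SmM U A) (hB : SmM U B) (aA : AntisymmOn U A)
    (aB : AntisymmOn U B) {u w u' w' : E4 → E4} (hu : ContDiffOn ℝ ∞ u U)
    (hw : ContDiffOn ℝ ∞ w U) (hu' : ContDiffOn ℝ ∞ u' U) (hw' : ContDiffOn ℝ ∞ w' U) {y : E4}
    (hy : y ∈ U) (ku : KillingEq G u y) (kw : KillingEq G w y) (ku' : KillingEq G u' y)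
    (kw' : KillingEq G w' y) (hp : ∀ x ∈ U, PairEq G A (u x).ofLp (w x).ofLp x)
    (hp' : ∀ x ∈ U, PairEq G B (u' x).ofLp (w' x).ofLp x) (hn : NonNullAt G A y) :
    (∃ K, ConstCurvAt G K y) ∨ ∃ a b : ℝ, B y = a • A y + b • hodge G A y := by
  obtain ⟨φ, V, k, rfl, hN⟩ := h.exists_normal' hy
  have h0 := hN.zero_mem
  rcases hN.constCurv_or_combination (k.pull_smooth hA) (k.pull_smooth hB) (k.antisymmOn aA)
    (k.antisymmOn aB) (k.pullVec_smooth hu) (k.pullVec_smooth hw) (k.pullVec_smooth hu')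
    (k.pullVec_smooth hw') ((k.killingEq_pull h hu h0).2 ku) ((k.killingEq_pull h hw h0).2 kw)
    ((k.killingEq_pull h hu' h0).2 ku') ((k.killingEq_pull h hw' h0).2 kw')
    (fun x hx => (k.pairEq_pull h hA hx u w).2 (hp _ (k.mapsTo hx)))
    (fun x hx => (k.pairEq_pull h hB hx u' w').2 (hp' _ (k.mapsTo hx)))
    ((k.nonNullAt_pull G A h0).2 hn) with ⟨K, hK⟩ | ⟨a, b, hab⟩
  · exact Or.inl ⟨K, (k.constCurvAt_pull h h0 K).1 hK⟩
  · refine Or.inr ⟨a, b, ?_⟩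
    rw [k.hodge_pull G A h0] at hab
    have : pull φ (fun y => B y - (a • A y + b • hodge G A y)) 0 = 0 := by
      have e : pull φ (fun y => B y - (a • A y + b • hodge G A y)) 0 =
          pull φ B 0 - (a • pull φ A 0 + b • pull φ (hodge G A) 0) := by
        simp only [pull, Matrix.mul_sub, Matrix.mul_add, Matrix.mul_smul, Matrix.sub_mul,
          Matrix.add_mul, Matrix.smul_mul]
      rw [e, hab, sub_self]
    exact sub_eq_zero.1 ((k.pull_eq_zero h0).1 this)

/-! ### Proportional solutions: constancy of the coefficients and the two Lie derivatives. -/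

/-- The self-dual part of `pairForm` as a function of the complex vector `u + i w`. -/
def pairVec (ζ : Fin 4 → ℂ) : Fin 4 → Fin 3 → ℂ :=
  ![![ζ 1, ζ 2, ζ 3], ![-ζ 0, Complex.I * ζ 3, -(Complex.I * ζ 2)],
    ![-(Complex.I * ζ 3), -ζ 0, Complex.I * ζ 1], ![Complex.I * ζ 2, -(Complex.I * ζ 1), -ζ 0]]

lemma sdv_pairForm (u w : Fin 4 → ℝ) (a : Fin 4) :
    sdv (pairForm u w a) = pairVec (fun i => u i + Complex.I * w i) a := by
  obtain ⟨q1, q2, q3, q4, q5, q6, q7, q8, q9, q10, q11, q12, q13, q14, q15, q16, q17, q18, q19, q20,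
    q21, q22, q23, q24⟩ := leviCivita_values
  funext k
  fin_cases a <;> fin_cases k <;>
  · simp [sdv, pairForm, pairVec, Fin.sum_univ_four,
      leviCivita_self_12, leviCivita_self_13, leviCivita_self_14, leviCivita_self_23,
      leviCivita_self_24, leviCivita_self_34, q1, q2, q3, q4, q5, q6, q7, q8, q9, q10, q11, q12,
      q13, q14, q15, q16, q17, q18, q19, q20, q21, q22, q23, q24]
    try (apply Complex.ext <;> simp)

/-- The three spatial rows form −ζ₀·1 plus an antisymmetric matrix. The symmetric part of ξ⊗α has
rank at most two, so ζ₀ = 0; its vanishing then kills the spatial ξ, the antisymmetric part the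
spatial ζ, and the row a = 0 the remaining ξ₀. -/
lemma pairVec_rank_one {α : Fin 3 → ℂ} (hα : α ⬝ᵥ α ≠ 0) {ζ ξ : Fin 4 → ℂ}
    (h : ∀ a, pairVec ζ a = ξ a • α) : ζ = 0 ∧ ξ = 0 := by
  have e : ∀ a k, pairVec ζ a k = ξ a * α k := fun a k => by rw [h]; rfl
  have e00 : ζ 1 = _ := e 0 0
  have e01 : ζ 2 = _ := e 0 1
  have e02 : ζ 3 = _ := e 0 2
  have e10 : -ζ 0 = _ := e 1 0
  have e11 : Complex.I * ζ 3 = _ := e 1 1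
  have e12 : -(Complex.I * ζ 2) = _ := e 1 2
  have e20 : -(Complex.I * ζ 3) = _ := e 2 0
  have e21 : -ζ 0 = _ := e 2 1
  have e22 : Complex.I * ζ 1 = _ := e 2 2
  have e30 : Complex.I * ζ 2 = _ := e 3 0
  have e31 : -(Complex.I * ζ 1) = _ := e 3 1
  have e32 : -ζ 0 = _ := e 3 2
  set s := α ⬝ᵥ α with hs
  have hs' : s = α 0 * α 0 + α 1 * α 1 + α 2 * α 2 := by
    rw [hs, dotProduct, Fin.sum_univ_three]
  have z0 : ζ 0 = 0 := by
    have : 2 * ζ 0 * s = 0 := by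
      rw [hs']
      linear_combination (α 0 * α 0 - s) * e10 + (α 1 * α 1 - s) * e21 + (α 2 * α 2 - s) * e32
        + α 0 * α 1 * (e11 + e20) + α 0 * α 2 * (e12 + e30) + α 1 * α 2 * (e22 + e31)
        - (ξ 1 * α 0 + ξ 2 * α 1 + ξ 3 * α 2 + 3 * ζ 0) * hs'
    simpa [hα] using this
  have x1 : ξ 1 = 0 := by
    have : ξ 1 * s = 0 := by
      rw [hs']
      linear_combination - α 0 * e10 - α 1 * (e11 + e20) + α 0 * e21 - α 2 * (e12 + e30) + α 0 * e32
        + α 0 * z0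
    simpa [hα] using this
  have x2 : ξ 2 = 0 := by
    have : ξ 2 * s = 0 := by
      rw [hs']
      linear_combination - α 1 * e21 - α 0 * (e11 + e20) + α 1 * e10 - α 2 * (e22 + e31) + α 1 * e32
        + α 1 * z0
    simpa [hα] using this
  have x3 : ξ 3 = 0 := by
    have : ξ 3 * s = 0 := by
      rw [hs']
      linear_combination - α 2 * e32 - α 0 * (e12 + e30) + α 2 * e10 - α 1 * (e22 + e31) + α 2 * e21
        + α 2 * z0
    simpa [hα] using this
  have z1 : ζ 1 = 0 := by simpa [x2] using e22
  have z2 : ζ 2 = 0 := by simpa [x1] using e12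
  have z3 : ζ 3 = 0 := by simpa [x1] using e11
  have x0 : ξ 0 = 0 := by
    have : ξ 0 * s = 0 := by
      rw [hs']
      linear_combination (- α 0) * e00 - α 1 * e01 - α 2 * e02 + α 0 * z1 + α 1 * z2 + α 2 * z3
    simpa [hα] using this
  constructor <;> funext a <;> fin_cases a <;> assumption

/-- Inserting ζ into the antisymmetric form built from ζ itself gives zero. With ζ = u + iw this
links the derivatives of A along u and w. -/
lemma pairVec_self (ζ : Fin 4 → ℂ) : ∑ d, ζ d • pairVec ζ d = 0 := by
  funext k
  fin_cases k <;> simp [pairVec, Fin.sum_univ_four] <;> ring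

lemma sdv_sum (c : Fin 4 → ℝ) (X : Fin 4 → Fin 4 → Fin 4 → ℝ) :
    sdv (fun a b => ∑ d, c d * X d a b) = ∑ d, (c d : ℂ) • sdv (X d) := by
  funext k
  simp only [sdv_apply, Fin.sum_univ_four, Pi.add_apply, Pi.smul_apply, smul_eq_mul]
  push_cast
  ring

lemma pairForm_combination (u w u' w' : Fin 4 → ℝ) (f g : ℝ) (a b c : Fin 4) :
    pairForm (fun i => u' i - f * u i - g * w i) (fun i => w' i - f * w i + g * u i) a b c =
      pairForm u' w' a b c - f * pairForm u w a b c - g * pairForm w (fun i => - u i) a b c := by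
  simp only [pairForm, Fin.sum_univ_four]
  ring

namespace Normal

variable {V : Set E4} {G : Comp2} (h : Normal V G)
include h

/-- If `f A + g *A` is again conformal Killing-Yano, then `f` and `g` are constant. -/
lemma pairEq_combination {A B : Comp2} (hA : SmM V A) (aA : AntisymmOn V A) {f g : E4 → ℝ}
    (hf : DifferentiableAt ℝ f 0) (hg : DifferentiableAt ℝ g 0)
    (hB : ∀ z ∈ V, B z = f z • A z + g z • hodge G A z) {u w u' w' : Fin 4 → ℝ}
    (hp : PairEq G A u w 0) (hp' : PairEq G B u' w' 0) (hn : NonNullAt G A 0) :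
    ((∀ i, u' i = f 0 * u i + g 0 * w i) ∧ ∀ i, w' i = f 0 * w i - g 0 * u i) ∧
      ∀ a, pd a f 0 = 0 ∧ pd a g 0 = 0 := by
  have a0 := aA 0 h.zero_mem
  rw [h.nonNullAt_iff a0] at hn
  have hH := (h.pairEq_zero' _ _ _).1 (h.pairEq_hodge hA hp)
  rw [h.pairEq_zero'] at hp hp'
  have hdA : ∀ b c, DifferentiableAt ℝ (fun z => A z b c) 0 := fun b c =>
    contDiffOn_diffAt (hA b c) h.isOpen h.zero_mem
  have hdH : ∀ b c, DifferentiableAt ℝ (fun z => hodge G A z b c) 0 := fun b c =>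
    contDiffOn_diffAt (h.hodge_smooth hA b c) h.isOpen h.zero_mem
  -- Subtract f and g times the pair equations of A and *A from that of B. Only df ⊗ A + dg ⊗ *A
  -- survives, a rank-one object in complex form, so `pairVec_rank_one` applies.
  have key : ∀ a b c, pairForm (fun i => u' i - f 0 * u i - g 0 * w i)
      (fun i => w' i - f 0 * w i + g 0 * u i) a b c =
      (3 * pd a f 0) * A 0 b c + (3 * pd a g 0) * hodge G A 0 b c := by
    intro a b c
    have e : pd a (fun z => B z b c) 0 = pd a (fun z => f z * A z b c + g z * hodge G A z b c) 0 :=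
      pd_congr h.isOpen (fun z hz => by rw [hB z hz]; rfl) h.zero_mem a
    rw [pd_add a (hf.fun_mul (hdA b c)) (hg.fun_mul (hdH b c)), pd_mul a hf (hdA b c),
      pd_mul a hg (hdH b c)] at e
    rw [pairForm_combination, ← hp, ← hp', ← hH, e]
    ring
  have hv : ∀ a, pairVec (fun i => ((u' i - f 0 * u i - g 0 * w i : ℝ) : ℂ)
      + Complex.I * ((w' i - f 0 * w i + g 0 * u i : ℝ) : ℂ)) a =
      (3 * (pd a f 0 : ℂ) - 3 * Complex.I * (pd a g 0 : ℂ)) • sdv (A 0) := by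
    intro a
    rw [← sdv_pairForm]
    have : pairForm (fun i => u' i - f 0 * u i - g 0 * w i)
      (fun i => w' i - f 0 * w i + g 0 * u i) a = fun b c => (3 * pd a f 0) * A 0 b c
        + (3 * pd a g 0) * hodge G A 0 b c := by
      funext b c; exact key a b c
    rw [this]
    refine (sdv_add_smul (A 0) (hodge G A 0) _ _).trans ?_
    rw [h.sdv_hodge a0, smul_smul, ← add_smul]
    congr 1
    push_cast
    ring
  obtain ⟨hζ, hξ⟩ := pairVec_rank_one (ξ := fun a => 3 * (pd a f 0 : ℂ)
    - 3 * Complex.I * (pd a g 0 : ℂ)) hn hv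
  refine ⟨⟨fun i => ?_, fun i => ?_⟩, fun a => ?_⟩
  · have := congrArg Complex.re (congrFun hζ i)
    simp at this
    linarith
  · have := congrArg Complex.im (congrFun hζ i)
    simp at this
    linarith
  · have h1 := congrArg Complex.re (congrFun hξ a)
    have h2 := congrArg Complex.im (congrFun hξ a)
    simp at h1 h2
    exact ⟨h1, h2⟩

/-- The Lie derivatives of `A` along the two vectors of its pair are related. -/
lemma lieDeriv_pair {A : Comp2} (hA : SmM V A) (aA : AntisymmOn V A) {u w : E4 → E4}
    (ku : KillingEq G u 0) (kw : KillingEq G w 0) (hp : PairEq G A (u 0).ofLp (w 0).ofLp 0)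
    (hn : NonNullAt G A 0) {f g f' g' : ℝ}
    (hf : lieDeriv u A 0 = f • A 0 + g • hodge G A 0)
    (hf' : lieDeriv w A 0 = f' • A 0 + g' • hodge G A 0) : f' = g ∧ g' = - f := by
  have a0 := aA 0 h.zero_mem
  rw [h.nonNullAt_iff a0] at hn
  rw [h.pairEq_zero'] at hp
  -- L_Z A is ∇_Z A plus a rotation of A by ∇Z. In ℂ³ the rotation is a cross product with α, which
  -- pairing with α removes.
  have main : ∀ (Z : E4 → E4) (f g : ℝ), KillingEq G Z 0 →
      lieDeriv Z A 0 = f • A 0 + g • hodge G A 0 →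
      3 * ((f : ℂ) - Complex.I * g) * (sdv (A 0) ⬝ᵥ sdv (A 0)) =
      (∑ d, (Z 0 d : ℂ) • pairVec (fun i => (u 0 i : ℂ) + Complex.I * (w 0 i : ℂ)) d) ⬝ᵥ
        sdv (A 0) := by
    intro Z f g kZ hZ
    set n : Fin 4 → Fin 4 → ℝ := fun a c => sg c * pd a (fun z => Z z c) 0 with hn
    have an : ∀ a b, n a b = - n b a := fun a b => by
      have := (h.killingEq_iff Z).1 kZ a b
      simp only [hn]; linarith
    have e : (fun b c => (3 * f) * A 0 b c + (3 * g) * hodge G A 0 b c) = fun b c =>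
        1 * (fun b c => ∑ d, Z 0 d * pairForm (u 0).ofLp (w 0).ofLp d b c) b c
        + (-3) * (fun b c => ∑ e, sg e * (n e b * A 0 e c + n e c * A 0 b e)) b c := by
      funext b c
      have hbc : lieDeriv Z A 0 b c = f * A 0 b c + g * hodge G A 0 b c := by rw [hZ]; rfl
      have : (3 * f) * A 0 b c + (3 * g) * hodge G A 0 b c = 3 * lieDeriv Z A 0 b c := by
        rw [hbc]; ring
      rw [this]
      simp only [lieDeriv, ← hp, Finset.mul_sum, ← Finset.sum_add_distrib]
      refine Finset.sum_congr rfl fun d _ => ?_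
      rw [an d b, an d c]
      simp only [hn]
      linear_combination (-3) * (A 0 d c * pd b (fun z => Z z d) 0
        + A 0 b d * pd c (fun z => Z z d) 0) * sg_mul_self d
    have e2 := congrArg sdv e
    rw [sdv_add_smul, sdv_sum, sdv_commutator an a0] at e2
    have e1 := sdv_add_smul (A 0) (hodge G A 0) (3 * f) (3 * g)
    rw [h.sdv_hodge a0, smul_smul, ← add_smul] at e1
    have e3 := congrArg (fun v => v ⬝ᵥ sdv (A 0)) (e1.symm.trans e2)
    simp only [sdv_pairForm, add_dotProduct, smul_dotProduct, smul_eq_mul] at e3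
    rw [dotProduct_comm (sdv (A 0) ⨯₃ sdv n), dot_self_cross] at e3
    push_cast at e3
    linear_combination e3
  have m1 := main u f g ku hf
  have m2 := main w f' g' kw hf'
  have hs : (∑ d, (u 0 d : ℂ) • pairVec (fun i => (u 0 i : ℂ) + Complex.I * (w 0 i : ℂ)) d)
      + Complex.I • (∑ d, (w 0 d : ℂ) • pairVec (fun i => (u 0 i : ℂ) + Complex.I * (w 0 i : ℂ)) d)
      = 0 := by
    rw [Finset.smul_sum, ← Finset.sum_add_distrib,
      ← pairVec_self (fun i => (u 0 i : ℂ) + Complex.I * (w 0 i : ℂ))]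
    exact Finset.sum_congr rfl fun d _ => by rw [smul_smul, ← add_smul]
  have hs' := congrArg (fun v => v ⬝ᵥ sdv (A 0)) hs
  simp only [add_dotProduct, smul_dotProduct, zero_dotProduct, smul_eq_mul] at hs'
  rw [← m1, ← m2] at hs'
  have e : ((f : ℂ) - Complex.I * g + Complex.I * (f' - Complex.I * g')) *
      (sdv (A 0) ⬝ᵥ sdv (A 0)) = 0 := by
    linear_combination (1 / 3) * hs'
  have := (mul_eq_zero.1 e).resolve_right hn
  have h1 := congrArg Complex.re this
  have h2 := congrArg Complex.im this
  simp at h1 h2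
  constructor <;> linarith

end Normal

/-! ### Invariance of A on open sets where the curvature is nowhere constant. -/

lemma AntisymmOn.lieDeriv {U : Set E4} {A : Comp2} (h : AntisymmOn U A) (hU : IsOpen U)
    (Z : E4 → E4) : AntisymmOn U (lieDeriv Z A) := by
  intro y hy a b
  simp only [CKY.lieDeriv, ← Finset.sum_neg_distrib]
  refine Finset.sum_congr rfl fun c _ => ?_
  rw [h.pd hU hy c a b, h y hy c b, h y hy a c]
  ring

lemma CoordMap.pd_eq_zero {V U : Set E4} {φ : E4 → E4} (k : CoordMap V U φ) {x : E4} (hx : x ∈ V)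
    {f : E4 → ℝ} (df : DifferentiableAt ℝ f (φ x)) (hd : ∀ a, pd a (fun z => f (φ z)) x = 0)
    (a : Fin 4) : pd a f (φ x) = 0 := by
  have e : (jac φ x)ᵀ *ᵥ (fun a => pd a f (φ x)) = 0 := by
    funext a
    exact (pd_comp df (k.diffAt hx) a).symm.trans (hd a)
  have := Matrix.eq_zero_of_mulVec_eq_zero (by
    rw [Matrix.det_transpose]; exact (k.det_pos x hx).ne') e
  exact congrFun this a

section Chart

variable {U : Set E4} {G : Comp2} (h : MetricOn U G)
include h

lemma MetricOn.pairing_smooth {S T : Comp2} (hS : SmM U S) (hT : SmM U T) :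
    ContDiffOn ℝ ∞ (pairing G S T) U := by
  have hr : SmM U (raise G T) := by
    have : SmM U fun z => (G z)⁻¹ * T z * ((G z)⁻¹)ᵀ :=
      (h.inv_smooth.mul hT).mul h.inv_smooth.transpose
    exact this.congr fun z _ => raise_eq G T z
  exact contDiffOn_const.mul (ContDiffOn.sum fun a _ => ContDiffOn.sum fun b _ =>
    (hS a b).mul (hr a b))

lemma MetricOn.pairing_hodge_hodge {A : Comp2} (aA : AntisymmOn U A) {y : E4} (hy : y ∈ U) :
    pairing G (hodge G A) A y = pairing G A (hodge G A) y ∧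
      pairing G (hodge G A) (hodge G A) y = - pairing G A A y := by
  obtain ⟨φ, V, k, rfl, hN⟩ := h.exists_normal' hy
  have h0 := hN.zero_mem
  have := hN.pairing_hodge_hodge (k.antisymmOn aA 0 h0)
  rw [pairing_congr (k.hodge_pull G A h0) rfl, pairing_congr rfl (k.hodge_pull G A h0),
    pairing_congr (k.hodge_pull G A h0) (k.hodge_pull G A h0)] at this
  simpa only [k.pairing_pull _ _ _ h0] using this

/-- Solve the linear system given by (B, A) and (B, *A). Because (*A, *A) = −(A, A), its determinant
is −(p² + q²) with p = (A, A), q = (A, *A), nonzero as A is non null; so the pointwise coefficients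
are smooth. -/
lemma MetricOn.smooth_coefficients {A B : Comp2} (hA : SmM U A) (aA : AntisymmOn U A)
    (hB : SmM U B) (hn : ∀ x ∈ U, NonNullAt G A x)
    (hAB : ∀ x ∈ U, ∃ a b : ℝ, B x = a • A x + b • hodge G A x) :
    ∃ f g : E4 → ℝ, ContDiffOn ℝ ∞ f U ∧ ContDiffOn ℝ ∞ g U ∧
      ∀ x ∈ U, B x = f x • A x + g x • hodge G A x := by
  have hH := h.hodge_smooth hA
  set p := pairing G A A with hp
  set q := pairing G A (hodge G A) with hq
  have hpq : ∀ x ∈ U, p x * p x + q x * q x ≠ 0 := by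
    intro x hx h0
    have h1 : p x = 0 := by nlinarith [mul_self_nonneg (p x), mul_self_nonneg (q x)]
    have h2 : q x = 0 := by nlinarith [mul_self_nonneg (p x), mul_self_nonneg (q x)]
    exact (hn x hx).elim (fun H => H h1) (fun H => H h2)
  have sp := h.pairing_smooth hA hA
  have sq := h.pairing_smooth hA hH
  have s1 := h.pairing_smooth hB hA
  have s2 := h.pairing_smooth hB hH
  refine ⟨fun x => (pairing G B A x * p x + pairing G B (hodge G A) x * q x) /
      (p x * p x + q x * q x), fun x => (pairing G B A x * q x - pairing G B (hodge G A) x * p x) /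
      (p x * p x + q x * q x), ((s1.mul sp).add (s2.mul sq)).div ((sp.mul sp).add (sq.mul sq)) hpq,
      ((s1.mul sq).sub (s2.mul sp)).div ((sp.mul sp).add (sq.mul sq)) hpq, fun x hx => ?_⟩
  obtain ⟨a, b, hab⟩ := hAB x hx
  have hlin : ∀ T : Comp2, pairing G B T x = a * pairing G A T x + b * pairing G (hodge G A) T x := by
    intro T
    have : ∀ i j, B x i j = a * A x i j + b * hodge G A x i j := fun i j => by rw [hab]; rfl
    simp only [pairing, this, add_mul, Finset.sum_add_distrib, mul_add, Finset.mul_sum]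
    congr 1 <;> exact Finset.sum_congr rfl fun i _ => Finset.sum_congr rfl fun j _ => by ring
  have hh := h.pairing_hodge_hodge aA hx
  have e1 : (pairing G B A x * p x + pairing G B (hodge G A) x * q x) /
      (p x * p x + q x * q x) = a := by
    rw [div_eq_iff (hpq x hx), hlin, hlin, hh.1, hh.2]; ring
  have e2 : (pairing G B A x * q x - pairing G B (hodge G A) x * p x) /
      (p x * p x + q x * q x) = b := by
    rw [div_eq_iff (hpq x hx), hlin, hlin, hh.1, hh.2]; ring
  simp only [e1, e2, hab]

/-- If `f A + g *A` is again conformal Killing-Yano, then `f` and `g` are constant. -/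
theorem MetricOn.pairEq_combination {A B : Comp2} (hA : SmM U A) (hB : SmM U B)
    (aA : AntisymmOn U A) {f g : E4 → ℝ} (hf : ContDiffOn ℝ ∞ f U) (hg : ContDiffOn ℝ ∞ g U)
    (hAB : ∀ z ∈ U, B z = f z • A z + g z • hodge G A z) {u w u' w' : E4} {y : E4} (hy : y ∈ U)
    (hp : PairEq G A u.ofLp w.ofLp y) (hp' : PairEq G B u'.ofLp w'.ofLp y)
    (hn : NonNullAt G A y) :
    u' = f y • u + g y • w ∧ ∀ a, pd a f y = 0 ∧ pd a g y = 0 := by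
  obtain ⟨φ, V, k, rfl, hN⟩ := h.exists_normal' hy
  have h0 := hN.zero_mem
  have df := contDiffOn_diffAt hf h.isOpen hy
  have dg := contDiffOn_diffAt hg h.isOpen hy
  have hAB' : ∀ z ∈ V, pull φ B z = f (φ z) • pull φ A z
      + g (φ z) • hodge (pull φ G) (pull φ A) z := by
    intro z hz
    rw [k.hodge_pull G A hz, pull, hAB _ (k.mapsTo hz)]
    simp only [pull, Matrix.mul_add, Matrix.mul_smul, Matrix.add_mul, Matrix.smul_mul]
  obtain ⟨⟨hu, -⟩, hd⟩ := hN.pairEq_combination (k.pull_smooth hA) (k.antisymmOn aA)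
    (DifferentiableAt.comp (0 : E4) df (k.diffAt h0)) (dg.comp (0 : E4) (k.diffAt h0)) hAB'
    ((k.pairEq_pull h hA h0 (fun _ => u) (fun _ => w)).2 hp)
    ((k.pairEq_pull h hB h0 (fun _ => u') (fun _ => w')).2 hp') ((k.nonNullAt_pull G A h0).2 hn)
  refine ⟨?_, fun a => ⟨k.pd_eq_zero h0 df (fun a => (hd a).1) a,
    k.pd_eq_zero h0 dg (fun a => (hd a).2) a⟩⟩
  have e : pullVec φ (fun _ => u') 0 =
      f (φ 0) • pullVec φ (fun _ => u) 0 + g (φ 0) • pullVec φ (fun _ => w) 0 := by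
    ext i; exact hu i
  have e' := congrArg (fun v : E4 => jac φ 0 *ᵥ v.ofLp) e
  simp only [WithLp.ofLp_add, WithLp.ofLp_smul, Matrix.mulVec_add, Matrix.mulVec_smul,
    k.jac_mulVec_pullVec _ h0] at e'
  ext i
  exact congrFun e' i

theorem MetricOn.lieDeriv_pair {A : Comp2} (hA : SmM U A) (aA : AntisymmOn U A) {u w : E4 → E4}
    (hu : ContDiffOn ℝ ∞ u U) (hw : ContDiffOn ℝ ∞ w U) {y : E4} (hy : y ∈ U)
    (ku : KillingEq G u y) (kw : KillingEq G w y) (hp : PairEq G A (u y).ofLp (w y).ofLp y)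
    (hn : NonNullAt G A y) {f g f' g' : ℝ} (hf : lieDeriv u A y = f • A y + g • hodge G A y)
    (hf' : lieDeriv w A y = f' • A y + g' • hodge G A y) : f' = g ∧ g' = - f := by
  obtain ⟨φ, V, k, rfl, hN⟩ := h.exists_normal' hy
  have h0 := hN.zero_mem
  have hl : ∀ (Z : E4 → E4) (f g : ℝ), ContDiffOn ℝ ∞ Z U →
      lieDeriv Z A (φ 0) = f • A (φ 0) + g • hodge G A (φ 0) → lieDeriv (pullVec φ Z) (pull φ A) 0 =
        f • pull φ A 0 + g • hodge (pull φ G) (pull φ A) 0 := by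
    intro Z f g hZ e
    rw [k.hodge_pull G A h0, k.lieDeriv_pull hZ hA h0, pull, e]
    simp only [pull, Matrix.mul_add, Matrix.mul_smul, Matrix.add_mul, Matrix.smul_mul]
  exact hN.lieDeriv_pair (k.pull_smooth hA) (k.antisymmOn aA) ((k.killingEq_pull h hu h0).2 ku)
    ((k.killingEq_pull h hw h0).2 kw) ((k.pairEq_pull h hA h0 u w).2 hp)
    ((k.nonNullAt_pull G A h0).2 hn) (hl u f g hu hf) (hl w f' g' hw hf')

/-- Where the curvature is not constant, `A` is invariant under both vectors of its pair. -/
theorem MetricOn.lieDeriv_eq_zero {A : Comp2} (hA : SmM U A) (aA : AntisymmOn U A) {u w : E4 → E4}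
    (hu : ContDiffOn ℝ ∞ u U) (hw : ContDiffOn ℝ ∞ w U) (ku : ∀ x ∈ U, KillingEq G u x)
    (kw : ∀ x ∈ U, KillingEq G w x) (hp : ∀ x ∈ U, PairEq G A (u x).ofLp (w x).ofLp x)
    (hn : ∀ x ∈ U, NonNullAt G A x) (hc : ∀ x ∈ U, ¬ ∃ K, ConstCurvAt G K x) {y : E4}
    (hy : y ∈ U) : lieDeriv u A y = 0 ∧ lieDeriv w A y = 0 := by
  have hU := h.isOpen
  have comb : ∀ Z : E4 → E4, ContDiffOn ℝ ∞ Z U → (∀ x ∈ U, KillingEq G Z x) → ∀ x ∈ U,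
      ∃ a b : ℝ, lieDeriv Z A x = a • A x + b • hodge G A x := by
    intro Z hZ kZ x hx
    exact (h.constCurv_or_combination hA (smM_lieDeriv hU hZ hA) aA (aA.lieDeriv hU Z) hu hw
      (contDiffOn_lieBracket hU hZ hu) (contDiffOn_lieBracket hU hZ hw) hx (ku x hx) (kw x hx)
      (h.killingEq_lieBracket hZ hu kZ ku hx) (h.killingEq_lieBracket hZ hw kZ kw hx) hp
      (fun x hx => h.pairEq_lieDeriv hA hZ hu hw kZ hp hx) (hn x hx)).resolve_left (hc x hx)
  obtain ⟨f, g, hf, hg, hfg⟩ := h.smooth_coefficients hA aA (smM_lieDeriv hU hu hA) hn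
    (comb u hu ku)
  obtain ⟨f', g', hfg'⟩ := comb w hw kw y hy
  have hc := fun x hx => h.pairEq_combination hA (smM_lieDeriv hU hu hA) aA hf hg hfg hx (hp x hx)
    (h.pairEq_lieDeriv hA hu hu hw ku hp hx) (hn x hx)
  -- The left-hand side is [u, u].
  have hz : ∀ x ∈ U, f x • u x + g x • w x = 0 := fun x hx => by
    rw [← (hc x hx).1, VectorField.lieBracket_self]; rfl
  have du := contDiffOn_diffAt hu hU hy
  have dw := contDiffOn_diffAt hw hU hy
  have hX := lieDeriv_smul_vec A du dw (f y) (g y)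
  -- Freezing f and g at y changes the vanishing field fu + gw only to second order, since df = dg =
  -- 0 at y. Its 1-jet at y is therefore zero.
  have hX0 : lieDeriv (fun z => f y • u z + g y • w z) A y = 0 := by
    have hj : ∀ a i, pd a (fun z => (f y • u z + g y • w z) i) y = 0 := by
      intro a i
      have dui := contDiffOn_diffAt (contDiffOn_coord hu i) hU hy
      have dwi := contDiffOn_diffAt (contDiffOn_coord hw i) hU hy
      have df := contDiffOn_diffAt hf hU hy
      have dg := contDiffOn_diffAt hg hU hy
      have e1 : pd a (fun z => f z * u z i + g z * w z i) y = pd a (fun _ => (0 : ℝ)) y :=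
        pd_congr hU (fun z hz' => congrArg (fun v : E4 => v i) (hz z hz')) hy a
      rw [pd_add a (df.fun_mul dui) (dg.fun_mul dwi), pd_mul a df dui, pd_mul a dg dwi,
        ((hc y hy).2 a).1, ((hc y hy).2 a).2] at e1
      change pd a (fun z => f y * u z i + g y * w z i) y = 0
      rw [pd_add a (dui.const_mul _) (dwi.const_mul _), pd_const_mul a _ dui,
        pd_const_mul a _ dwi]
      have e0 : pd a (fun _ : E4 => (0 : ℝ)) y = 0 := by simp [pd]
      linarith
    ext a b
    simp only [lieDeriv, hj, hz y hy]
    simp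
  obtain ⟨h1, h2⟩ := h.lieDeriv_pair hA aA hu hw hy (ku y hy) (kw y hy) (hp y hy) (hn y hy)
    (hfg y hy) hfg'
  have hA0 : A y ≠ 0 := by
    intro h0
    have : ∀ T, pairing G A T y = 0 := fun T => by simp [pairing, h0]
    exact (hn y hy).elim (fun H => H (this _)) (fun H => H (this _))
  -- Substitute L_u A = fA + g*A and L_w A = gA − f*A; the *A terms cancel.
  have hs : (f y * f y + g y * g y) • A y = 0 := by
    rw [← hX0, hX, hfg y hy, hfg', h1, h2]
    module
  have hs' := (smul_eq_zero.1 hs).resolve_right hA0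
  have f0 : f y = 0 := by nlinarith [mul_self_nonneg (f y), mul_self_nonneg (g y)]
  have g0 : g y = 0 := by nlinarith [mul_self_nonneg (f y), mul_self_nonneg (g y)]
  rw [hfg y hy, hfg', h1, h2, f0, g0]
  simp

end Chart

/-! ### Unique continuation for closed linear first-order systems -/

/-- `f` is a combination of the functions `F j` with continuous coefficients. -/
def InSpan {ι : Type*} [Fintype ι] (U : Set E4) (F : ι → E4 → ℝ) (f : E4 → ℝ) : Prop :=
  ∃ c : ι → E4 → ℝ, (∀ j, ContinuousOn (c j) U) ∧ ∀ x ∈ U, f x = ∑ j, c j x * F j x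

namespace InSpan

variable {ι : Type*} [Fintype ι] {U : Set E4} {F : ι → E4 → ℝ} {f g : E4 → ℝ}

lemma basic (j : ι) : InSpan U F (F j) := by
  classical
  refine ⟨fun i _ => if i = j then 1 else 0, fun i => continuousOn_const, fun x _ => ?_⟩
  simp

lemma add (hf : InSpan U F f) (hg : InSpan U F g) : InSpan U F (fun x => f x + g x) := by
  obtain ⟨c, hc, ec⟩ := hf
  obtain ⟨d, hd, ed⟩ := hg
  refine ⟨fun j x => c j x + d j x, fun j => (hc j).add (hd j), fun x hx => ?_⟩
  beta_reduce
  rw [ec x hx, ed x hx, ← Finset.sum_add_distrib]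
  exact Finset.sum_congr rfl fun j _ => by ring

lemma mul (hf : InSpan U F f) (hg : ContinuousOn g U) : InSpan U F (fun x => g x * f x) := by
  obtain ⟨c, hc, ec⟩ := hf
  refine ⟨fun j x => g x * c j x, fun j => hg.mul (hc j), fun x hx => ?_⟩
  beta_reduce
  rw [ec x hx, Finset.mul_sum]
  exact Finset.sum_congr rfl fun j _ => by ring

lemma mul_right (hf : InSpan U F f) (hg : ContinuousOn g U) : InSpan U F (fun x => f x * g x) := by
  simpa only [mul_comm] using hf.mul hg

lemma neg (hf : InSpan U F f) : InSpan U F (fun x => - f x) := by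
  simpa using hf.mul (g := fun _ => -1) continuousOn_const

lemma sub (hf : InSpan U F f) (hg : InSpan U F g) : InSpan U F (fun x => f x - g x) := by
  simpa [sub_eq_add_neg] using hf.add hg.neg

lemma sum {κ : Type*} {s : Finset κ} {h : κ → E4 → ℝ} (hh : ∀ i ∈ s, InSpan U F (h i)) :
    InSpan U F (fun x => ∑ i ∈ s, h i x) := by
  classical
  induction s using Finset.induction_on with
  | empty => exact ⟨fun _ _ => 0, fun _ => continuousOn_const, fun x _ => by simp⟩
  | insert a s ha ih =>
    simp only [Finset.sum_insert ha]
    exact (hh a (Finset.mem_insert_self _ _)).add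
      (ih fun i hi => hh i (Finset.mem_insert_of_mem hi))

lemma congr (hf : InSpan U F f) (h : ∀ x ∈ U, g x = f x) : InSpan U F g := by
  obtain ⟨c, hc, ec⟩ := hf
  exact ⟨c, hc, fun x hx => (h x hx).trans (ec x hx)⟩

end InSpan

/-- A solution of a closed linear first-order system vanishing at a point vanishes on every convex
set around the point. -/
lemma eq_zero_of_inSpan {ι : Type*} [Fintype ι] {U S : Set E4} {F : ι → E4 → ℝ}
    (hS : Convex ℝ S) (hSU : S ⊆ U) (hF : ∀ j, ∀ x ∈ U, DifferentiableAt ℝ (F j) x)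
    (h : ∀ a j, InSpan U F (pd a (F j))) {y : E4} (hy : y ∈ S) (h0 : ∀ j, F j y = 0) {x : E4}
    (hx : x ∈ S) (j : ι) : F j x = 0 := by
  choose c hc ec using h
  set v : E4 := x - y with hv
  set γ : ℝ → E4 := fun t => y + t • v with hγ
  have hmem : ∀ t ∈ Set.Icc (0 : ℝ) 1, γ t ∈ U := fun t ht =>
    hSU (hS.add_smul_sub_mem hy hx ht)
  have hγd : ∀ t, HasDerivAt γ v t := fun t => by
    have := ((hasDerivAt_id t).smul_const v).const_add y
    rwa [one_smul] at this
  set f : ℝ → ι → ℝ := fun t j => F j (γ t) with hf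
  set f' : ℝ → ι → ℝ := fun t j => ∑ a, v a * pd a (F j) (γ t) with hf'
  have hd : ∀ t ∈ Set.Icc (0 : ℝ) 1, HasDerivAt f (f' t) t := by
    intro t ht
    refine hasDerivAt_pi.2 fun j => ?_
    have := (hF j _ (hmem t ht)).hasFDerivAt.comp_hasDerivAt t (hγd t)
    rw [fderiv_eq_sum_pd] at this
    exact this
  have hγc : ContinuousOn γ (Set.Icc 0 1) := fun t _ => (hγd t).continuousAt.continuousWithinAt
  -- On the segment from y to x the system is a linear ODE. Summing over all j dominates every row
  -- of its matrix in the sup norm, and the resulting bound on a compact interval feeds Grönwall's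
  -- inequality.
  have hcont : ContinuousOn (fun t => ∑ j, ∑ a, |v a| * ∑ i, |c a j i (γ t)|) (Set.Icc 0 1) :=
    continuousOn_finsetSum _ fun j _ => continuousOn_finsetSum _ fun a _ =>
      continuousOn_const.mul (continuousOn_finsetSum _ fun i _ =>
        ((hc a j i).comp hγc hmem).abs)
  obtain ⟨K, hK⟩ := isCompact_Icc.exists_bound_of_continuousOn hcont
  have bound : ∀ t ∈ Set.Ico (0 : ℝ) 1, ‖f' t‖ ≤ K * ‖f t‖ := by
    intro t ht
    have ht' := Set.Ico_subset_Icc_self ht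
    have hKt := hK t ht'
    have hle : ∑ j, ∑ a, |v a| * ∑ i, |c a j i (γ t)| ≤ K := (le_abs_self _).trans hKt
    have hnn : ∀ j, 0 ≤ ∑ a, |v a| * ∑ i, |c a j i (γ t)| := fun j => by positivity
    have hK0 : 0 ≤ K := (norm_nonneg _).trans hKt
    refine (pi_norm_le_iff_of_nonneg (by positivity)).2 fun j => ?_
    calc ‖f' t j‖ ≤ ∑ a, |v a| * ∑ i, |c a j i (γ t)| * ‖f t‖ := by
          simp only [hf', Real.norm_eq_abs]
          refine (Finset.abs_sum_le_sum_abs _ _).trans (Finset.sum_le_sum fun a _ => ?_)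
          rw [abs_mul, ec a j _ (hmem t ht')]
          refine mul_le_mul_of_nonneg_left ?_ (abs_nonneg _)
          refine (Finset.abs_sum_le_sum_abs _ _).trans (Finset.sum_le_sum fun i _ => ?_)
          rw [abs_mul]
          exact mul_le_mul_of_nonneg_left (norm_le_pi_norm (f t) i) (abs_nonneg _)
      _ = (∑ a, |v a| * ∑ i, |c a j i (γ t)|) * ‖f t‖ := by
          rw [Finset.sum_mul]
          exact Finset.sum_congr rfl fun a _ => by rw [← Finset.sum_mul, mul_assoc]
      _ ≤ K * ‖f t‖ := by
          refine mul_le_mul_of_nonneg_right ?_ (norm_nonneg _)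
          exact (Finset.single_le_sum (f := fun j => ∑ a, |v a| * ∑ i, |c a j i (γ t)|)
            (fun j _ => hnn j) (Finset.mem_univ j)).trans hle
  have := eq_zero_of_abs_deriv_le_mul_abs_self_of_eq_zero_right (a := 0) (b := 1) (f := f) (f' := f')
    (fun t ht => (hd t ht).continuousAt.continuousWithinAt)
    (fun t ht => (hd t (Set.Ico_subset_Icc_self ht)).hasDerivWithinAt)
    (by funext j; simp [hf, hγ, h0]) bound 1 (by simp)
  have e := congrFun this j
  simpa [hf, hγ, hv] using e

/-- Compared with another pair of the same tensor, this forces that pair to vanish, the pair being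
unique. -/
lemma pairEq_of_eq_zero (G : Comp2) {B : Comp2} {T : Set E4} (hT : IsOpen T)
    (hB : ∀ x ∈ T, B x = 0) {z : E4} (hz : z ∈ T) : PairEq G B 0 0 z := by
  have hdB : ∀ a b c, pd a (fun x => B x b c) z = 0 := by
    intro a b c
    have : pd a (fun x => B x b c) z = pd a (fun _ => (0 : ℝ)) z :=
      pd_congr hT (fun x hx => by rw [hB x hx]; rfl) hz a
    rw [this]; simp [pd]
  intro a b c
  simp [covDeriv, hdB, hB z hz]

section Chart

variable {U : Set E4} {G : Comp2} (h : MetricOn U G)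
include h

/-- The second derivatives of a Killing vector are determined by the vector and its first
derivatives. -/
lemma MetricOn.killing_pd_pd {Z : E4 → E4} (hZ : ContDiffOn ℝ ∞ Z U)
    (kZ : ∀ x ∈ U, KillingEq G Z x) (L : Fin 4 → Fin 4 → Fin 4 → E4 → ℝ)
    (hL : ∀ e b c x, L e b c x = ∑ d, (Z x d * pd e (pd d fun z => G z b c) x
      + pd d (fun z => G z b c) x * pd e (fun z => Z z d) x
      + pd b (fun z => Z z d) x * pd e (fun z => G z d c) x
      + pd c (fun z => Z z d) x * pd e (fun z => G z b d) x)) {x : E4} (hx : x ∈ U) (e b i : Fin 4) :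
    pd e (pd b fun z => Z z i) x =
      ∑ c, (G x)⁻¹ i c * ((-1 / 2) * (L e b c x + L b e c x - L c e b x)) := by
  -- H is the Hessian of Z with its index lowered. It is symmetric in e, b, and the differentiated
  -- Killing equation fixes its symmetrisation in c, b; the Koszul combination solves for it.
  set H : Fin 4 → Fin 4 → Fin 4 → ℝ := fun c e b => ∑ d, G x c d * pd e (pd b fun z => Z z d) x with hH
  have hsym : ∀ c e b, H c e b = H c b e := fun c e b => Finset.sum_congr rfl fun d _ => by
    rw [pd_comm (contDiffOn_coord hZ d) h.isOpen hx e b]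
  have key : ∀ e b c, H c e b + H b e c = - L e b c x := by
    intro e b c
    have h1 : pd e (fun z => lieDeriv Z G z b c) x = pd e (fun _ => (0 : ℝ)) x :=
      pd_congr h.isOpen (fun z hz => by rw [kZ z hz]; rfl) hx e
    have h2 : pd e (fun _ : E4 => (0 : ℝ)) x = 0 := by simp [pd]
    rw [pd_lieDeriv h.isOpen h.smooth hZ hx, h2] at h1
    have h3 : H c e b + H b e c + L e b c x = 0 := by
      rw [← h1, hL]
      simp only [hH, ← Finset.sum_add_distrib]
      refine Finset.sum_congr rfl fun d _ => ?_
      rw [h.symm_apply hx c d]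
      ring
    linarith
  have hHL : ∀ c, H c e b = (-1 / 2) * (L e b c x + L b e c x - L c e b x) := fun c => by
    have k1 := key e b c
    have k2 := key b e c
    have k3 := key c e b
    have s1 := hsym c e b
    have s2 := hsym e b c
    have s3 := hsym b e c
    linarith
  simp only [← hHL]
  have e1 : (G x)⁻¹ *ᵥ (G x *ᵥ fun d => pd e (pd b fun z => Z z d) x) =
      fun d => pd e (pd b fun z => Z z d) x := by
    rw [Matrix.mulVec_mulVec, Matrix.nonsing_inv_mul _ (h.isUnit hx), Matrix.one_mulVec]
  exact (congrFun e1 i).symm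

/-- A Killing vector with vanishing 1-jet at a point vanishes. -/
lemma MetricOn.killing_eq_zero {S : Set E4} (hS : Convex ℝ S) (hSU : S ⊆ U) {Z : E4 → E4}
    (hZ : ContDiffOn ℝ ∞ Z U) (kZ : ∀ x ∈ U, KillingEq G Z x) {y : E4} (hy : y ∈ S)
    (h0 : Z y = 0) (h1 : ∀ a i, pd a (fun z => Z z i) y = 0) {x : E4} (hx : x ∈ S) : Z x = 0 := by
  set F : Fin 4 ⊕ Fin 4 × Fin 4 → E4 → ℝ := Sum.elim (fun i x => Z x i)
    (fun p => pd p.1 (fun z => Z z p.2)) with hF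
  have b0 : ∀ i, InSpan U F (fun x => Z x i) := fun i => InSpan.basic (F := F) (Sum.inl i)
  have b1 : ∀ a i, InSpan U F (pd a (fun z => Z z i)) := fun a i =>
    InSpan.basic (F := F) (Sum.inr (a, i))
  have cG : ∀ a b c, ContinuousOn (pd c (fun z => G z a b)) U := fun a b c =>
    (contDiffOn_pd (h.smooth a b) h.isOpen c).continuousOn
  have cG' : ∀ a b c d, ContinuousOn (pd d (pd c (fun z => G z a b))) U := fun a b c d =>
    (contDiffOn_pd (contDiffOn_pd (h.smooth a b) h.isOpen c) h.isOpen d).continuousOn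
  have cI : ∀ a b, ContinuousOn (fun z => (G z)⁻¹ a b) U := fun a b =>
    (h.inv_smooth a b).continuousOn
  have hL : ∀ e b c, InSpan U F (fun x => ∑ d, (Z x d * pd e (pd d fun z => G z b c) x
      + pd d (fun z => G z b c) x * pd e (fun z => Z z d) x
      + pd b (fun z => Z z d) x * pd e (fun z => G z d c) x
      + pd c (fun z => Z z d) x * pd e (fun z => G z b d) x)) := fun e b c =>
    InSpan.sum fun d _ => ((((b0 d).mul_right (cG' b c d e)).add ((b1 e d).mul (cG b c d))).add
      ((b1 b d).mul_right (cG d c e))).add ((b1 c d).mul_right (cG b d e))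
  ext i
  refine eq_zero_of_inSpan (F := F) hS hSU ?_ ?_ hy ?_ hx (Sum.inl i)
  · rintro (i | ⟨a, i⟩) x hx
    · exact contDiffOn_diffAt (contDiffOn_coord hZ i) h.isOpen hx
    · exact contDiffOn_diffAt (contDiffOn_pd (contDiffOn_coord hZ i) h.isOpen a) h.isOpen hx
  · rintro e (i | ⟨a, i⟩)
    · exact b1 e i
    · refine InSpan.congr ?_ fun x hx =>
        h.killing_pd_pd hZ kZ _ (fun _ _ _ _ => rfl) hx e a i
      exact InSpan.sum fun c _ => InSpan.mul (InSpan.mul (((hL e a c).add (hL a e c)).sub (hL c e a))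
        continuousOn_const) (cI i c)
  · rintro (i | ⟨a, i⟩)
    · simp [hF, h0]
    · exact h1 a i

/-- A zero pair means ∇B = 0, a closed first-order system for the components. -/
lemma MetricOn.parallel_eq_zero {S : Set E4} (hS : Convex ℝ S) (hSU : S ⊆ U) (hSo : IsOpen S)
    {B : Comp2} (hB : SmM U B) (hp : ∀ x ∈ S, PairEq G B 0 0 x) {y : E4} (hy : y ∈ S)
    (h0 : B y = 0) {x : E4} (hx : x ∈ S) : B x = 0 := by
  set F : Fin 4 × Fin 4 → E4 → ℝ := fun p x => B x p.1 p.2 with hF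
  have b0 : ∀ i j, InSpan S F (fun x => B x i j) := fun i j => InSpan.basic (F := F) (i, j)
  have cΓ : ∀ a b c, ContinuousOn (christoffel G a b c) S := fun a b c =>
    ((h.christoffel_smooth a b c).continuousOn).mono hSU
  ext i j
  refine eq_zero_of_inSpan (U := S) (F := F) hS subset_rfl ?_ ?_ hy ?_ hx (i, j)
  · rintro ⟨i, j⟩ x hx
    exact contDiffOn_diffAt (hB i j) h.isOpen (hSU hx)
  · rintro a ⟨b, c⟩
    refine InSpan.congr (f := fun x => ∑ d, (christoffel G d a b x * B x d c
      + christoffel G d a c x * B x b d)) ?_ fun x hx => ?_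
    · exact InSpan.sum fun d _ => ((b0 d c).mul (cΓ d a b)).add ((b0 b d).mul (cΓ d a c))
    · have := hp x hx a b c
      simp only [Matrix.mulVec_zero, covDeriv] at this
      simp at this
      simp only [hF]
      linarith
  · rintro ⟨i, j⟩
    simp [hF, h0]

/-- Unique continuation for the Lie derivative along a Killing vector of a conformal Killing-Yano
tensor. -/
theorem MetricOn.lieDeriv_unique_continuation {A : Comp2} (hA : SmM U A) (aA : AntisymmOn U A)
    {Z u w : E4 → E4} (hZ : ContDiffOn ℝ ∞ Z U) (hu : ContDiffOn ℝ ∞ u U)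
    (hw : ContDiffOn ℝ ∞ w U) (kZ : ∀ x ∈ U, KillingEq G Z x) (ku : ∀ x ∈ U, KillingEq G u x)
    (kw : ∀ x ∈ U, KillingEq G w x) (hp : ∀ x ∈ U, PairEq G A (u x).ofLp (w x).ofLp x)
    {S : Set E4} (hS : Convex ℝ S) (hSU : S ⊆ U) (hSo : IsOpen S) {y : E4} (hy : y ∈ S)
    (h0 : ∀ᶠ x in nhds y, lieDeriv Z A x = 0) {x : E4} (hx : x ∈ S) : lieDeriv Z A x = 0 := by
  have hU := h.isOpen
  have hB := smM_lieDeriv hU hZ hA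
  have aB := aA.lieDeriv hU Z
  have hpB := fun x hx => h.pairEq_lieDeriv hA hZ hu hw kZ hp (y := x) hx
  have su := contDiffOn_lieBracket hU hZ hu
  have sw := contDiffOn_lieBracket hU hZ hw
  obtain ⟨T, hT, hTo, hyT⟩ := eventually_nhds_iff.1 h0
  set T' := T ∩ U
  have hT'o : IsOpen T' := hTo.inter hU
  have hyT' : y ∈ T' := ⟨hyT, hSU hy⟩
  have hp0 : ∀ z ∈ T', PairEq G (lieDeriv Z A) 0 0 z := fun z hz =>
    pairEq_of_eq_zero G hTo hT hz.1
  have hz1 : ∀ z ∈ T', VectorField.lieBracket ℝ Z u z = 0 := fun z hz => by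
    ext i
    have e1 := h.codiffVec_of_pairEq hB aB hz.2 (hpB z hz.2)
    rw [h.codiffVec_of_pairEq hB aB hz.2 (hp0 z hz)] at e1
    exact (congrFun e1 i).symm
  have hz2 : ∀ z ∈ T', VectorField.lieBracket ℝ Z w z = 0 := fun z hz => by
    ext i
    have e1 := h.codiffVec_hodge_of_pairEq hB hz.2 (hpB z hz.2)
    rw [h.codiffVec_hodge_of_pairEq hB hz.2 (hp0 z hz)] at e1
    exact (congrFun e1 i).symm
  have hjet : ∀ W : E4 → E4, (∀ z ∈ T', W z = 0) → ∀ a i, pd a (fun z => W z i) y = 0 := by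
    intro W hW a i
    have : pd a (fun x => W x i) y = pd a (fun _ => (0 : ℝ)) y :=
      pd_congr hT'o (fun x hx => by rw [hW x hx]; rfl) hyT' a
    rw [this]; simp [pd]
  -- The brackets [Z, u] and [Z, w] are Killing and vanish near y, hence on S. The pair of L_Z A is
  -- then zero and this tensor is parallel on S.
  have hu0 := fun x hx => h.killing_eq_zero hS hSU su
    (fun x hx => h.killingEq_lieBracket hZ hu kZ ku hx) hy (hz1 y hyT') (hjet _ hz1) (x := x) hx
  have hw0 := fun x hx => h.killing_eq_zero hS hSU sw
    (fun x hx => h.killingEq_lieBracket hZ hw kZ kw hx) hy (hz2 y hyT') (hjet _ hz2) (x := x) hx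
  refine h.parallel_eq_zero hS hSU hSo hB (fun x hx => ?_) hy (hT y hyT) hx
  have := hpB x (hSU hx)
  rw [hu0 x hx, hw0 x hx] at this
  exact this

end Chart

/-! ### Schur's lemma -/

/-- One twelfth of the scalar curvature. -/
def curvConst (G : Comp2) (y : E4) : ℝ := (1 / 12) * ∑ a, ∑ b, (G y)⁻¹ a b * ricci G y a b

section Chart

variable {U : Set E4} {G : Comp2} (h : MetricOn U G)
include h

lemma MetricOn.riemannUp_smooth (a b c d : Fin 4) : ContDiffOn ℝ ∞ (riemannUp G a b c d) U :=
  ((contDiffOn_pd (h.christoffel_smooth a b d) h.isOpen c).sub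
    (contDiffOn_pd (h.christoffel_smooth a b c) h.isOpen d)).add
    (ContDiffOn.sum fun e _ => ((h.christoffel_smooth e b d).mul (h.christoffel_smooth a e c)).sub
      ((h.christoffel_smooth e b c).mul (h.christoffel_smooth a e d)))

lemma MetricOn.riemann_smooth (a b c d : Fin 4) : ContDiffOn ℝ ∞ (riemann G a b c d) U :=
  ContDiffOn.sum fun e _ => (h.smooth a e).mul (h.riemannUp_smooth e b c d)

lemma MetricOn.curvConst_smooth : ContDiffOn ℝ ∞ (curvConst G) U :=
  contDiffOn_const.mul (ContDiffOn.sum fun a _ => ContDiffOn.sum fun b _ =>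
    (h.inv_smooth a b).mul (ContDiffOn.sum fun c _ => h.riemannUp_smooth c a c b))

lemma MetricOn.riemannUp_of_constCurvAt {K : ℝ} {y : E4} (hy : y ∈ U) (hK : ConstCurvAt G K y)
    (a b c d : Fin 4) : riemannUp G a b c d y =
      K * ((if a = c then 1 else 0) * G y b d - (if a = d then 1 else 0) * G y b c) := by
  have e1 : (G y)⁻¹ *ᵥ (G y *ᵥ fun e => riemannUp G e b c d y) = fun e => riemannUp G e b c d y := by
    rw [Matrix.mulVec_mulVec, Matrix.nonsing_inv_mul _ (h.isUnit hy), Matrix.one_mulVec]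
  have e2 : (G y *ᵥ fun e => riemannUp G e b c d y) =
      fun i => K * (G y i c * G y b d - G y i d * G y b c) := by
    funext i; exact hK i b c d
  have hi : ∀ c, ∑ i, (G y)⁻¹ a i * G y i c = if a = c then 1 else 0 := fun c => by
    have := congrFun (congrFun (Matrix.nonsing_inv_mul _ (h.isUnit hy)) a) c
    rwa [Matrix.mul_apply, Matrix.one_apply] at this
  rw [e2] at e1
  rw [← congrFun e1 a, ← hi c, ← hi d]
  simp only [Matrix.mulVec, dotProduct, Finset.sum_mul, ← Finset.sum_sub_distrib, Finset.mul_sum]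
  exact Finset.sum_congr rfl fun i _ => by ring

lemma MetricOn.curvConst_eq {K : ℝ} {y : E4} (hy : y ∈ U) (hK : ConstCurvAt G K y) :
    curvConst G y = K := by
  have hr : ∀ a b, ricci G y a b = 3 * K * G y b a := by
    intro a b
    simp only [ricci, h.riemannUp_of_constCurvAt hy hK, if_true, one_mul, ← Finset.mul_sum,
      Finset.sum_sub_distrib, ite_mul, zero_mul, Finset.sum_ite_eq', Finset.mem_univ, if_true]
    rw [h.symm_apply hy b a]
    simp
    ring
  have hi : ∑ a, ∑ b, (G y)⁻¹ a b * G y b a = 4 := by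
    have := congrArg Matrix.trace (Matrix.nonsing_inv_mul _ (h.isUnit hy))
    simpa [Matrix.trace, Matrix.mul_apply] using this
  have : ∑ a, ∑ b, (G y)⁻¹ a b * ricci G y a b = 3 * K * ∑ a, ∑ b, (G y)⁻¹ a b * G y b a := by
    simp only [hr, Finset.mul_sum]
    exact Finset.sum_congr rfl fun a _ => Finset.sum_congr rfl fun b _ => by ring
  rw [curvConst, this, hi]
  ring

/-- The only possible K is the smooth function `curvConst`, so failure means that one of finitely
many continuous functions is nonzero. -/
lemma MetricOn.isOpen_not_constCurv : IsOpen {y ∈ U | ¬ ∃ K, ConstCurvAt G K y} := by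
  have : {y ∈ U | ¬ ∃ K, ConstCurvAt G K y} = ⋃ a, ⋃ b, ⋃ c, ⋃ d, U ∩ (fun y => riemann G a b c d y -
      curvConst G y * (G y a c * G y b d - G y a d * G y b c)) ⁻¹' {0}ᶜ := by
    ext y
    simp only [Set.mem_setOf_eq, Set.mem_iUnion, Set.mem_inter_iff, Set.mem_preimage,
      Set.mem_compl_iff, Set.mem_singleton_iff]
    constructor
    · rintro ⟨hy, hK⟩
      by_contra! hne
      exact hK ⟨_, fun a b c d => sub_eq_zero.1 (hne a b c d hy)⟩
    · rintro ⟨a, b, c, d, hy, hne⟩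
      refine ⟨hy, fun ⟨K, hK⟩ => hne ?_⟩
      rw [h.curvConst_eq hy hK, hK, sub_self]
  rw [this]
  refine isOpen_iUnion fun a => isOpen_iUnion fun b => isOpen_iUnion fun c => isOpen_iUnion fun d => ?_
  exact ContinuousOn.isOpen_inter_preimage ((h.riemann_smooth a b c d).sub (h.curvConst_smooth.mul
    (((h.smooth a c).mul (h.smooth b d)).sub ((h.smooth a d).mul (h.smooth b c))))).continuousOn
    h.isOpen isOpen_compl_singleton

end Chart

namespace Normal

variable {V : Set E4} {G : Comp2} (h : Normal V G)
include h

/-- The second Bianchi identity at the origin. -/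
lemma pd_riemannUp_bianchi (a b c d e : Fin 4) : pd e (riemannUp G a b c d) 0
    + pd c (riemannUp G a b d e) 0 + pd d (riemannUp G a b e c) 0 = 0 := by
  have hΓ : ∀ a b c, DifferentiableAt ℝ (christoffel G a b c) 0 := fun a b c =>
    contDiffOn_diffAt (h.christoffel_smooth a b c) h.isOpen h.zero_mem
  have hΓ' : ∀ a b c d, DifferentiableAt ℝ (pd d (christoffel G a b c)) 0 := fun a b c d =>
    contDiffOn_diffAt (contDiffOn_pd (h.christoffel_smooth a b c) h.isOpen d) h.isOpen h.zero_mem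
  have key : ∀ c d e, pd e (riemannUp G a b c d) 0 =
      pd e (pd c (christoffel G a b d)) 0 - pd e (pd d (christoffel G a b c)) 0 := by
    intro c d e
    have e1 : pd e (riemannUp G a b c d) 0 = pd e (fun y => (pd c (christoffel G a b d) y
      - pd d (christoffel G a b c) y) + ∑ e, (christoffel G e b d y * christoffel G a e c y
      - christoffel G e b c y * christoffel G a e d y)) 0 := rfl
    have hm : ∀ a b c d e f, DifferentiableAt ℝ
        (fun y => christoffel G a b c y * christoffel G d e f y) 0 := fun a b c d e f =>
      (hΓ a b c).fun_mul (hΓ d e f)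
    have hs : ∀ i ∈ (Finset.univ : Finset (Fin 4)), DifferentiableAt ℝ (fun y =>
        christoffel G i b d y * christoffel G a i c y
        - christoffel G i b c y * christoffel G a i d y) 0 := fun i _ =>
      (hm _ _ _ _ _ _).fun_sub (hm _ _ _ _ _ _)
    rw [e1, pd_add e ((hΓ' a b d c).fun_sub (hΓ' a b c d)) (DifferentiableAt.fun_sum hs), pd_sum e hs,
      pd_sub e (hΓ' a b d c) (hΓ' a b c d)]
    have : ∀ i, pd e (fun y => christoffel G i b d y * christoffel G a i c y
        - christoffel G i b c y * christoffel G a i d y) 0 = 0 := fun i => by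
      rw [pd_sub e (hm _ _ _ _ _ _) (hm _ _ _ _ _ _), pd_mul e (hΓ _ _ _) (hΓ _ _ _),
        pd_mul e (hΓ _ _ _) (hΓ _ _ _)]
      simp [h.christoffel_zero]
    simp [this]
  have hc := fun b' c d => pd_comm (h.christoffel_smooth a b b') h.isOpen h.zero_mem c d
  rw [key, key, key, hc d e c, hc e c d, hc c d e]
  ring

/-- Choose c, d, e distinct. In the second Bianchi identity for R^c_{dcd}, cyclic in c, d, e, two of
the three terms vanish and the third is ±∂_e K. -/
lemma pd_curvConst (hK : ∀ x ∈ V, ∃ K, ConstCurvAt G K x) (e : Fin 4) : pd e (curvConst G) 0 = 0 := by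
  have hK' : ∀ x ∈ V, ∀ a b c d, riemannUp G a b c d x = curvConst G x *
      ((if a = c then 1 else 0) * G x b d - (if a = d then 1 else 0) * G x b c) := by
    intro x hx a b c d
    obtain ⟨K, hKx⟩ := hK x hx
    rw [h.toMetricOn.curvConst_eq hx hKx]
    exact h.toMetricOn.riemannUp_of_constCurvAt hx hKx a b c d
  have dG : ∀ b c, DifferentiableAt ℝ (fun x => G x b c) 0 := fun b c =>
    contDiffOn_diffAt (h.smooth b c) h.isOpen h.zero_mem
  have dK : DifferentiableAt ℝ (curvConst G) 0 :=
    contDiffOn_diffAt h.toMetricOn.curvConst_smooth h.isOpen h.zero_mem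
  have key : ∀ a b c d e, pd e (riemannUp G a b c d) 0 =
      pd e (curvConst G) 0 * ((if a = c then 1 else 0) * G 0 b d
        - (if a = d then 1 else 0) * G 0 b c) := by
    intro a b c d e
    have e1 : pd e (riemannUp G a b c d) 0 = pd e (fun x => curvConst G x *
      ((if a = c then 1 else 0) * G x b d - (if a = d then 1 else 0) * G x b c)) 0 :=
      pd_congr h.isOpen (fun x hx => hK' x hx a b c d) h.zero_mem e
    rw [e1, pd_mul e dK (((dG b d).const_mul _).fun_sub ((dG b c).const_mul _)),
      pd_sub e ((dG b d).const_mul _) ((dG b c).const_mul _), pd_const_mul e _ (dG b d),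
      pd_const_mul e _ (dG b c), h.deriv, h.deriv]
    ring
  obtain ⟨c, d, hcd, hce, hde⟩ : ∃ c d : Fin 4, c ≠ d ∧ c ≠ e ∧ d ≠ e := by decide +revert
  have b := h.pd_riemannUp_bianchi c d c d e
  rw [key, key, key] at b
  simp only [hcd, hce, hde, hcd.symm, hce.symm, hde.symm, if_true, if_false, h.val_apply] at b
  have : sg d ≠ 0 := fun h0 => by simpa [h0] using sg_mul_self d
  simp at b
  exact b.resolve_right this

end Normal

section Chart

variable {U : Set E4} {G : Comp2} (h : MetricOn U G)
include h

theorem MetricOn.pd_curvConst (hK : ∀ x ∈ U, ∃ K, ConstCurvAt G K x) {y : E4} (hy : y ∈ U)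
    (e : Fin 4) : pd e (curvConst G) y = 0 := by
  obtain ⟨φ, V, k, rfl, hN⟩ := h.exists_normal' hy
  have h0 := hN.zero_mem
  have hK' : ∀ x ∈ V, ∃ K, ConstCurvAt (pull φ G) K x := fun x hx => by
    obtain ⟨K, hKx⟩ := hK _ (k.mapsTo hx)
    exact ⟨K, (k.constCurvAt_pull h hx K).2 hKx⟩
  refine k.pd_eq_zero h0 (contDiffOn_diffAt h.curvConst_smooth h.isOpen hy) (fun a => ?_) e
  rw [← hN.pd_curvConst hK' a]
  have : pd a (fun z => curvConst G (φ z)) 0 = pd a (curvConst (pull φ G)) 0 :=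
    pd_congr k.isOpen (fun z hz => by
      obtain ⟨K, hKx⟩ := hK _ (k.mapsTo hz)
      rw [h.curvConst_eq (k.mapsTo hz) hKx,
        hN.toMetricOn.curvConst_eq hz ((k.constCurvAt_pull h hz K).2 hKx)]) h0 a
  exact this

/-- Schur's lemma. -/
theorem MetricOn.curvConst_const (hK : ∀ x ∈ U, ∃ K, ConstCurvAt G K x) {S : Set E4}
    (hS : Convex ℝ S) (hSU : S ⊆ U) {x y : E4} (hx : x ∈ S) (hy : y ∈ S) :
    curvConst G x = curvConst G y := by
  have hd : ∀ z ∈ S, HasFDerivWithinAt (curvConst G) (0 : E4 →L[ℝ] ℝ) S z := fun z hz => by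
    have h1 := (contDiffOn_diffAt h.curvConst_smooth h.isOpen (hSU hz)).hasFDerivAt
    rw [fderiv_ext_pd (h.pd_curvConst hK (hSU hz))] at h1
    exact h1.hasFDerivWithinAt
  have := hS.norm_image_sub_le_of_norm_hasFDerivWithin_le (C := 0) hd (by simp) hy hx
  rw [zero_mul] at this
  exact sub_eq_zero.1 (norm_le_zero_iff.1 this)

end Chart

/-! ### Components of tensor fields in the charts of a manifold -/

variable {M : Type*} [TopologicalSpace M] [ChartedSpace E4 M] [IsManifold (𝓡 4) ∞ M]

/-- The value of a bilinear field on two vectors of the model space. -/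
def BilinField.eval (B : BilinField M) (x : M) (v w : E4) : ℝ := B.form x v w

/-- The derivative of the inverse of a chart. -/
def symmDeriv (e : OpenPartialHomeomorph M E4) (y : E4) : E4 →L[ℝ] E4 :=
  mfderiv (𝓡 4) (𝓡 4) e.symm y

lemma BilinField.comp_eq (B : BilinField M) (e : OpenPartialHomeomorph M E4) (y : E4)
    (a b : Fin 4) : B.comp e y a b =
      B.eval (e.symm y) (symmDeriv e y (bv a)) (symmDeriv e y (bv b)) := rfl

lemma BilinField.eval_sum (B : BilinField M) (x : M) {ι : Type*} [Fintype ι] (c d : ι → ℝ)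
    (v : ι → E4) : B.eval x (∑ i, c i • v i) (∑ i, d i • v i) =
      ∑ i, ∑ j, c i * d j * B.eval x (v i) (v j) := by
  have : ∀ f : E4 →L[ℝ] E4 →L[ℝ] ℝ, f (∑ i, c i • v i) (∑ i, d i • v i) =
      ∑ i, ∑ j, c i * d j * f (v i) (v j) := by
    intro f
    simp only [map_sum, map_smul, _root_.sum_apply, FunLike.coe_smul, Pi.smul_apply, smul_eq_mul,
      Finset.mul_sum, mul_assoc]
    rw [Finset.sum_comm]
    exact Finset.sum_congr rfl fun i _ => Finset.sum_congr rfl fun j _ => by ring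
  exact this (B.form x)

/-- Bilinear matrix form of `eval` on images of a linear map. -/
lemma BilinField.eval_map (B : BilinField M) (x : M) (L : E4 →L[ℝ] E4) (v w : E4) :
    B.eval x (L v) (L w) = ∑ i, ∑ j, v i * w j * B.eval x (L (bv i)) (L (bv j)) := by
  conv_lhs => rw [sum_bv v, sum_bv w]
  simp only [map_sum, map_smul]
  exact B.eval_sum x _ _ _

lemma mem_maximalAtlas {e : OpenPartialHomeomorph M E4} (he : e ∈ atlas E4 M) :
    e ∈ IsManifold.maximalAtlas (𝓡 4) ∞ M := IsManifold.subset_maximalAtlas he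

lemma hasMFDerivAt_symm {e : OpenPartialHomeomorph M E4} (he : e ∈ atlas E4 M) {y : E4}
    (hy : y ∈ e.target) : HasMFDerivAt (𝓡 4) (𝓡 4) e.symm y (symmDeriv e y) :=
  ((contMDiffOn_symm_of_mem_maximalAtlas (mem_maximalAtlas he)).contMDiffAt
    (e.open_target.mem_nhds hy)).mdifferentiableAt (by simp) |>.hasMFDerivAt

lemma symmDeriv_injective {e : OpenPartialHomeomorph M E4} (he : e ∈ atlas E4 M) {y : E4}
    (hy : y ∈ e.target) : Function.Injective (symmDeriv e y) := by
  have h1 : MDifferentiableAt (𝓡 4) (𝓡 4) e (e.symm y) :=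
    (contMDiffAt_of_mem_maximalAtlas (mem_maximalAtlas he) (e.map_target hy)).mdifferentiableAt
      (by simp)
  have h2 := h1.hasMFDerivAt.comp y (hasMFDerivAt_symm he hy)
  have h3 : HasMFDerivAt (𝓡 4) (𝓡 4) (e ∘ e.symm) y (ContinuousLinearMap.id ℝ E4) :=
    (hasMFDerivAt_id (I := 𝓡 4) y).congr_of_eventuallyEq
      (Filter.eventuallyEq_of_mem (e.open_target.mem_nhds hy) fun z hz => e.right_inv hz)
  have h4 := hasMFDerivAt_unique h2 h3
  intro v w hvw
  have hv := DFunLike.congr_fun h4 v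
  have hw := DFunLike.congr_fun h4 w
  have : mfderiv (𝓡 4) (𝓡 4) e (e.symm y) (symmDeriv e y v) =
    mfderiv (𝓡 4) (𝓡 4) e (e.symm y) (symmDeriv e y w) := by rw [hvw]
  exact hv.symm.trans (this.trans hw)

/-- The coordinate fields are smooth along the inverse chart, being the tangent map applied to
constant fields; evaluate the smooth bilinear section on them. -/
lemma BilinField.smM_comp (B : BilinField M) {e : OpenPartialHomeomorph M E4}
    (he : e ∈ atlas E4 M) : SmM e.target (B.comp e) := by
  have hs := contMDiffOn_symm_of_mem_maximalAtlas (mem_maximalAtlas he)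
  have hv : ∀ a : Fin 4, ContMDiffOn (𝓡 4) ((𝓡 4).prod 𝓘(ℝ, E4)) ∞
      (fun y => Bundle.TotalSpace.mk' E4 (E := fun x : M => TangentSpace (𝓡 4) x) (e.symm y)
        (coordVec e a y)) e.target := by
    intro a
    have h1 := hs.contMDiffOn_tangentMapWithin (m := ∞) (by simp) e.open_target.uniqueMDiffOn
    have h2 : ContMDiff (𝓡 4) ((𝓡 4).prod 𝓘(ℝ, E4)) ∞
      (fun y : E4 => (Bundle.TotalSpace.mk' E4 y (bv a : TangentSpace (𝓡 4) y) :
        TangentBundle (𝓡 4) E4)) :=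
      (contMDiff_vectorSpace_iff_contDiff (V := fun _ => bv a)).2 contDiff_const
    have h3 := h1.comp (h2.contMDiffOn (s := e.target)) (fun y hy => hy)
    refine h3.congr fun y hy => ?_
    simp only [Function.comp, tangentMapWithin, mfderivWithin_of_isOpen e.open_target hy]
    rfl
  intro a b
  rw [← contMDiffOn_iff_contDiffOn]
  have hB := B.contMDiff.comp_contMDiffOn hs
  have := ContMDiffOn.clm_bundle_apply₂ (F₁ := E4) (F₂ := E4) (F₃ := ℝ)
    (E₃ := Bundle.Trivial M ℝ) hB (hv a) (hv b)
  intro y hy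
  have h4 := this y hy
  exact (Bundle.contMDiffWithinAt_totalSpace.1 h4).2

lemma antisymmOn_comp (A : TwoForm M) (e : OpenPartialHomeomorph M E4) :
    AntisymmOn e.target (A.comp e) := fun _ _ _ _ => A.antisymm _ _ _

lemma metricOn_comp (g : LorentzMetric M) {e : OpenPartialHomeomorph M E4}
    (he : e ∈ atlas E4 M) : MetricOn e.target (g.comp e) where
  isOpen := e.open_target
  smooth := g.smM_comp he
  lorentz y hy := by
    obtain ⟨b, hb⟩ := g.signature (e.symm y)
    -- This lets the orthonormal basis of the tangent space be written in coordinates; its vectors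
    -- are the columns of the frame matrix P.
    have hsurj : Function.Surjective (symmDeriv e y) :=
      LinearMap.surjective_of_injective (f := (symmDeriv e y : E4 →ₗ[ℝ] E4))
        (symmDeriv_injective he hy)
    choose v hv using fun i => hsurj (b i)
    refine ⟨Matrix.of fun a i => v i a, ?_⟩
    ext i j
    have h1 : g.eval (e.symm y) (symmDeriv e y (v i)) (symmDeriv e y (v j)) = mink i j := by
      rw [hv, hv]; exact hb i j
    rw [← h1]
    conv_rhs => rw [sum_bv (v i), sum_bv (v j)]
    simp only [map_sum, map_smul]
    rw [BilinField.eval_sum]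
    simp only [Matrix.mul_apply, Matrix.transpose_apply, Matrix.of_apply, Finset.sum_mul]
    rw [Finset.sum_comm]
    refine Finset.sum_congr rfl fun p _ => Finset.sum_congr rfl fun q _ => ?_
    rw [← BilinField.comp_eq]
    ring

/-- A change of charts of an oriented atlas. -/
lemma coordMap_transition (hor : IsOrientedAtlas M) {e e' : OpenPartialHomeomorph M E4}
    (he : e ∈ atlas E4 M) (he' : e' ∈ atlas E4 M) :
    CoordMap (e.symm.trans e').source e'.target (e.symm.trans e') where
  isOpen := (e.symm.trans e').open_source
  isOpen' := e'.open_target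
  mapsTo := fun y hy => e'.map_source (by simpa using hy.2)
  smooth := by
    rw [← contMDiffOn_iff_contDiffOn]
    exact (contMDiffOn_of_mem_maximalAtlas (mem_maximalAtlas he')).comp
      ((contMDiffOn_symm_of_mem_maximalAtlas (mem_maximalAtlas he)).mono
        fun y hy => by simpa using hy.1) fun y hy => by simpa using hy.2
  det_pos := fun y hy => by
    have hpos := hor e he e' he' y hy
    have hd : DifferentiableAt ℝ (e.symm.trans e') y := by
      have h1 : ContMDiffAt (𝓡 4) (𝓡 4) ∞ (e.symm.trans e') y :=
        (contMDiffAt_of_mem_maximalAtlas (mem_maximalAtlas he') (by simpa using hy.2)).comp y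
          ((contMDiffOn_symm_of_mem_maximalAtlas (mem_maximalAtlas he)).contMDiffAt
            (e.open_target.mem_nhds (by simpa using hy.1)))
      exact h1.contDiffAt.differentiableAt (by simp)
    have hj : LinearMap.toMatrix (EuclideanSpace.basisFun (Fin 4) ℝ).toBasis
        (EuclideanSpace.basisFun (Fin 4) ℝ).toBasis
        (fderiv ℝ (e.symm.trans e') y : E4 →ₗ[ℝ] E4) = jac (e.symm.trans e') y := by
      ext i a
      rw [LinearMap.toMatrix_apply, jac_apply, pd, fderiv_coord hd]
      simp
    rwa [← LinearMap.det_toMatrix (EuclideanSpace.basisFun (Fin 4) ℝ).toBasis, hj] at hpos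

lemma symmDeriv_transition (hor : IsOrientedAtlas M) {e e' : OpenPartialHomeomorph M E4}
    (he : e ∈ atlas E4 M) (he' : e' ∈ atlas E4 M) {y : E4} (hy : y ∈ (e.symm.trans e').source) :
    symmDeriv e y = (symmDeriv e' (e.symm.trans e' y)).comp (fderiv ℝ (e.symm.trans e') y) := by
  have k := coordMap_transition hor he he'
  have hy1 : y ∈ e.target := by simpa using hy.1
  have h1 : HasMFDerivAt (𝓡 4) (𝓡 4) (e.symm.trans e') y (fderiv ℝ (e.symm.trans e') y) :=
    (k.diffAt hy).hasFDerivAt.hasMFDerivAt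
  have h2 := (hasMFDerivAt_symm he' (k.mapsTo hy)).comp y h1
  have h3 := (hasMFDerivAt_symm he hy1).congr_of_eventuallyEq
    (Filter.eventuallyEq_of_mem (k.isOpen.mem_nhds hy) (f := e'.symm ∘ (e.symm.trans e'))
      fun z hz => e'.left_inv (by simpa using hz.2))
  exact hasMFDerivAt_unique h3 h2

lemma comp_transition (hor : IsOrientedAtlas M) (B : BilinField M)
    {e e' : OpenPartialHomeomorph M E4} (he : e ∈ atlas E4 M) (he' : e' ∈ atlas E4 M) {y : E4}
    (hy : y ∈ (e.symm.trans e').source) :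
    B.comp e y = pull (e.symm.trans e') (B.comp e') y := by
  have k := coordMap_transition hor he he'
  have hpt : e'.symm (e.symm.trans e' y) = e.symm y := e'.left_inv (by simpa using hy.2)
  ext a b
  rw [BilinField.comp_eq, symmDeriv_transition hor he he' hy]
  have h2 := B.eval_map (e.symm y) (symmDeriv e' (e.symm.trans e' y))
    (fderiv ℝ (e.symm.trans e') y (bv a)) (fderiv ℝ (e.symm.trans e') y (bv b))
  refine h2.trans ?_
  have hj : ∀ i a, fderiv ℝ (e.symm.trans e') y (bv a) i = jac (e.symm.trans e') y i a :=
    fun i a => (fderiv_coord (k.diffAt hy) _ i).symm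
  simp only [pull, Matrix.mul_apply, Matrix.transpose_apply, Finset.sum_mul, hj]
  rw [Finset.sum_comm]
  refine Finset.sum_congr rfl fun p _ => Finset.sum_congr rfl fun q _ => ?_
  rw [BilinField.comp_eq, hpt]
  ring

/-! ### Locality -/

section Locality

variable {S : Set E4} (hS : IsOpen S) {G G' T T' : Comp2}
include hS

lemma christoffel_congr (hG : ∀ x ∈ S, G x = G' x) (a b c : Fin 4) {x : E4} (hx : x ∈ S) :
    christoffel G a b c x = christoffel G' a b c x := by
  have hd : ∀ a b c, pd c (fun z => G z a b) x = pd c (fun z => G' z a b) x := fun a b c =>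
    pd_congr hS (fun z hz => by rw [hG z hz]) hx c
  simp only [christoffel, hd, hG x hx]

lemma riemann_congr (hG : ∀ x ∈ S, G x = G' x) (a b c d : Fin 4) {x : E4} (hx : x ∈ S) :
    riemann G a b c d x = riemann G' a b c d x := by
  have hΓ := fun a b c x hx => christoffel_congr hS hG a b c (x := x) hx
  have hd : ∀ a b c d, pd d (christoffel G a b c) x = pd d (christoffel G' a b c) x :=
    fun a b c d => pd_congr hS (hΓ a b c) hx d
  simp only [riemann, riemannUp, hd, hΓ _ _ _ x hx, hG x hx]

lemma codiffVec_congr (hG : ∀ x ∈ S, G x = G' x) (hT : ∀ x ∈ S, T x = T' x) {x : E4} (hx : x ∈ S) :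
    codiffVec G T x = codiffVec G' T' x := by
  have hd : ∀ a b c, pd c (fun z => T z a b) x = pd c (fun z => T' z a b) x := fun a b c =>
    pd_congr hS (fun z hz => by rw [hT z hz]) hx c
  simp only [codiffVec, codiff, covDeriv, hd, christoffel_congr hS hG _ _ _ hx, hG x hx, hT x hx]

lemma lieDeriv_congr {Z Z' : E4 → E4} (hZ : ∀ x ∈ S, Z x = Z' x) (hT : ∀ x ∈ S, T x = T' x)
    {x : E4} (hx : x ∈ S) : lieDeriv Z T x = lieDeriv Z' T' x := by
  have hd : ∀ a b c, pd c (fun z => T z a b) x = pd c (fun z => T' z a b) x := fun a b c =>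
    pd_congr hS (fun z hz => by rw [hT z hz]) hx c
  have hd' : ∀ a c, pd c (fun z => Z z a) x = pd c (fun z => Z' z a) x := fun a c =>
    pd_congr hS (fun z hz => by rw [hZ z hz]) hx c
  ext a b
  simp only [lieDeriv, hd, hd', hT x hx, hZ x hx]

end Locality

lemma MetricOn.mono {U U' : Set E4} {G : Comp2} (h : MetricOn U G) (hU' : IsOpen U') (hs : U' ⊆ U) :
    MetricOn U' G := ⟨hU', h.smooth.mono hs, fun y hy => h.lorentz y (hs hy)⟩

/-! ### Changes of chart for Z₁, Z₂, invariance and constant curvature. -/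

section Transition

variable {M : Type*} [TopologicalSpace M] [ChartedSpace E4 M] [IsManifold (𝓡 4) ∞ M]
  (hor : IsOrientedAtlas M) (g : LorentzMetric M) (A : TwoForm M)
  {e e' : OpenPartialHomeomorph M E4} (he : e ∈ atlas E4 M) (he' : e' ∈ atlas E4 M)
include hor he he'

lemma Z1_transition {y : E4} (hy : y ∈ (e.symm.trans e').source) :
    Z1 g A e y = pullVec (e.symm.trans e') (Z1 g A e') y := by
  have k := coordMap_transition hor he he'
  rw [Z1, codiffVec_congr k.isOpen (fun x hx => comp_transition hor g.toBilinField he he' hx)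
    (fun x hx => comp_transition hor A.toBilinField he he' hx) hy,
    k.codiffVec_pull (metricOn_comp g he') (A.smM_comp he') hy]
  rfl

lemma Z2_transition {y : E4} (hy : y ∈ (e.symm.trans e').source) :
    Z2 g A e y = pullVec (e.symm.trans e') (Z2 g A e') y := by
  have k := coordMap_transition hor he he'
  have h' := metricOn_comp g he'
  rw [Z2, codiffVec_congr k.isOpen (fun x hx => comp_transition hor g.toBilinField he he' hx)
    (fun x hx => (hodge_congr (comp_transition hor g.toBilinField he he' hx)
      (comp_transition hor A.toBilinField he he' hx)).trans (k.hodge_pull _ _ hx)) hy,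
    k.codiffVec_pull h' (h'.hodge_smooth (A.smM_comp he')) hy]
  rfl

lemma lieDeriv_transition {Z Z' : E4 → E4} (hZ : ContDiffOn ℝ ∞ Z' e'.target)
    (hZZ : ∀ y ∈ (e.symm.trans e').source, Z y = pullVec (e.symm.trans e') Z' y) {y : E4}
    (hy : y ∈ (e.symm.trans e').source) :
    lieDeriv Z (A.comp e) y = 0 ↔ lieDeriv Z' (A.comp e') (e.symm.trans e' y) = 0 := by
  have k := coordMap_transition hor he he'
  rw [lieDeriv_congr k.isOpen hZZ (fun x hx => comp_transition hor A.toBilinField he he' hx) hy,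
    k.lieDeriv_pull hZ (A.smM_comp he') hy, k.pull_eq_zero hy]

lemma constCurvAt_transition {K : ℝ} {y : E4} (hy : y ∈ (e.symm.trans e').source) :
    ConstCurvAt (g.comp e) K y ↔ ConstCurvAt (g.comp e') K (e.symm.trans e' y) := by
  have k := coordMap_transition hor he he'
  rw [← k.constCurvAt_pull (metricOn_comp g he') hy, ConstCurvAt, ConstCurvAt,
    ← comp_transition hor g.toBilinField he he' hy]
  simp only [riemann_congr k.isOpen
    (fun x hx => comp_transition hor g.toBilinField he he' hx) _ _ _ _ hy]

end Transition

/-! ### Globalisation over the connected manifold. -/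

section Global

variable {M : Type*} [TopologicalSpace M] [ChartedSpace E4 M] [IsManifold (𝓡 4) ∞ M]
  (hor : IsOrientedAtlas M) (g : LorentzMetric M) (A : TwoForm M)

/-- If the curvature were constant pointwise, its value would be a chart-independent function on M,
locally constant by Schur's lemma and so constant. -/
lemma exists_not_constCurvAt [ConnectedSpace M] (hor : IsOrientedAtlas M)
    (hcurv : ¬ HasConstantCurvature g) :
    ∃ e ∈ atlas E4 M, ∃ y ∈ e.target, ¬ ∃ K, ConstCurvAt (g.comp e) K y := by
  by_contra! hall
  apply hcurv
  set κ : M → ℝ := fun x => curvConst (g.comp (chartAt E4 x)) (chartAt E4 x x) with hκ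
  have hchart : ∀ e ∈ atlas E4 M, ∀ y ∈ e.target, curvConst (g.comp e) y = κ (e.symm y) := by
    intro e he y hy
    obtain ⟨K, hK⟩ := hall e he y hy
    have he' := chart_mem_atlas E4 (e.symm y)
    have hy' : y ∈ (e.symm.trans (chartAt E4 (e.symm y))).source := by
      simp [hy]
    have hK' := (constCurvAt_transition hor g he he' hy').1 hK
    rw [(metricOn_comp g he).curvConst_eq hy hK, hκ]
    exact ((metricOn_comp g he').curvConst_eq
      ((coordMap_transition hor he he').mapsTo hy') hK').symm
  have hloc : IsLocallyConstant κ := by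
    rw [IsLocallyConstant.iff_eventually_eq]
    intro x
    have he := chart_mem_atlas E4 x
    set e := chartAt E4 x
    have hx : x ∈ e.source := mem_chart_source E4 x
    obtain ⟨r, hr, hball⟩ := Metric.isOpen_iff.1 e.open_target (e x) (e.map_source hx)
    filter_upwards [e.open_source.mem_nhds hx,
      (e.continuousAt hx).preimage_mem_nhds (Metric.ball_mem_nhds _ hr)] with z hz hzb
    have h1 := (metricOn_comp g he).curvConst_const (hall e he) (convex_ball (e x) r) hball
      hzb (Metric.mem_ball_self hr)
    rwa [hchart e he _ (e.map_source hz), hchart e he _ (e.map_source hx), e.left_inv hz,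
      e.left_inv hx] at h1
  obtain ⟨x₀⟩ := (inferInstance : Nonempty M)
  refine ⟨κ x₀, fun e he y hy => ?_⟩
  obtain ⟨K, hK⟩ := hall e he y hy
  have : K = κ x₀ := by
    rw [← (metricOn_comp g he).curvConst_eq hy hK, hchart e he y hy]
    exact hloc.apply_eq_of_preconnectedSpace _ _
  rw [← this]
  exact hK

lemma smooth_Z1 {e : OpenPartialHomeomorph M E4} (he : e ∈ atlas E4 M) :
    ContDiffOn ℝ ∞ (Z1 g A e) e.target :=
  (metricOn_comp g he).codiffVec_smooth (A.smM_comp he)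

lemma smooth_Z2 {e : OpenPartialHomeomorph M E4} (he : e ∈ atlas E4 M) :
    ContDiffOn ℝ ∞ (Z2 g A e) e.target :=
  (metricOn_comp g he).codiffVec_smooth ((metricOn_comp g he).hodge_smooth (A.smM_comp he))

variable {g A}

lemma pairEq_chart (hA : IsCKY g A) {e : OpenPartialHomeomorph M E4} (he : e ∈ atlas E4 M) :
    ∀ y ∈ e.target, PairEq (g.comp e) (A.comp e) (Z1 g A e y).ofLp (Z2 g A e y).ofLp y :=
  fun y hy => (metricOn_comp g he).pairEq_of_ckyEq (A.smM_comp he) (antisymmOn_comp A e) hy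
    (hA e he y hy)

lemma killing_Z1 (hA : IsCKY g A) (hRic : CommutesWithRicci g A) {e : OpenPartialHomeomorph M E4}
    (he : e ∈ atlas E4 M) : ∀ y ∈ e.target, KillingEq (g.comp e) (Z1 g A e) y :=
  fun y hy => (metricOn_comp g he).killingEq_of_pairEq (A.smM_comp he) (antisymmOn_comp A e)
    (smooth_Z1 g A he) (smooth_Z2 g A he) (pairEq_chart hA he) hy (hRic e he y hy).1

/-- Apply the argument for Z₁ to *A, whose pair is (Z₂, −Z₁), with [*A, Ric] = 0. -/
lemma killing_Z2 (hA : IsCKY g A) (hRic : CommutesWithRicci g A) {e : OpenPartialHomeomorph M E4}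
    (he : e ∈ atlas E4 M) : ∀ y ∈ e.target, KillingEq (g.comp e) (Z2 g A e) y :=
  fun y hy => (metricOn_comp g he).killingEq_of_pairEq
    ((metricOn_comp g he).hodge_smooth (A.smM_comp he))
    (fun y _ a b => hodge_antisymm _ _ y a b) (smooth_Z2 g A he) (smooth_Z1 g A he).neg
    (fun x hx => (metricOn_comp g he).pairEq_hodge (A.smM_comp he) hx (pairEq_chart hA he x hx)) hy
    (hRic e he y hy).2

/-- `A` is invariant under `Z₁` and `Z₂` at the point with coordinates `y`. -/
def InvariantAt (g : LorentzMetric M) (A : TwoForm M) (e : OpenPartialHomeomorph M E4) (y : E4) :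
    Prop :=
  lieDeriv (Z1 g A e) (A.comp e) y = 0 ∧ lieDeriv (Z2 g A e) (A.comp e) y = 0

lemma invariantAt_chart [ConnectedSpace M] (hor : IsOrientedAtlas M)
    (hcurv : ¬ HasConstantCurvature g) (hA : IsCKY g A) (hnull : IsNonNull g A)
    (hRic : CommutesWithRicci g A) {e : OpenPartialHomeomorph M E4} (he : e ∈ atlas E4 M) {y : E4}
    (hy : y ∈ e.target) : InvariantAt g A e y := by
  -- Invariance is required on a neighbourhood: this makes W open and supplies the hypothesis of
  -- unique continuation.
  set W : Set M := {x | ∃ e ∈ atlas E4 M, x ∈ e.source ∧ ∀ᶠ y in nhds (e x), InvariantAt g A e y}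
    with hW
  have hchart : ∀ x ∈ W, ∀ e ∈ atlas E4 M, x ∈ e.source →
      ∀ᶠ y in nhds (e x), InvariantAt g A e y := by
    rintro x ⟨e', he', hx', hev⟩ e he hx
    have hxs : e x ∈ (e.symm.trans e').source := by simp [hx, hx']
    have hφ : e.symm.trans e' (e x) = e' x := by simp [hx]
    have hc := (coordMap_transition hor he he').diffAt hxs |>.continuousAt
    rw [ContinuousAt, hφ] at hc
    filter_upwards [hc.eventually hev, (e.symm.trans e').open_source.mem_nhds hxs] with y hy hys
    exact ⟨(lieDeriv_transition hor A he he' (smooth_Z1 g A he')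
      (fun z hz => Z1_transition hor g A he he' hz) hys).2 hy.1,
      (lieDeriv_transition hor A he he' (smooth_Z2 g A he')
      (fun z hz => Z2_transition hor g A he he' hz) hys).2 hy.2⟩
  have hopen : IsOpen W := by
    rw [isOpen_iff_mem_nhds]
    rintro x ⟨e, he, hx, hev⟩
    filter_upwards [e.open_source.mem_nhds hx,
      (e.continuousAt hx).eventually hev.eventually_nhds] with z hz hzev
    exact ⟨e, he, hz, hzev⟩
  -- Near a limit point, a coordinate ball contains a point of W, and unique continuation spreads
  -- the invariance over the ball.
  have hclosed : IsClosed W := by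
    rw [← closure_subset_iff_isClosed]
    intro x hx
    have he := chart_mem_atlas E4 x
    have hxs : x ∈ (chartAt E4 x).source := mem_chart_source E4 x
    set e := chartAt E4 x
    obtain ⟨r, hr, hball⟩ := Metric.isOpen_iff.1 e.open_target (e x) (e.map_source hxs)
    obtain ⟨z, hz, hzW⟩ := mem_closure_iff_nhds.1 hx _ (Filter.inter_mem (e.open_source.mem_nhds hxs)
      ((e.continuousAt hxs).preimage_mem_nhds (Metric.ball_mem_nhds _ hr)))
    have hev := hchart z hzW e he hz.1
    have h := metricOn_comp g he
    have sA := A.smM_comp he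
    have aA := antisymmOn_comp A e
    refine ⟨e, he, hxs, Filter.eventually_of_mem (Metric.ball_mem_nhds _ hr) fun y hy => ⟨?_, ?_⟩⟩
    · exact h.lieDeriv_unique_continuation sA aA (smooth_Z1 g A he) (smooth_Z1 g A he)
        (smooth_Z2 g A he) (killing_Z1 hA hRic he) (killing_Z1 hA hRic he) (killing_Z2 hA hRic he)
        (pairEq_chart hA he) (convex_ball _ _) hball Metric.isOpen_ball hz.2
        (hev.mono fun _ h => h.1) hy
    · exact h.lieDeriv_unique_continuation sA aA (smooth_Z2 g A he) (smooth_Z1 g A he)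
        (smooth_Z2 g A he) (killing_Z2 hA hRic he) (killing_Z1 hA hRic he) (killing_Z2 hA hRic he)
        (pairEq_chart hA he) (convex_ball _ _) hball Metric.isOpen_ball hz.2
        (hev.mono fun _ h => h.2) hy
  -- The non-constant-curvature points of a chart form an open set, on which the local result
  -- applies.
  have hne : W.Nonempty := by
    obtain ⟨e, he, y, hy, hK⟩ := exists_not_constCurvAt g hor hcurv
    have h := metricOn_comp g he
    set U := {y ∈ e.target | ¬ ∃ K, ConstCurvAt (g.comp e) K y} with hU
    have hUo : IsOpen U := h.isOpen_not_constCurv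
    have hs : U ⊆ e.target := fun y hy => hy.1
    refine ⟨e.symm y, e, he, e.map_target hy, ?_⟩
    rw [e.right_inv hy]
    refine Filter.eventually_of_mem (hUo.mem_nhds ⟨hy, hK⟩) fun z hz => ?_
    exact (h.mono hUo hs).lieDeriv_eq_zero ((A.smM_comp he).mono hs)
      (fun y hy => antisymmOn_comp A e y (hs hy)) ((smooth_Z1 g A he).mono hs)
      ((smooth_Z2 g A he).mono hs) (fun x hx => killing_Z1 hA hRic he x (hs hx))
      (fun x hx => killing_Z2 hA hRic he x (hs hx)) (fun x hx => pairEq_chart hA he x (hs hx))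
      (fun x hx => hnull e he x (hs hx)) (fun x hx => hx.2) hz
  have huniv : W = Set.univ := IsClopen.eq_univ ⟨hclosed, hopen⟩ hne
  have hmem : e.symm y ∈ W := huniv ▸ Set.mem_univ _
  have := hchart _ hmem e he (e.map_target hy)
  rw [e.right_inv hy] at this
  exact this.self_of_nhds

end Global

end

end CKY

/-! ### The theorem. -/

theorem proposition1 {M : Type*} [TopologicalSpace M] [ChartedSpace CKY.E4 M]
    [IsManifold (𝓡 4) ∞ M] [ConnectedSpace M] (hor : CKY.IsOrientedAtlas M)
    (g : CKY.LorentzMetric M) (hcurv : ¬ CKY.HasConstantCurvature g)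
    (A : CKY.TwoForm M) (hA : CKY.IsCKY g A) (hnull : CKY.IsNonNull g A) (hRic : CKY.CommutesWithRicci g A) :
    -- `Z₁` and `Z₂` are Killing vectors (possibly zero) that leave `A` invariant
    (∀ e ∈ atlas CKY.E4 M, ∀ y ∈ e.target,
      CKY.lieDeriv (CKY.Z1 g A e) (g.comp e) y = 0 ∧ CKY.lieDeriv (CKY.Z2 g A e) (g.comp e) y = 0 ∧
      CKY.lieDeriv (CKY.Z1 g A e) (A.comp e) y = 0 ∧ CKY.lieDeriv (CKY.Z2 g A e) (A.comp e) y = 0) ∧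
    -- if `Z₁ ∧ Z₂` is not identically zero, then they commute
    ((∃ e ∈ atlas CKY.E4 M, ∃ y ∈ e.target, LinearIndependent ℝ ![CKY.Z1 g A e y, CKY.Z2 g A e y]) →
      ∀ e ∈ atlas CKY.E4 M, ∀ y ∈ e.target,
        VectorField.lieBracket ℝ (CKY.Z1 g A e) (CKY.Z2 g A e) y = 0) := by
  have hinv : ∀ e ∈ atlas CKY.E4 M, ∀ y ∈ e.target, CKY.InvariantAt g A e y := fun e he y hy =>
    CKY.invariantAt_chart hor hcurv hA hnull hRic he hy
  refine ⟨fun e he y hy => ⟨CKY.killing_Z1 hA hRic he y hy, CKY.killing_Z2 hA hRic he y hy,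
    (hinv e he y hy).1, (hinv e he y hy).2⟩, fun _ e he y hy => ?_⟩
  have h := CKY.metricOn_comp g he
  have s1 := CKY.smooth_Z1 g A he
  have s2 := CKY.smooth_Z2 g A he
  have sB := CKY.smM_lieDeriv h.isOpen s1 (A.smM_comp he)
  -- The second vector of the pair of L_{Z₁} A is [Z₁, Z₂]; since this tensor vanishes on the whole
  -- chart, the zero pair also serves, and uniqueness identifies the two.
  have e1 := h.codiffVec_hodge_of_pairEq sB hy (h.pairEq_lieDeriv (A.smM_comp he) s1 s1 s2
    (CKY.killing_Z1 hA hRic he) (CKY.pairEq_chart hA he) hy)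
  have e2 := h.codiffVec_hodge_of_pairEq sB hy
    (CKY.pairEq_of_eq_zero _ h.isOpen (fun x hx => (hinv e he x hx).1) hy)
  ext i
  exact congrFun (e1.symm.trans e2) i
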